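/- All objects are over a field $K$. Write $\Delta(c)=c_1\otimes c_2$ for comultiplications, $\varepsilon$ for counits. Let $H$ be a bialgebra. Let $A$ be a (unital associative) algebra that is also a coalgebra with $\varepsilon_A(1_A)=1$, and suppose that * $A$ is a left $H$-comodule coalgebra: there is a left coaction $A\to H\otimes A$, $a\mapsto a_{-1}\otimes a_0$, for which $\Delta_A,\varepsilon_A$ are comodule maps; * $\triangleright: H\otimes A\to A$ is a left weak action: $1_H\triangleright a=a$, $x\triangleright 1_A=\varepsilon(x)1_A$, $x\triangleright(aa')=(x_1\triangleright a)(x_2\triangleright a')$; * $\sigma:H\otimes H\to A$ is linear with $\varepsilon_A(\sigma(x,x'))=\varepsilon(x)\varepsilon(x')$ and $A\#^{\sigma}H$ is a left crossed product, i.e. $\sigma(x,1)=\sigma(1,x)=\varepsilon(x)1_A$, $(x_1\triangleright\sigma(x'_1,x''_1))\sigma(x_2,x'_2x''_2)=\sigma(x_1,x'_1)\sigma(x_2x'_2,x'')$, $(x_1\triangleright(x'_1\triangleright a))\sigma(x_2,x'_2)=\sigma(x_1,x'_1)(x_2x'_2\triangleright a)$. Let $B$ be an algebra that is also a coalgebra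 with $\varepsilon_B(1_B)=1$, and suppose that * $B$ is a right $H$-comodule coalgebra with coaction $b\mapsto b_{[0]}\otimes b_{[1]}\in B\otimes H$; * $\triangleleft: B\otimes H\to B$ is a right weak action: $b\triangleleft 1_H=b$, $1_B\triangleleft x=\varepsilon(x)1_B$, $(bb')\triangleleft x=(b\triangleleft x_1)(b'\triangleleft x_2)$; * $\tau:H\otimes H\to B$ is linear with $\varepsilon_B(\tau(x,x'))=\varepsilon(x)\varepsilon(x')$ and $H^{\tau}\#B$ is a right crossed product, i.e. $\tau(x,1)=\tau(1,x)=\varepsilon(x)1_B$, $\tau(x_1x'_1,x''_1)(\tau(x_2,x'_2)\triangleleft x''_2)=\tau(x,x'_1x''_1)\tau(x'_2,x''_2)$, $\tau(x'_1,x''_1)((b\triangleleft x'_2)\triangleleft x''_2)=(b\triangleleft x'_1x''_1)\tau(x'_2,x''_2)$. Then the space $A\otimes H\otimes B$ with the two-sided crossed product multiplication $$(a\otimes x\otimes b)(a'\otimes x'\otimes b')=a(x_1\triangleright a')\sigma(x_2,x'_1)\otimes x_3x'_2\otimes\tau(x_4,x'_3)(b\triangleleft x'_4)b',$$ unit $1_A\otimes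 1_H\otimes 1_B$, the two-sided smash coproduct $$\Delta(a\otimes x\otimes b)=a_1\otimes a_{2-1}x_1\otimes b_{1[0]}\otimes a_{20}\otimes x_2b_{1[1]}\otimes b_2$$ and counit $\varepsilon_A\otimes\varepsilon_H\otimes\varepsilon_B$ is a bialgebra if and only if the following conditions hold for all $a,a'\in A$, $b,b'\in B$, $x,x'\in H$ (where $a_{-11}\otimes a_{-12}=\Delta(a_{-1})$, $b_{[1]1}\otimes b_{[1]2}=\Delta(b_{[1]})$, and $b_{[0]}\otimes b_{[1]}\otimes b_{[2]}=b_{[0]}\otimes b_{[1]1}\otimes b_{[1]2}$): * (C1) $\varepsilon_A,\varepsilon_B$ are algebra maps; * (C2) $\Delta_A(1_A)=1_A\otimes 1_A$, $\Delta_B(1_B)=1_B\otimes 1_B$; * (C3) $1_{A\,-1}\otimes 1_{A\,0}=1_H\otimes 1_A$, $1_{B[0]}\otimes 1_{B[1]}=1_B\otimes 1_H$; * (C4) $\varepsilon_A(x\triangleright a)=\varepsilon_A(a)\varepsilon_H(x)$, $\varepsilon_B(b\triangleleft x)=\varepsilon_B(b)\varepsilon_H(x)$; * (C5) $a_1\otimes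 a_{2-1}x\otimes a_{20}=a_1\sigma(a_{2-11},x_1)\otimes a_{2-12}x_2\otimes a_{20}$; * (C6) $b_{1[0]}\otimes xb_{1[1]}\otimes b_2=b_{1[0]}\otimes x_1b_{1[1]}\otimes\tau(x_2,b_{1[2]})b_2$; * (D7) $(aa')_1\otimes(aa')_2=a_1(a_{2-11}\triangleright a'_1)\sigma(a_{2-12},a'_{2-1})\otimes a_{20}a'_{20}$; * (D8) $(aa')_{-1}\otimes(aa')_0=a_{-1}a'_{-1}\otimes a_0a'_0$; * (D9) $(bb')_1\otimes(bb')_2=b_{1[0]}b'_{1[0]}\otimes\tau(b_{1[1]},b'_{1[1]})(b_2\triangleleft b'_{1[2]})b'_2$; * (D10) $(bb')_{[0]}\otimes(bb')_{[1]}=b_{[0]}b'_{[0]}\otimes b_{[1]}b'_{[1]}$; * (D11) $\sigma(x_1,x'_1)_{-1}x_2x'_2\otimes\sigma(x_1,x'_1)_0=x_1x'_1\otimes\sigma(x_2,x'_2)$; * (D12) $\sigma(x,x')_1\otimes\sigma(x,x')_2=\sigma(x_1,x'_1)\otimes\sigma(x_2,x'_2)$; * (D13) $\tau(x_2,x'_2)_{[0]}\otimes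 x_1x'_1\tau(x_2,x'_2)_{[1]}=\tau(x_1,x'_1)\otimes x_2x'_2$; * (D14) $\tau(x,x')_1\otimes\tau(x,x')_2=\tau(x_1,x'_1)\otimes\tau(x_2,x'_2)$; * (D15) $(x\triangleright a)_1\otimes(x\triangleright a)_2=(x_1\triangleright a_1)\sigma(x_2,a_{2-1})\otimes x_3\triangleright a_{20}$; * (D16) $(x_1\triangleright a)_{-1}x_2\otimes(x_1\triangleright a)_0=x_1a_{-1}\otimes x_2\triangleright a_0$; * (D17) $(b\triangleleft x_2)_{[0]}\otimes x_1(b\triangleleft x_2)_{[1]}=b_{[0]}\triangleleft x_1\otimes b_{[1]}x_2$; * (D18) $(b\triangleleft x)_1\otimes(b\triangleleft x)_2=b_{1[0]}\triangleleft x_1\otimes\tau(b_{1[1]},x_2)(b_2\triangleleft x_3)$; * (D19) $a_{-1}x\otimes 1_B\otimes a_0=a_{-11}x_1\otimes\tau(a_{-12},x_2)\otimes a_0$; * (D20) $b_{[0]}\otimes 1_A\otimes xb_{[1]}=b_{[0]}\otimes\sigma(x_1,b_{[1]1})\otimes x_2b_{[1]2}$; * (D21) $b_{[1]}\triangleright a_0\otimes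 b_{[0]}\triangleleft a_{-1}=a\otimes b$; * (D22) $\tau(x_3,x'_2)(b\triangleleft x'_3)b'\otimes a(x_1\triangleright a')\sigma(x_2,x'_1)=\tau(a_{-1}x_1,a'_{-1}x'_1)(b_{[0]}\triangleleft x'_2)b'_{[0]}\otimes a_0(x_2\triangleright a'_0)\sigma(x_3b_{[1]},x'_3b'_{[1]})$. -/

import Mathlib

open scoped TensorProduct

universe u₁ u₂ u₃ u₄

namespace DoubleCrossed

/-! Sweedler notation -/

section Sweedler

variable {K M N P : Type*} [Field K] [AddCommGroup M] [Module K M] [AddCommGroup N] [Module K N]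
  [AddCommGroup P] [Module K P]

/-- Sweedler summation: if `t = ∑ mᵢ ⊗ nᵢ`, then `sweedler t f = ∑ f mᵢ nᵢ`. It is used only for
functions `f` that are bilinear, and for these the value does not depend on the way `t` is written
as a sum of pure tensors, see `sweedler_eq_lift` and `sweedler_eq_sum`. -/
noncomputable def sweedler (t : M ⊗[K] N) (f : M → N → P) : P :=
  ∑ p ∈ (TensorProduct.exists_finset t).choose, f p.1 p.2

theorem sweedler_eq_lift (t : M ⊗[K] N) (f : M →ₗ[K] N →ₗ[K] P) :
    sweedler t (fun m n => f m n) = TensorProduct.lift f t := by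
  conv_rhs => rw [(TensorProduct.exists_finset t).choose_spec]
  simp [sweedler]

theorem sweedler_eq_sum {ι : Type*} (s : Finset ι) (m : ι → M) (n : ι → N)
    (f : M →ₗ[K] N →ₗ[K] P) :
    sweedler (∑ i ∈ s, m i ⊗ₜ[K] n i) (fun m n => f m n) = ∑ i ∈ s, f (m i) (n i) := by
  simp [sweedler_eq_lift]

variable (K) {C : Type*} [AddCommGroup C] [Module K C] [Coalgebra K C]

/-- `Δ₂ K c f = f c₁ c₂` in Sweedler notation, `Δ(c) = c₁ ⊗ c₂`. -/
noncomputable def Δ₂ (c : C) (f : C → C → P) : P :=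
  sweedler (Coalgebra.comul (R := K) c) f

/-- `Δ₃ K c f = f c₁ c₂ c₃` in Sweedler notation. -/
noncomputable def Δ₃ (c : C) (f : C → C → C → P) : P :=
  Δ₂ K c fun c₁ d => Δ₂ K d fun c₂ c₃ => f c₁ c₂ c₃

/-- `Δ₄ K c f = f c₁ c₂ c₃ c₄` in Sweedler notation. -/
noncomputable def Δ₄ (c : C) (f : C → C → C → C → P) : P :=
  Δ₂ K c fun c₁ d => Δ₃ K d fun c₂ c₃ c₄ => f c₁ c₂ c₃ c₄

end Sweedler

/-! Comodule coalgebras and weak actions -/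

/-- A left `H`-comodule coalgebra structure on the coalgebra `A`:
a left coaction `a ↦ a₋₁ ⊗ a₀` for which `Δ_A` and `ε_A` are maps of left `H`-comodules. -/
structure LeftComoduleCoalgebra (K H A : Type*) [Field K] [Ring H] [Bialgebra K H]
    [AddCommGroup A] [Module K A] [Coalgebra K A] where
  /-- the coaction `a ↦ a₋₁ ⊗ a₀` -/
  coact : A →ₗ[K] H ⊗[K] A
  coassoc : ∀ a : A, TensorProduct.assoc K H H A
      ((Coalgebra.comul (R := K) (A := H)).rTensor A (coact a)) = coact.lTensor H (coact a)
  counit_coact : ∀ a : A,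
      (Coalgebra.counit (R := K) (A := H)).rTensor A (coact a) = (1 : K) ⊗ₜ[K] a
  /-- `a₋₁ ⊗ a₀₁ ⊗ a₀₂ = a₁₋₁ a₂₋₁ ⊗ a₁₀ ⊗ a₂₀` -/
  coact_comul : ∀ a : A,
      (Coalgebra.comul (R := K) (A := A)).lTensor H (coact a) =
      Δ₂ K a fun a₁ a₂ => sweedler (coact a₁) fun h a₁₀ => sweedler (coact a₂) fun k a₂₀ =>
        (h * k) ⊗ₜ[K] (a₁₀ ⊗ₜ[K] a₂₀)
  /-- `a₋₁ ε(a₀) = ε(a) 1` -/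
  coact_counit : ∀ a : A,
      (sweedler (coact a) fun h a₀ => Coalgebra.counit (R := K) a₀ • h) =
        Coalgebra.counit (R := K) a • (1 : H)

/-- A right `H`-comodule coalgebra structure on the coalgebra `B`:
a right coaction `b ↦ b₍₀₎ ⊗ b₍₁₎` for which `Δ_B` and `ε_B` are maps of right `H`-comodules. -/
structure RightComoduleCoalgebra (K H B : Type*) [Field K] [Ring H] [Bialgebra K H]
    [AddCommGroup B] [Module K B] [Coalgebra K B] where
  /-- the coaction `b ↦ b₍₀₎ ⊗ b₍₁₎` -/
  coact : B →ₗ[K] B ⊗[K] H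
  coassoc : ∀ b : B, TensorProduct.assoc K B H H (coact.rTensor H (coact b)) =
      (Coalgebra.comul (R := K) (A := H)).lTensor B (coact b)
  counit_coact : ∀ b : B,
      (Coalgebra.counit (R := K) (A := H)).lTensor B (coact b) = b ⊗ₜ[K] (1 : K)
  /-- `b₍₀₎₁ ⊗ b₍₀₎₂ ⊗ b₍₁₎ = b₁₍₀₎ ⊗ b₂₍₀₎ ⊗ b₁₍₁₎ b₂₍₁₎` -/
  coact_comul : ∀ b : B,
      (Coalgebra.comul (R := K) (A := B)).rTensor H (coact b) =
      Δ₂ K b fun b₁ b₂ => sweedler (coact b₁) fun b₁₀ h => sweedler (coact b₂) fun b₂₀ k =>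
        (b₁₀ ⊗ₜ[K] b₂₀) ⊗ₜ[K] (h * k)
  /-- `ε(b₍₀₎) b₍₁₎ = ε(b) 1` -/
  coact_counit : ∀ b : B,
      (sweedler (coact b) fun b₀ h => Coalgebra.counit (R := K) b₀ • h) =
        Coalgebra.counit (R := K) b • (1 : H)

/-- A left weak action `x ▷ a` of `H` on the algebra `A`. -/
structure LeftWeakAction (K H A : Type*) [Field K] [Ring H] [Bialgebra K H]
    [Ring A] [Algebra K A] where
  /-- the map `x ↦ a ↦ x ▷ a` -/
  act : H →ₗ[K] A →ₗ[K] A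
  one_act : ∀ a : A, act 1 a = a
  act_one : ∀ x : H, act x 1 = Coalgebra.counit (R := K) x • (1 : A)
  act_mul : ∀ (x : H) (a a' : A), act x (a * a') = Δ₂ K x fun x₁ x₂ => act x₁ a * act x₂ a'

/-- A right weak action `b ◁ x` of `H` on the algebra `B`. -/
structure RightWeakAction (K H B : Type*) [Field K] [Ring H] [Bialgebra K H]
    [Ring B] [Algebra K B] where
  /-- the map `b ↦ x ↦ b ◁ x` -/
  act : B →ₗ[K] H →ₗ[K] B
  act_one : ∀ b : B, act b 1 = b
  one_act : ∀ x : H, act 1 x = Coalgebra.counit (R := K) x • (1 : B)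
  mul_act : ∀ (b b' : B) (x : H), act (b * b') x = Δ₂ K x fun x₁ x₂ => act b x₁ * act b' x₂

/-! Crossed products -/

/-- `σ : H ⊗ H → A` (written as a bilinear map) and the left weak action `▷` form a left crossed
product `A #^σ H`: `σ` is normalized, it is a 2-cocycle, and `A` is a twisted `H`-module. These are
the conditions under which
`(a ⊗ x)(a' ⊗ x') = a (x₁ ▷ a') σ(x₂, x'₁) ⊗ x₃ x'₂`
is an associative multiplication on `A ⊗ H` with unit `1 ⊗ 1`. -/
structure IsLeftCrossedProduct {K H A : Type*} [Field K] [Ring H] [Bialgebra K H]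
    [Ring A] [Algebra K A] (act : H →ₗ[K] A →ₗ[K] A) (σ : H →ₗ[K] H →ₗ[K] A) : Prop where
  map_one_right : ∀ x : H, σ x 1 = Coalgebra.counit (R := K) x • (1 : A)
  map_one_left : ∀ x : H, σ 1 x = Coalgebra.counit (R := K) x • (1 : A)
  cocycle : ∀ x x' x'' : H,
    (Δ₂ K x fun x₁ x₂ => Δ₂ K x' fun x'₁ x'₂ => Δ₂ K x'' fun x''₁ x''₂ =>
      act x₁ (σ x'₁ x''₁) * σ x₂ (x'₂ * x''₂)) =
    Δ₂ K x fun x₁ x₂ => Δ₂ K x' fun x'₁ x'₂ => σ x₁ x'₁ * σ (x₂ * x'₂) x''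
  twisted_module : ∀ (x x' : H) (a : A),
    (Δ₂ K x fun x₁ x₂ => Δ₂ K x' fun x'₁ x'₂ => act x₁ (act x'₁ a) * σ x₂ x'₂) =
    Δ₂ K x fun x₁ x₂ => Δ₂ K x' fun x'₁ x'₂ => σ x₁ x'₁ * act (x₂ * x'₂) a

/-- `τ : H ⊗ H → B` (written as a bilinear map) and the right weak action `◁` form a right crossed
product `H ^τ# B`: the conditions under which
`(x ⊗ b)(x' ⊗ b') = x₁ x'₁ ⊗ τ(x₂, x'₂) (b ◁ x'₃) b'`
is an associative multiplication on `H ⊗ B` with unit `1 ⊗ 1`. -/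
structure IsRightCrossedProduct {K H B : Type*} [Field K] [Ring H] [Bialgebra K H]
    [Ring B] [Algebra K B] (act : B →ₗ[K] H →ₗ[K] B) (τ : H →ₗ[K] H →ₗ[K] B) : Prop where
  map_one_right : ∀ x : H, τ x 1 = Coalgebra.counit (R := K) x • (1 : B)
  map_one_left : ∀ x : H, τ 1 x = Coalgebra.counit (R := K) x • (1 : B)
  cocycle : ∀ x x' x'' : H,
    (Δ₂ K x fun x₁ x₂ => Δ₂ K x' fun x'₁ x'₂ => Δ₂ K x'' fun x''₁ x''₂ =>
      τ (x₁ * x'₁) x''₁ * act (τ x₂ x'₂) x''₂) =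
    Δ₂ K x' fun x'₁ x'₂ => Δ₂ K x'' fun x''₁ x''₂ => τ x (x'₁ * x''₁) * τ x'₂ x''₂
  twisted_module : ∀ (x' x'' : H) (b : B),
    (Δ₂ K x' fun x'₁ x'₂ => Δ₂ K x'' fun x''₁ x''₂ => τ x'₁ x''₁ * act (act b x'₂) x''₂) =
    Δ₂ K x' fun x'₁ x'₂ => Δ₂ K x'' fun x''₁ x''₂ => act b (x'₁ * x''₁) * τ x'₂ x''₂

/-! The two-sided crossed product and the two-sided smash coproduct on `A ⊗ H ⊗ B` -/

/-- The product of `a ⊗ x ⊗ b` and `a' ⊗ x' ⊗ b'` in the two-sided crossed product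
`A #^σ H ^τ# B`:
`a (x₁ ▷ a') σ(x₂, x'₁) ⊗ x₃ x'₂ ⊗ τ(x₄, x'₃) (b ◁ x'₄) b'`. -/
noncomputable def crossedMul {K H A B : Type*} [Field K] [Ring H] [Bialgebra K H]
    [Ring A] [Algebra K A] [Ring B] [Algebra K B] (actA : H →ₗ[K] A →ₗ[K] A) (actB : B →ₗ[K] H →ₗ[K] B)
    (σ : H →ₗ[K] H →ₗ[K] A) (τ : H →ₗ[K] H →ₗ[K] B)
    (a : A) (x : H) (b : B) (a' : A) (x' : H) (b' : B) : A ⊗[K] (H ⊗[K] B) :=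
  Δ₄ K x fun x₁ x₂ x₃ x₄ => Δ₄ K x' fun x'₁ x'₂ x'₃ x'₄ =>
    (a * actA x₁ a' * σ x₂ x'₁) ⊗ₜ[K] ((x₃ * x'₂) ⊗ₜ[K] (τ x₄ x'₃ * actB b x'₄ * b'))

/-- The coproduct of `a ⊗ x ⊗ b` in the two-sided smash coproduct `A × H × B`:
`(a₁ ⊗ a₂₋₁ x₁ ⊗ b₁₍₀₎) ⊗ (a₂₀ ⊗ x₂ b₁₍₁₎ ⊗ b₂)`. -/
noncomputable def smashComul {K H A B : Type*} [Field K] [Ring H] [Bialgebra K H]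
    [AddCommGroup A] [Module K A] [Coalgebra K A] [AddCommGroup B] [Module K B] [Coalgebra K B]
    (coactA : A →ₗ[K] H ⊗[K] A) (coactB : B →ₗ[K] B ⊗[K] H)
    (a : A) (x : H) (b : B) : (A ⊗[K] (H ⊗[K] B)) ⊗[K] (A ⊗[K] (H ⊗[K] B)) :=
  Δ₂ K a fun a₁ a₂ => sweedler (coactA a₂) fun h a₂₀ => Δ₂ K x fun x₁ x₂ =>
  Δ₂ K b fun b₁ b₂ => sweedler (coactB b₁) fun b₁₀ k =>
    (a₁ ⊗ₜ[K] ((h * x₁) ⊗ₜ[K] b₁₀)) ⊗ₜ[K] (a₂₀ ⊗ₜ[K] ((x₂ * k) ⊗ₜ[K] b₂))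

/-- The two-sided crossed product `A #^σ H ^τ# B` equipped with the two-sided smash coproduct
`A × H × B` is a bialgebra: there is a `K`-bialgebra `E` and a linear isomorphism `e` from
`A ⊗ H ⊗ B` to `E` that carries the crossed multiplication, the element `1 ⊗ 1 ⊗ 1`, the smash
comultiplication and the counit `ε_A ⊗ ε_H ⊗ ε_B` to the multiplication, the unit, the
comultiplication and the counit of `E`. -/
def IsDoubleCrossedBiproduct
    {K : Type u₁} {H : Type u₂} {A : Type u₃} {B : Type u₄} [Field K] [Ring H] [Bialgebra K H]
    [Ring A] [Algebra K A] [Coalgebra K A] [Ring B] [Algebra K B] [Coalgebra K B]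
    (coactA : A →ₗ[K] H ⊗[K] A) (coactB : B →ₗ[K] B ⊗[K] H)
    (actA : H →ₗ[K] A →ₗ[K] A) (actB : B →ₗ[K] H →ₗ[K] B)
    (σ : H →ₗ[K] H →ₗ[K] A) (τ : H →ₗ[K] H →ₗ[K] B) : Prop :=
  ∃ (E : Type (max u₂ u₃ u₄)) (_ : Ring E) (_ : Bialgebra K E)
    (e : (A ⊗[K] (H ⊗[K] B)) ≃ₗ[K] E),
    (∀ (a : A) (x : H) (b : B) (a' : A) (x' : H) (b' : B),
      e (a ⊗ₜ[K] (x ⊗ₜ[K] b)) * e (a' ⊗ₜ[K] (x' ⊗ₜ[K] b')) =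
        e (crossedMul actA actB σ τ a x b a' x' b')) ∧
    e (1 ⊗ₜ[K] (1 ⊗ₜ[K] 1)) = 1 ∧
    (∀ (a : A) (x : H) (b : B),
      Coalgebra.comul (R := K) (e (a ⊗ₜ[K] (x ⊗ₜ[K] b))) =
        TensorProduct.map e.toLinearMap e.toLinearMap (smashComul coactA coactB a x b)) ∧
    (∀ (a : A) (x : H) (b : B),
      Coalgebra.counit (R := K) (e (a ⊗ₜ[K] (x ⊗ₜ[K] b))) =
        Coalgebra.counit (R := K) a * Coalgebra.counit (R := K) x * Coalgebra.counit (R := K) b)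

/-! The compatibility conditions -/

/-- The list of compatibility conditions between the structure maps
`coactA a = a₋₁ ⊗ a₀`, `coactB b = b₍₀₎ ⊗ b₍₁₎`, `actA x a = x ▷ a`, `actB b x = b ◁ x`, `σ`, `τ`.
In the code `h`, `h'` stand for the component in `H` of `coactA` and `k`, `k'` for that of
`coactB`. -/
structure CompatibilityConditions {K H A B : Type*} [Field K] [Ring H] [Bialgebra K H]
    [Ring A] [Algebra K A] [Coalgebra K A] [Ring B] [Algebra K B] [Coalgebra K B]
    (coactA : A →ₗ[K] H ⊗[K] A) (coactB : B →ₗ[K] B ⊗[K] H)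
    (actA : H →ₗ[K] A →ₗ[K] A) (actB : B →ₗ[K] H →ₗ[K] B)
    (σ : H →ₗ[K] H →ₗ[K] A) (τ : H →ₗ[K] H →ₗ[K] B) : Prop where
  /-- `ε_A` is an algebra map -/
  counit_algA : Coalgebra.counit (R := K) (1 : A) = 1 ∧ ∀ a a' : A,
    Coalgebra.counit (R := K) (a * a') = Coalgebra.counit (R := K) a * Coalgebra.counit (R := K) a'
  /-- `ε_B` is an algebra map -/
  counit_algB : Coalgebra.counit (R := K) (1 : B) = 1 ∧ ∀ b b' : B,
    Coalgebra.counit (R := K) (b * b') = Coalgebra.counit (R := K) b * Coalgebra.counit (R := K) b'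
  /-- `Δ(1_A) = 1_A ⊗ 1_A` -/
  comul_oneA : Coalgebra.comul (R := K) (1 : A) = 1 ⊗ₜ[K] 1
  /-- `Δ(1_B) = 1_B ⊗ 1_B` -/
  comul_oneB : Coalgebra.comul (R := K) (1 : B) = 1 ⊗ₜ[K] 1
  /-- `(1_A)₋₁ ⊗ (1_A)₀ = 1_H ⊗ 1_A` -/
  coact_oneA : coactA 1 = 1 ⊗ₜ[K] 1
  /-- `(1_B)₍₀₎ ⊗ (1_B)₍₁₎ = 1_B ⊗ 1_H` -/
  coact_oneB : coactB 1 = 1 ⊗ₜ[K] 1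
  /-- `ε(x ▷ a) = ε(a) ε(x)` -/
  counit_actA : ∀ (x : H) (a : A), Coalgebra.counit (R := K) (actA x a) =
    Coalgebra.counit (R := K) a * Coalgebra.counit (R := K) x
  /-- `ε(b ◁ x) = ε(b) ε(x)` -/
  counit_actB : ∀ (b : B) (x : H), Coalgebra.counit (R := K) (actB b x) =
    Coalgebra.counit (R := K) b * Coalgebra.counit (R := K) x
  /-- `a₁ ⊗ a₂₋₁ x ⊗ a₂₀ = a₁ σ(a₂₋₁₁, x₁) ⊗ a₂₋₁₂ x₂ ⊗ a₂₀` -/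
  twisted_comoduleA : ∀ (a : A) (x : H),
    (Δ₂ K a fun a₁ a₂ => sweedler (coactA a₂) fun h a₂₀ =>
      a₁ ⊗ₜ[K] ((h * x) ⊗ₜ[K] a₂₀)) =
    Δ₂ K a fun a₁ a₂ => sweedler (coactA a₂) fun h a₂₀ => Δ₂ K h fun h₁ h₂ => Δ₂ K x fun x₁ x₂ =>
      (a₁ * σ h₁ x₁) ⊗ₜ[K] ((h₂ * x₂) ⊗ₜ[K] a₂₀)
  /-- `b₁₍₀₎ ⊗ x b₁₍₁₎ ⊗ b₂ = b₁₍₀₎ ⊗ x₁ b₁₍₁₎ ⊗ τ(x₂, b₁₍₂₎) b₂` -/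
  twisted_comoduleB : ∀ (b : B) (x : H),
    (Δ₂ K b fun b₁ b₂ => sweedler (coactB b₁) fun b₁₀ k =>
      b₁₀ ⊗ₜ[K] ((x * k) ⊗ₜ[K] b₂)) =
    Δ₂ K b fun b₁ b₂ => sweedler (coactB b₁) fun b₁₀ k => Δ₂ K x fun x₁ x₂ => Δ₂ K k fun k₁ k₂ =>
      b₁₀ ⊗ₜ[K] ((x₁ * k₁) ⊗ₜ[K] (τ x₂ k₂ * b₂))
  /-- `(aa')₁ ⊗ (aa')₂ = a₁ (a₂₋₁₁ ▷ a'₁) σ(a₂₋₁₂, a'₂₋₁) ⊗ a₂₀ a'₂₀` -/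
  comul_mulA : ∀ a a' : A, Coalgebra.comul (R := K) (a * a') =
    Δ₂ K a fun a₁ a₂ => Δ₂ K a' fun a'₁ a'₂ =>
    sweedler (coactA a₂) fun h a₂₀ => sweedler (coactA a'₂) fun h' a'₂₀ => Δ₂ K h fun h₁ h₂ =>
      (a₁ * actA h₁ a'₁ * σ h₂ h') ⊗ₜ[K] (a₂₀ * a'₂₀)
  /-- `(aa')₋₁ ⊗ (aa')₀ = a₋₁ a'₋₁ ⊗ a₀ a'₀` -/
  coact_mulA : ∀ a a' : A, coactA (a * a') =
    sweedler (coactA a) fun h a₀ => sweedler (coactA a') fun h' a'₀ =>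
      (h * h') ⊗ₜ[K] (a₀ * a'₀)
  /-- `(bb')₁ ⊗ (bb')₂ = b₁₍₀₎ b'₁₍₀₎ ⊗ τ(b₁₍₁₎, b'₁₍₁₎) (b₂ ◁ b'₁₍₂₎) b'₂` -/
  comul_mulB : ∀ b b' : B, Coalgebra.comul (R := K) (b * b') =
    Δ₂ K b fun b₁ b₂ => Δ₂ K b' fun b'₁ b'₂ =>
    sweedler (coactB b₁) fun b₁₀ k => sweedler (coactB b'₁) fun b'₁₀ k' => Δ₂ K k' fun k'₁ k'₂ =>
      (b₁₀ * b'₁₀) ⊗ₜ[K] (τ k k'₁ * actB b₂ k'₂ * b'₂)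
  /-- `(bb')₍₀₎ ⊗ (bb')₍₁₎ = b₍₀₎ b'₍₀₎ ⊗ b₍₁₎ b'₍₁₎` -/
  coact_mulB : ∀ b b' : B, coactB (b * b') =
    sweedler (coactB b) fun b₀ k => sweedler (coactB b') fun b'₀ k' =>
      (b₀ * b'₀) ⊗ₜ[K] (k * k')
  /-- `σ(x₁, x'₁)₋₁ x₂ x'₂ ⊗ σ(x₁, x'₁)₀ = x₁ x'₁ ⊗ σ(x₂, x'₂)` -/
  coact_σ : ∀ x x' : H,
    (Δ₂ K x fun x₁ x₂ => Δ₂ K x' fun x'₁ x'₂ => sweedler (coactA (σ x₁ x'₁)) fun h s₀ =>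
      (h * x₂ * x'₂) ⊗ₜ[K] s₀) =
    Δ₂ K x fun x₁ x₂ => Δ₂ K x' fun x'₁ x'₂ => (x₁ * x'₁) ⊗ₜ[K] σ x₂ x'₂
  /-- `σ(x, x')₁ ⊗ σ(x, x')₂ = σ(x₁, x'₁) ⊗ σ(x₂, x'₂)` -/
  comul_σ : ∀ x x' : H, Coalgebra.comul (R := K) (σ x x') =
    Δ₂ K x fun x₁ x₂ => Δ₂ K x' fun x'₁ x'₂ => σ x₁ x'₁ ⊗ₜ[K] σ x₂ x'₂
  /-- `τ(x₂, x'₂)₍₀₎ ⊗ x₁ x'₁ τ(x₂, x'₂)₍₁₎ = τ(x₁, x'₁) ⊗ x₂ x'₂` -/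
  coact_τ : ∀ x x' : H,
    (Δ₂ K x fun x₁ x₂ => Δ₂ K x' fun x'₁ x'₂ => sweedler (coactB (τ x₂ x'₂)) fun t₀ k =>
      t₀ ⊗ₜ[K] (x₁ * x'₁ * k)) =
    Δ₂ K x fun x₁ x₂ => Δ₂ K x' fun x'₁ x'₂ => τ x₁ x'₁ ⊗ₜ[K] (x₂ * x'₂)
  /-- `τ(x, x')₁ ⊗ τ(x, x')₂ = τ(x₁, x'₁) ⊗ τ(x₂, x'₂)` -/
  comul_τ : ∀ x x' : H, Coalgebra.comul (R := K) (τ x x') =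
    Δ₂ K x fun x₁ x₂ => Δ₂ K x' fun x'₁ x'₂ => τ x₁ x'₁ ⊗ₜ[K] τ x₂ x'₂
  /-- `(x ▷ a)₁ ⊗ (x ▷ a)₂ = (x₁ ▷ a₁) σ(x₂, a₂₋₁) ⊗ x₃ ▷ a₂₀` -/
  comul_actA : ∀ (x : H) (a : A), Coalgebra.comul (R := K) (actA x a) =
    Δ₃ K x fun x₁ x₂ x₃ => Δ₂ K a fun a₁ a₂ => sweedler (coactA a₂) fun h a₂₀ =>
      (actA x₁ a₁ * σ x₂ h) ⊗ₜ[K] actA x₃ a₂₀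
  /-- `(x₁ ▷ a)₋₁ x₂ ⊗ (x₁ ▷ a)₀ = x₁ a₋₁ ⊗ x₂ ▷ a₀` -/
  coact_actA : ∀ (x : H) (a : A),
    (Δ₂ K x fun x₁ x₂ => sweedler (coactA (actA x₁ a)) fun h c₀ => (h * x₂) ⊗ₜ[K] c₀) =
    Δ₂ K x fun x₁ x₂ => sweedler (coactA a) fun h a₀ => (x₁ * h) ⊗ₜ[K] actA x₂ a₀
  /-- `(b ◁ x₂)₍₀₎ ⊗ x₁ (b ◁ x₂)₍₁₎ = b₍₀₎ ◁ x₁ ⊗ b₍₁₎ x₂` -/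
  coact_actB : ∀ (b : B) (x : H),
    (Δ₂ K x fun x₁ x₂ => sweedler (coactB (actB b x₂)) fun c₀ k => c₀ ⊗ₜ[K] (x₁ * k)) =
    Δ₂ K x fun x₁ x₂ => sweedler (coactB b) fun b₀ k => actB b₀ x₁ ⊗ₜ[K] (k * x₂)
  /-- `(b ◁ x)₁ ⊗ (b ◁ x)₂ = b₁₍₀₎ ◁ x₁ ⊗ τ(b₁₍₁₎, x₂) (b₂ ◁ x₃)` -/
  comul_actB : ∀ (b : B) (x : H), Coalgebra.comul (R := K) (actB b x) =
    Δ₂ K b fun b₁ b₂ => sweedler (coactB b₁) fun b₁₀ k => Δ₃ K x fun x₁ x₂ x₃ =>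
      actB b₁₀ x₁ ⊗ₜ[K] (τ k x₂ * actB b₂ x₃)
  /-- `a₋₁ x ⊗ 1_B ⊗ a₀ = a₋₁₁ x₁ ⊗ τ(a₋₁₂, x₂) ⊗ a₀` -/
  coactA_τ : ∀ (a : A) (x : H),
    (sweedler (coactA a) fun h a₀ => (h * x) ⊗ₜ[K] ((1 : B) ⊗ₜ[K] a₀)) =
    sweedler (coactA a) fun h a₀ => Δ₂ K h fun h₁ h₂ => Δ₂ K x fun x₁ x₂ =>
      (h₁ * x₁) ⊗ₜ[K] (τ h₂ x₂ ⊗ₜ[K] a₀)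
  /-- `b₍₀₎ ⊗ 1_A ⊗ x b₍₁₎ = b₍₀₎ ⊗ σ(x₁, b₍₁₎₁) ⊗ x₂ b₍₁₎₂` -/
  coactB_σ : ∀ (b : B) (x : H),
    (sweedler (coactB b) fun b₀ k => b₀ ⊗ₜ[K] ((1 : A) ⊗ₜ[K] (x * k))) =
    sweedler (coactB b) fun b₀ k => Δ₂ K x fun x₁ x₂ => Δ₂ K k fun k₁ k₂ =>
      b₀ ⊗ₜ[K] (σ x₁ k₁ ⊗ₜ[K] (x₂ * k₂))
  /-- `b₍₁₎ ▷ a₀ ⊗ b₍₀₎ ◁ a₋₁ = a ⊗ b` -/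
  double : ∀ (a : A) (b : B),
    (sweedler (coactA a) fun h a₀ => sweedler (coactB b) fun b₀ k =>
      actA k a₀ ⊗ₜ[K] actB b₀ h) = a ⊗ₜ[K] b
  /-- `τ(x₃, x'₂) (b ◁ x'₃) b' ⊗ a (x₁ ▷ a') σ(x₂, x'₁)
  = τ(a₋₁ x₁, a'₋₁ x'₁) (b₍₀₎ ◁ x'₂) b'₍₀₎ ⊗ a₀ (x₂ ▷ a'₀) σ(x₃ b₍₁₎, x'₃ b'₍₁₎)` -/
  exchange : ∀ (a a' : A) (x x' : H) (b b' : B),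
    (Δ₃ K x fun x₁ x₂ x₃ => Δ₃ K x' fun x'₁ x'₂ x'₃ =>
      (τ x₃ x'₂ * actB b x'₃ * b') ⊗ₜ[K] (a * actA x₁ a' * σ x₂ x'₁)) =
    sweedler (coactA a) fun h a₀ => sweedler (coactA a') fun h' a'₀ =>
    sweedler (coactB b) fun b₀ k => sweedler (coactB b') fun b'₀ k' =>
    Δ₃ K x fun x₁ x₂ x₃ => Δ₃ K x' fun x'₁ x'₂ x'₃ =>
      (τ (h * x₁) (h' * x'₁) * actB b₀ x'₂ * b'₀) ⊗ₜ[K]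
        (a₀ * actA x₂ a'₀ * σ (x₃ * k) (x'₃ * k'))

end DoubleCrossed

/-!
Write `a`, `x`, `b` for the elements `a ⊗ 1 ⊗ 1`, `1 ⊗ x ⊗ 1`, `1 ⊗ 1 ⊗ b` of the two-sided crossed
product `E = A ⊗ H ⊗ B`. The products `a a'`, `b b'` are those of `A` and `B`, and
`a x b = a ⊗ x ⊗ b`, `b a = a b`, `x a = (x₁ ▷ a) x₂`, `b x = x₁ (b ◁ x₂)`,
`x x' = σ(x₁, x'₁) (x₂ x'₂) τ(x₃, x'₃)`, where `x₂ x'₂` is the product of `H`.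

*The algebra and the coalgebra.* The algebra `E` exists without any compatibility condition: the map
`a ⊗ x ⊗ b ↦ (a ⊗ x₁) ⊗ (x₂ ⊗ b)` identifies it with a subalgebra of `(A #^σ H) ⊗ (H ^τ# B)`, and
the two crossed products are associative by the cocycle and twisted module conditions. The smash
coproduct is coassociative and counital since `A` and `B` are comodule coalgebras. So only the
compatibility of `Δ` and `ε` with products and units is at stake.

*A bialgebra satisfies the conditions.* The counits give projections of `E` to its tensor factors.
The conditions on `ε` and on units are immediate. Applying two projections to `Δ(uv) = Δ(u)Δ(v)`,
with `u` and `v` in the subspaces `A`, `H`, `B`, gives one condition at a time. The exchange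
condition is the exception: it comes from arbitrary `u` and `v`, projected to `B ⊗ A`, and the
outcome still has coactions of `a'` and `b` in the arguments of the actions. By
`RightWeakAction.sweedler_act_mul` and `LeftWeakAction.sweedler_mul_act`, a coaction that absorbs
the cocycle turns a weak action into an action, after which `b₍₁₎ ▷ a₀ ⊗ b₍₀₎ ◁ a₋₁ = a ⊗ b`
removes these coactions.

*The conditions give a bialgebra.* Coactions absorb both cocycles (`absorb_left`, `absorb_right`),
so that `Δ(a x b) = Δ(a)Δ(x)Δ(b)`. Each of the six products `a a'`, `b b'`, `x x'`, `b a`, `x a`,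
`b x` is then treated separately; the product `x x'` is an instance of a general fact about
convolution products, `comul_convolution`. The rules above for reordering factors reduce `Δ(uv)`
to these six cases, see `CompatibilityConditions.comul_mul`. The counit is multiplicative because it
is the counit of `A` after the projection to `A`.
-/

namespace DoubleCrossed

/-! ### Linear expressions in Sweedler notation -/

-- Every identity between Sweedler sums is used for expressions that are linear in each variable.
-- These linearity conditions are stated with `IsLinearMap` and discharged by `fun_prop`.
attribute [fun_prop] IsLinearMap

section Calculus

variable {K M N P Q R S : Type*} [Field K] [AddCommGroup M] [Module K M] [AddCommGroup N]
  [Module K N] [AddCommGroup P] [Module K P] [AddCommGroup Q] [Module K Q] [AddCommGroup R]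
  [Module K R] [AddCommGroup S] [Module K S]

@[fun_prop] theorem isLinearMap_id : IsLinearMap K fun x : M => x :=
  ⟨fun _ _ => rfl, fun _ _ => rfl⟩

@[fun_prop] theorem isLinearMap_comp {g : N → P} {f : M → N} (hg : IsLinearMap K g)
    (hf : IsLinearMap K f) : IsLinearMap K fun x => g (f x) :=
  ⟨fun _ _ => by rw [hf.map_add, hg.map_add], fun _ _ => by rw [hf.map_smul, hg.map_smul]⟩

@[fun_prop] theorem isLinearMap_linearMap (g : M →ₗ[K] N) : IsLinearMap K fun x => g x :=
  ⟨map_add g, map_smul g⟩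

@[fun_prop] theorem isLinearMap_linearEquiv (g : M ≃ₗ[K] N) : IsLinearMap K fun x => g x :=
  ⟨map_add g, map_smul g⟩

@[fun_prop] theorem isLinearMap_bilin_left (g : M →ₗ[K] N →ₗ[K] P) (y : N) :
    IsLinearMap K fun x => g x y := ⟨by simp, by simp⟩

@[fun_prop] theorem isLinearMap_tmul_left (n : N) : IsLinearMap K fun x : M => x ⊗ₜ[K] n :=
  ⟨fun _ _ => TensorProduct.add_tmul _ _ _, fun _ _ => (TensorProduct.smul_tmul' _ _ _).symm⟩

@[fun_prop] theorem isLinearMap_tmul_right (m : M) : IsLinearMap K fun x : N => m ⊗ₜ[K] x :=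
  ⟨fun _ _ => TensorProduct.tmul_add _ _ _, fun _ _ => TensorProduct.tmul_smul _ _ _⟩

@[fun_prop] theorem isLinearMap_const_smul (c : K) : IsLinearMap K fun x : M => c • x :=
  ⟨smul_add c, fun _ _ => smul_comm _ _ _⟩

@[fun_prop] theorem isLinearMap_smul_const (x : M) : IsLinearMap K fun c : K => c • x :=
  ⟨fun _ _ => add_smul _ _ _, fun _ _ => by simp [mul_smul]⟩

@[fun_prop] theorem isLinearMap_mul_const {A : Type*} [Ring A] [Algebra K A] (c : A) :
    IsLinearMap K fun x : A => x * c := ⟨fun _ _ => add_mul _ _ _, fun _ _ => smul_mul_assoc _ _ _⟩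

@[fun_prop] theorem isLinearMap_const_mul {A : Type*} [Ring A] [Algebra K A] (c : A) :
    IsLinearMap K fun x : A => c * x := ⟨fun _ _ => mul_add _ _ _, fun _ _ => mul_smul_comm _ _ _⟩

@[fun_prop] theorem isLinearMap_sweedler {t : M ⊗[K] N} {f : Q → M → N → P}
    (h : ∀ m n, IsLinearMap K fun x => f x m n) :
    IsLinearMap K fun x => sweedler t fun m n => f x m n :=
  ⟨fun x y => by simp [sweedler, (h _ _).map_add, Finset.sum_add_distrib],
    fun x y => by simp [sweedler, (h _ _).map_smul, Finset.smul_sum]⟩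

/-- Two linear expressions in an element of a tensor product agree if they agree on pure tensors. -/
theorem eq_of_tmul (t : M ⊗[K] N) {f g : M ⊗[K] N → P} (hf : IsLinearMap K f) (hg : IsLinearMap K g)
    (h : ∀ m n, f (m ⊗ₜ n) = g (m ⊗ₜ n)) : f t = g t :=
  DFunLike.congr_fun (TensorProduct.ext' h : hf.mk' = hg.mk') t

/-- The bundled form of a function of two variables that is linear in each of them. -/
def bilin (f : M → N → P) (h₁ : ∀ n, IsLinearMap K fun m => f m n)
    (h₂ : ∀ m, IsLinearMap K fun n => f m n) : M →ₗ[K] N →ₗ[K] P :=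
  LinearMap.mk₂ K f (fun x y n => (h₁ n).map_add x y) (fun c x n => (h₁ n).map_smul c x)
    (fun m x y => (h₂ m).map_add x y) (fun c m x => (h₂ m).map_smul c x)

theorem bilin_apply (f : M → N → P) (h₁ : ∀ n, IsLinearMap K fun m => f m n)
    (h₂ : ∀ m, IsLinearMap K fun n => f m n) (m : M) (n : N) : bilin f h₁ h₂ m n = f m n := rfl

section Bilinear

variable (f : M → N → P) (h₁ : ∀ n, IsLinearMap K fun m => f m n)
  (h₂ : ∀ m, IsLinearMap K fun n => f m n)
include h₁ h₂

theorem sweedler_eq_lift_bilin (t : M ⊗[K] N) :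
    (sweedler t fun m n => f m n) = TensorProduct.lift (bilin f h₁ h₂) t :=
  sweedler_eq_lift t (bilin f h₁ h₂)

@[fun_prop] theorem isLinearMap_sweedler_left :
    IsLinearMap K fun t : M ⊗[K] N => sweedler t fun m n => f m n := by
  simp only [sweedler_eq_lift_bilin f h₁ h₂]
  exact isLinearMap_linearMap _

theorem sweedler_tmul (m : M) (n : N) : sweedler (m ⊗ₜ[K] n) (fun m n => f m n) = f m n := by
  rw [sweedler_eq_lift_bilin f h₁ h₂]; rfl

/-- Summation over a tensor that is itself a Sweedler sum. -/
theorem sweedler_sweedler (t : R ⊗[K] S) (F : R → S → M ⊗[K] N) :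
    sweedler (sweedler t fun x y => F x y) (fun m n => f m n) =
      sweedler t fun x y => sweedler (F x y) fun m n => f m n := by
  simp only [sweedler_eq_lift_bilin f h₁ h₂]
  simp [sweedler]

theorem sweedler_map (φ : R →ₗ[K] M) (ψ : S →ₗ[K] N) (t : R ⊗[K] S) :
    sweedler (TensorProduct.map φ ψ t) (fun m n => f m n) =
      sweedler t fun x y => f (φ x) (ψ y) := by
  apply eq_of_tmul t
  · fun_prop
  · fun_prop
  intro x y
  simp (disch := fun_prop) only [TensorProduct.map_tmul, sweedler_tmul]

theorem sweedler_rTensor (φ : R →ₗ[K] M) (t : R ⊗[K] N) :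
    sweedler (φ.rTensor N t) (fun m n => f m n) = sweedler t fun x n => f (φ x) n :=
  sweedler_map f h₁ h₂ φ LinearMap.id t

theorem sweedler_lTensor (ψ : S →ₗ[K] N) (t : M ⊗[K] S) :
    sweedler (ψ.lTensor M t) (fun m n => f m n) = sweedler t fun m y => f m (ψ y) :=
  sweedler_map f h₁ h₂ LinearMap.id ψ t

end Bilinear

theorem sweedler_assoc (f : M → N → P → Q) (h₁ : ∀ y z, IsLinearMap K fun x => f x y z)
    (h₂ : ∀ x z, IsLinearMap K fun y => f x y z) (h₃ : ∀ x y, IsLinearMap K fun z => f x y z)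
    (u : (M ⊗[K] N) ⊗[K] P) :
    (sweedler (TensorProduct.assoc K M N P u) fun x d => sweedler d fun y z => f x y z) =
      sweedler u fun p z => sweedler p fun x y => f x y z := by
  have e₁ : IsLinearMap K fun u => (sweedler (TensorProduct.assoc K M N P u) fun x d =>
    sweedler d fun y z => f x y z) := by fun_prop
  have e₂ : IsLinearMap K fun u : (M ⊗[K] N) ⊗[K] P => sweedler u fun p z =>
    sweedler p fun x y => f x y z := by fun_prop
  have : e₁.mk' = e₂.mk' := by
    refine TensorProduct.ext_threefold fun x y z => ?_
    simp (disch := fun_prop) only [IsLinearMap.mk'_apply, TensorProduct.assoc_tmul, sweedler_tmul]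
  exact DFunLike.congr_fun this u

omit [Module K P] in
theorem sweedler_comm (s : M ⊗[K] N) (t : R ⊗[K] S) (f : M → N → R → S → P) :
    (sweedler s fun m n => sweedler t fun x y => f m n x y) =
      sweedler t fun x y => sweedler s fun m n => f m n x y :=
  Finset.sum_comm

omit [Module K P] in
/-- Moves the sum over `t` to the front. As a rewrite rule, with `t` given, it stops there. -/
theorem sweedler_pull (t : R ⊗[K] S) {s : M ⊗[K] N} {f : M → N → R → S → P} :
    (sweedler s fun m n => sweedler t fun x y => f m n x y) =
      sweedler t fun x y => sweedler s fun m n => f m n x y :=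
  Finset.sum_comm

omit [Module K P] in
theorem sweedler_congr {t : M ⊗[K] N} {f g : M → N → P} (h : ∀ m n, f m n = g m n) :
    (sweedler t fun m n => f m n) = sweedler t fun m n => g m n :=
  Finset.sum_congr rfl fun _ _ => h _ _

theorem map_sweedler (g : P →ₗ[K] Q) (t : M ⊗[K] N) (f : M → N → P) :
    g (sweedler t fun m n => f m n) = sweedler t fun m n => g (f m n) :=
  map_sum g _ _

theorem linearEquiv_sweedler (g : P ≃ₗ[K] Q) (t : M ⊗[K] N) (f : M → N → P) :
    g (sweedler t fun m n => f m n) = sweedler t fun m n => g (f m n) :=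
  map_sum g _ _

theorem bilin_sweedler (g : P →ₗ[K] Q →ₗ[K] R) (t : M ⊗[K] N) (f : M → N → P) (y : Q) :
    g (sweedler t fun m n => f m n) y = sweedler t fun m n => g (f m n) y := by
  simp [sweedler]

theorem sweedler_smul (t : M ⊗[K] N) (c : K) (f : M → N → P) :
    (sweedler t fun m n => c • f m n) = c • sweedler t fun m n => f m n := by
  simp [sweedler, Finset.smul_sum]

theorem sweedler_mul {A : Type*} [Ring A] [Algebra K A] (t : M ⊗[K] N) (f : M → N → A) (c : A) :
    (sweedler t fun m n => f m n) * c = sweedler t fun m n => f m n * c := Finset.sum_mul _ _ _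

theorem mul_sweedler {A : Type*} [Ring A] [Algebra K A] (t : M ⊗[K] N) (f : M → N → A) (c : A) :
    c * (sweedler t fun m n => f m n) = sweedler t fun m n => c * f m n := Finset.mul_sum _ _ _

theorem sweedler_mul_sweedler {A : Type*} [Ring A] [Algebra K A] (s : M ⊗[K] N) (f : M → N → A)
    (t : R ⊗[K] S) (g : R → S → A) :
    (sweedler s fun m n => f m n) * (sweedler t fun x y => g x y) =
      sweedler s fun m n => sweedler t fun x y => f m n * g x y := by
  simp only [sweedler_mul, mul_sweedler]
  exact sweedler_comm _ _ _

theorem sweedler_tmul_right (t : M ⊗[K] N) (f : M → N → P) (c : Q) :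
    (sweedler t fun m n => f m n) ⊗ₜ[K] c = sweedler t fun m n => f m n ⊗ₜ[K] c :=
  TensorProduct.sum_tmul _ _ _

theorem tmul_sweedler_right (t : M ⊗[K] N) (f : M → N → P) (c : Q) :
    c ⊗ₜ[K] (sweedler t fun m n => f m n) = sweedler t fun m n => c ⊗ₜ[K] f m n :=
  TensorProduct.tmul_sum _ _ _

theorem sweedler_tmul_eq (t : M ⊗[K] N) : (sweedler t fun m n => m ⊗ₜ[K] n) = t :=
  (TensorProduct.exists_finset t).choose_spec.symm

section Coalgebra

variable {C : Type*} [AddCommGroup C] [Module K C] [Coalgebra K C]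

/-- Coassociativity, used to put iterated coproducts into the right-nested form. -/
theorem sweedler_coassoc (c : C) (f : C → C → C → P) (h₁ : ∀ y z, IsLinearMap K fun x => f x y z)
    (h₂ : ∀ x z, IsLinearMap K fun y => f x y z) (h₃ : ∀ x y, IsLinearMap K fun z => f x y z) :
    (sweedler (Coalgebra.comul (R := K) c) fun d z =>
      sweedler (Coalgebra.comul (R := K) d) fun x y => f x y z) =
    sweedler (Coalgebra.comul (R := K) c) fun x d =>
      sweedler (Coalgebra.comul (R := K) d) fun y z => f x y z := by
  have h := congrArg (fun t => sweedler t fun x d => sweedler d fun y z => f x y z)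
    (Coalgebra.coassoc_apply (R := K) c)
  simp (disch := fun_prop) only [sweedler_assoc, sweedler_rTensor, sweedler_lTensor] at h
  exact h

/-- Coassociativity for two interleaved iterated coproducts. -/
theorem sweedler_coassoc₂ {D : Type*} [AddCommGroup D] [Module K D] [Coalgebra K D] (c : C) (d : D)
    (f : C → D → C → D → C → D → P)
    (h₁ : ∀ y z u v w, IsLinearMap K fun x => f x u y v z w)
    (h₂ : ∀ x z u v w, IsLinearMap K fun y => f x u y v z w)
    (h₃ : ∀ x y u v w, IsLinearMap K fun z => f x u y v z w)
    (h₄ : ∀ x y z v w, IsLinearMap K fun u => f x u y v z w)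
    (h₅ : ∀ x y z u w, IsLinearMap K fun v => f x u y v z w)
    (h₆ : ∀ x y z u v, IsLinearMap K fun w => f x u y v z w) :
    (sweedler (Coalgebra.comul (R := K) c) fun c' z =>
      sweedler (Coalgebra.comul (R := K) d) fun d' w =>
      sweedler (Coalgebra.comul (R := K) c') fun x y =>
      sweedler (Coalgebra.comul (R := K) d') fun u v =>
        f x u y v z w) =
    sweedler (Coalgebra.comul (R := K) c) fun x c' =>
      sweedler (Coalgebra.comul (R := K) d) fun u d' =>
      sweedler (Coalgebra.comul (R := K) c') fun y z =>
      sweedler (Coalgebra.comul (R := K) d') fun v w =>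
        f x u y v z w := by
  conv_lhs => enter [2, c', z]; rw [sweedler_pull (Coalgebra.comul (R := K) c')]
  conv_rhs => enter [2, x, c']; rw [sweedler_pull (Coalgebra.comul (R := K) c')]
  simp (disch := fun_prop) only [sweedler_coassoc]

/-- Coassociativity for three interleaved iterated coproducts. -/
theorem sweedler_coassoc₃ {D E : Type*} [AddCommGroup D] [Module K D] [Coalgebra K D]
    [AddCommGroup E] [Module K E] [Coalgebra K E] (c : C) (d : D) (e : E)
    (f : C → D → E → C → D → E → C → D → E → P)
    (h₁ : ∀ u e₁ y v e₂ z w e₃, IsLinearMap K fun x => f x u e₁ y v e₂ z w e₃)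
    (h₂ : ∀ x u e₁ v e₂ z w e₃, IsLinearMap K fun y => f x u e₁ y v e₂ z w e₃)
    (h₃ : ∀ x u e₁ y v e₂ w e₃, IsLinearMap K fun z => f x u e₁ y v e₂ z w e₃)
    (h₄ : ∀ x e₁ y v e₂ z w e₃, IsLinearMap K fun u => f x u e₁ y v e₂ z w e₃)
    (h₅ : ∀ x u e₁ y e₂ z w e₃, IsLinearMap K fun v => f x u e₁ y v e₂ z w e₃)
    (h₆ : ∀ x u e₁ y v e₂ z e₃, IsLinearMap K fun w => f x u e₁ y v e₂ z w e₃)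
    (h₇ : ∀ x u y v e₂ z w e₃, IsLinearMap K fun e₁ => f x u e₁ y v e₂ z w e₃)
    (h₈ : ∀ x u e₁ y v z w e₃, IsLinearMap K fun e₂ => f x u e₁ y v e₂ z w e₃)
    (h₉ : ∀ x u e₁ y v e₂ z w, IsLinearMap K fun e₃ => f x u e₁ y v e₂ z w e₃) :
    (sweedler (Coalgebra.comul (R := K) c) fun c' z =>
      sweedler (Coalgebra.comul (R := K) d) fun d' w =>
      sweedler (Coalgebra.comul (R := K) e) fun e' e₃ =>
      sweedler (Coalgebra.comul (R := K) c') fun x y =>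
      sweedler (Coalgebra.comul (R := K) d') fun u v =>
      sweedler (Coalgebra.comul (R := K) e') fun e₁ e₂ => f x u e₁ y v e₂ z w e₃) =
    sweedler (Coalgebra.comul (R := K) c) fun x c' =>
      sweedler (Coalgebra.comul (R := K) d) fun u d' =>
      sweedler (Coalgebra.comul (R := K) e) fun e₁ e' =>
      sweedler (Coalgebra.comul (R := K) c') fun y z =>
      sweedler (Coalgebra.comul (R := K) d') fun v w =>
      sweedler (Coalgebra.comul (R := K) e') fun e₂ e₃ => f x u e₁ y v e₂ z w e₃ := by
  conv_lhs => enter [2, c', z]; simp only [sweedler_pull (Coalgebra.comul (R := K) c')]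
  conv_rhs => enter [2, x, c']; simp only [sweedler_pull (Coalgebra.comul (R := K) c')]
  simp (disch := fun_prop) only [sweedler_coassoc]
  refine sweedler_congr fun x c' => sweedler_congr fun y z => ?_
  exact sweedler_coassoc₂ d e (fun u e₁ v e₂ w e₃ => f x u e₁ y v e₂ z w e₃)
    (by fun_prop) (by fun_prop) (by fun_prop) (by fun_prop) (by fun_prop) (by fun_prop)

theorem sweedler_counit_left (c : C) (f : C → P) (h : IsLinearMap K f) :
    (sweedler (Coalgebra.comul (R := K) c) fun x y => Coalgebra.counit (R := K) x • f y) = f c := by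
  have h := congrArg (fun t => sweedler t fun x y => x • f y)
    (Coalgebra.rTensor_counit_comul (R := K) c)
  simp (disch := fun_prop) only [sweedler_rTensor, sweedler_tmul, one_smul] at h
  exact h

theorem sweedler_counit_right (c : C) (f : C → P) (h : IsLinearMap K f) :
    (sweedler (Coalgebra.comul (R := K) c) fun x y => Coalgebra.counit (R := K) y • f x) = f c := by
  have h := congrArg (fun t => sweedler t fun x y => y • f x)
    (Coalgebra.lTensor_counit_comul (R := K) c)
  simp (disch := fun_prop) only [sweedler_lTensor, sweedler_tmul, one_smul] at h
  exact h

end Coalgebra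

section Bialgebra

variable {H : Type*} [Ring H] [Bialgebra K H]

theorem sweedler_comul_mul (x y : H) (f : H → H → P) (h₁ : ∀ y, IsLinearMap K fun x => f x y)
    (h₂ : ∀ x, IsLinearMap K fun y => f x y) :
    (sweedler (Coalgebra.comul (R := K) (x * y)) fun z w => f z w) =
      sweedler (Coalgebra.comul (R := K) x) fun x₁ x₂ =>
        sweedler (Coalgebra.comul (R := K) y) fun y₁ y₂ => f (x₁ * y₁) (x₂ * y₂) := by
  rw [Bialgebra.comul_mul]
  conv_lhs => rw [← sweedler_tmul_eq (Coalgebra.comul (R := K) x),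
    ← sweedler_tmul_eq (Coalgebra.comul (R := K) y)]
  rw [sweedler_comm (Coalgebra.comul (R := K) x)]
  simp (disch := fun_prop) only [sweedler_mul, mul_sweedler, Algebra.TensorProduct.tmul_mul_tmul,
    sweedler_sweedler, sweedler_tmul]

theorem sweedler_comul_one (f : H → H → P) (h₁ : ∀ y, IsLinearMap K fun x => f x y)
    (h₂ : ∀ x, IsLinearMap K fun y => f x y) :
    (sweedler (Coalgebra.comul (R := K) (1 : H)) fun z w => f z w) = f 1 1 := by
  rw [Bialgebra.comul_one, Algebra.TensorProduct.one_def, sweedler_tmul f h₁ h₂]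

end Bialgebra

end Calculus

/-- The coproduct of the tensor product coalgebra `M ⊗ N`. -/
theorem sweedler_comul_tmul {K M N P : Type*} [Field K] [AddCommGroup M] [Module K M]
    [Coalgebra K M] [AddCommGroup N] [Module K N] [Coalgebra K N] [AddCommGroup P] [Module K P]
    (x : M) (y : N) (f : M ⊗[K] N → M ⊗[K] N → P) (h₁ : ∀ w, IsLinearMap K fun z => f z w)
    (h₂ : ∀ z, IsLinearMap K fun w => f z w) :
    (sweedler (Coalgebra.comul (R := K) (x ⊗ₜ[K] y)) fun z w => f z w) =
      sweedler (Coalgebra.comul (R := K) x) fun x₁ x₂ =>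
        sweedler (Coalgebra.comul (R := K) y) fun y₁ y₂ => f (x₁ ⊗ₜ y₁) (x₂ ⊗ₜ y₂) := by
  rw [TensorProduct.comul_tmul]
  conv_lhs => rw [← sweedler_tmul_eq (Coalgebra.comul (R := K) x),
    ← sweedler_tmul_eq (Coalgebra.comul (R := K) y)]
  rw [sweedler_tmul_right]
  simp (disch := fun_prop) only [tmul_sweedler_right, linearEquiv_sweedler,
    TensorProduct.AlgebraTensorModule.tensorTensorTensorComm_tmul, sweedler_sweedler, sweedler_tmul]

section SMul

variable {K A V M N : Type*} [Field K] [Ring A] [AddCommGroup V] [Module K V] [Module A V]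
  [AddCommGroup M] [Module K M] [AddCommGroup N] [Module K N]

@[fun_prop] theorem isLinearMap_algebra_smul_const [Algebra K A] [IsScalarTower K A V] (v : V) :
    IsLinearMap K fun a : A => a • v :=
  ⟨fun _ _ => add_smul _ _ _, fun _ _ => smul_assoc _ _ _⟩

@[fun_prop] theorem isLinearMap_const_algebra_smul [SMulCommClass K A V] (a : A) :
    IsLinearMap K fun v : V => a • v :=
  ⟨smul_add a, fun c v => (smul_comm c a v).symm⟩

omit [Module K V] in
theorem smul_sweedler (t : M ⊗[K] N) (a : A) (f : M → N → V) :
    a • (sweedler t fun m n => f m n) = sweedler t fun m n => a • f m n := Finset.smul_sum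

omit [Module K V] in
theorem sweedler_smul_right [Module K A] (t : M ⊗[K] N) (f : M → N → A) (v : V) :
    (sweedler t fun m n => f m n) • v = sweedler t fun m n => f m n • v := Finset.sum_smul

end SMul

/-! ### The left crossed product -/

section LeftCrossed

variable {K H A : Type*} [Field K] [Ring H] [Bialgebra K H] [Ring A] [Algebra K A]
  (wA : LeftWeakAction K H A) (σ : H →ₗ[K] H →ₗ[K] A)

local notation "Δ" => Coalgebra.comul (R := K)
local notation:74 x:75 " ▷ " a:74 => LeftWeakAction.act wA x a

/-- The product `(1 ⊗ x) v` in the left crossed product. -/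
noncomputable def leftCrossedMulH : H →ₗ[K] A ⊗[K] H →ₗ[K] A ⊗[K] H :=
  bilin (fun x v => sweedler v fun a' x' =>
    sweedler (Δ x) fun x₁ d => sweedler (Δ d) fun x₂ x₃ => sweedler (Δ x') fun y₁ y₂ =>
      ((x₁ ▷ a') * σ x₂ y₁) ⊗ₜ[K] (x₃ * y₂)) (by fun_prop) (by fun_prop)

theorem leftCrossedMulH_tmul (x : H) (a' : A) (x' : H) :
    leftCrossedMulH wA σ x (a' ⊗ₜ x') = sweedler (Δ x) fun x₁ d => sweedler (Δ d) fun x₂ x₃ =>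
      sweedler (Δ x') fun y₁ y₂ => ((x₁ ▷ a') * σ x₂ y₁) ⊗ₜ[K] (x₃ * y₂) := by
  rw [leftCrossedMulH, bilin_apply]
  simp (disch := fun_prop) only [sweedler_tmul]

theorem leftCrossedMulH_smul (x : H) (a : A) (w : A ⊗[K] H) :
    leftCrossedMulH wA σ x (a • w) =
      sweedler (Δ x) fun x₁ x₂ => (x₁ ▷ a) • leftCrossedMulH wA σ x₂ w := by
  apply eq_of_tmul w
  · fun_prop
  · fun_prop
  intro a' x'
  simp (disch := fun_prop) only [TensorProduct.smul_tmul', leftCrossedMulH_tmul, smul_eq_mul,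
    wA.act_mul, Δ₂, sweedler_mul, sweedler_tmul_right, smul_sweedler, mul_assoc]
  conv_lhs => enter [2, x₁, d]; simp only [sweedler_pull (Δ x₁)]
  simp (disch := fun_prop) only [sweedler_coassoc]

variable {wA σ}

/-- The cocycle condition for `σ`, as associativity of `(1 ⊗ x) ((1 ⊗ x') (1 ⊗ x''))`. -/
theorem leftCrossedMulH_leftCrossedMulH_one (h : IsLeftCrossedProduct wA.act σ) (x x' x'' : H) :
    leftCrossedMulH wA σ x (leftCrossedMulH wA σ x' (1 ⊗ₜ x'')) =
      sweedler (Δ x) fun x₁ x₂ => sweedler (Δ x') fun y₁ y₂ =>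
        σ x₁ y₁ • leftCrossedMulH wA σ (x₂ * y₂) (1 ⊗ₜ x'') := by
  have e : ∀ x, leftCrossedMulH wA σ x (1 ⊗ₜ x'') = sweedler (Δ x) fun x₁ x₂ =>
      sweedler (Δ x'') fun z₁ z₂ => σ x₁ z₁ ⊗ₜ (x₂ * z₂) := fun x => by
    simp (disch := fun_prop) only [leftCrossedMulH_tmul, wA.act_one, one_mul, smul_mul_assoc,
      ← TensorProduct.smul_tmul', sweedler_smul, sweedler_counit_left]
  have key : (sweedler (Δ x) fun x₁₂ x₃ => sweedler (Δ x') fun y₁₂ y₃ => sweedler (Δ x'')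
      fun z₁₂ z₃ => (sweedler (Δ x₁₂) fun x₁ x₂ => sweedler (Δ y₁₂) fun y₁ y₂ =>
        sweedler (Δ z₁₂) fun z₁ z₂ => (x₁ ▷ σ y₁ z₁) * σ x₂ (y₂ * z₂)) ⊗ₜ[K] (x₃ * (y₃ * z₃))) =
      sweedler (Δ x) fun x₁₂ x₃ => sweedler (Δ x') fun y₁₂ y₃ => sweedler (Δ x'')
      fun z₁₂ z₃ => (sweedler (Δ x₁₂) fun x₁ x₂ => sweedler (Δ y₁₂) fun y₁ y₂ =>
        σ x₁ y₁ * σ (x₂ * y₂) z₁₂) ⊗ₜ[K] (x₃ * (y₃ * z₃)) :=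
    sweedler_congr fun x₁₂ x₃ => sweedler_congr fun y₁₂ y₃ => sweedler_congr fun z₁₂ z₃ =>
      congrArg (· ⊗ₜ[K] _) (h.cocycle x₁₂ y₁₂ z₁₂)
  simp (disch := fun_prop) only [e, sweedler_comul_mul, map_sweedler, leftCrossedMulH_tmul,
    smul_sweedler, TensorProduct.smul_tmul', smul_eq_mul, sweedler_pull (Δ x)]
  simp (disch := fun_prop) only [sweedler_tmul_right] at key
  simp (disch := fun_prop) only [sweedler_coassoc₃] at key
  simp (disch := fun_prop) only [sweedler_pull (Δ x'')] at key ⊢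
  simp (disch := fun_prop) only [sweedler_coassoc₂] at key
  simpa only [mul_assoc] using key

/-- Associativity for the first two factors in `H`: on `1 ⊗ H` it is the cocycle condition, and
the twisted module condition moves an element of `A` past `x` and `x'`. -/
theorem leftCrossedMulH_leftCrossedMulH (h : IsLeftCrossedProduct wA.act σ) (x x' : H)
    (w : A ⊗[K] H) :
    leftCrossedMulH wA σ x (leftCrossedMulH wA σ x' w) =
      sweedler (Δ x) fun x₁ x₂ => sweedler (Δ x') fun y₁ y₂ =>
        σ x₁ y₁ • leftCrossedMulH wA σ (x₂ * y₂) w := by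
  apply eq_of_tmul w
  · fun_prop
  · fun_prop
  intro a x''
  have ha : a ⊗ₜ[K] x'' = a • ((1 : A) ⊗ₜ[K] x'') := by simp [TensorProduct.smul_tmul']
  simp (disch := fun_prop) only [ha, leftCrossedMulH_smul, map_sweedler,
    leftCrossedMulH_leftCrossedMulH_one h, sweedler_comul_mul, smul_sweedler, ← mul_smul]
  have key : ∀ u : A ⊗[K] H, (sweedler (Δ x) fun x₁₂ x₃ => sweedler (Δ x') fun y₁₂ y₃ =>
        (sweedler (Δ x₁₂) fun x₁ x₂ => sweedler (Δ y₁₂) fun y₁ y₂ =>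
          (x₁ ▷ (y₁ ▷ a)) * σ x₂ y₂) • leftCrossedMulH wA σ (x₃ * y₃) u) =
      sweedler (Δ x) fun x₁₂ x₃ => sweedler (Δ x') fun y₁₂ y₃ =>
        (sweedler (Δ x₁₂) fun x₁ x₂ => sweedler (Δ y₁₂) fun y₁ y₂ =>
          σ x₁ y₁ * ((x₂ * y₂) ▷ a)) • leftCrossedMulH wA σ (x₃ * y₃) u := fun u =>
    sweedler_congr fun x₁₂ x₃ => sweedler_congr fun y₁₂ y₃ =>
      congrArg (· • _) (h.twisted_module x₁₂ y₁₂ a)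
  simp (disch := fun_prop) only [sweedler_smul_right] at key
  simp (disch := fun_prop) only [sweedler_coassoc₂] at key
  rw [sweedler_comm]
  exact key _

/-- The product of the left crossed product. -/
noncomputable def leftCrossedMul (wA : LeftWeakAction K H A) (σ : H →ₗ[K] H →ₗ[K] A) :
    A ⊗[K] H →ₗ[K] A ⊗[K] H →ₗ[K] A ⊗[K] H :=
  bilin (fun u v => sweedler u fun a x => a • leftCrossedMulH wA σ x v) (by fun_prop) (by fun_prop)

theorem leftCrossedMul_tmul (a : A) (x : H) (v : A ⊗[K] H) :
    leftCrossedMul wA σ (a ⊗ₜ x) v = a • leftCrossedMulH wA σ x v := by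
  rw [leftCrossedMul, bilin_apply]
  simp (disch := fun_prop) only [sweedler_tmul]

theorem leftCrossedMul_smul (a : A) (u v : A ⊗[K] H) :
    leftCrossedMul wA σ (a • u) v = a • leftCrossedMul wA σ u v := by
  apply eq_of_tmul u
  · fun_prop
  · fun_prop
  intro a' x
  simp only [TensorProduct.smul_tmul', leftCrossedMul_tmul, smul_assoc]

theorem leftCrossedMul_assoc (h : IsLeftCrossedProduct wA.act σ) (u v w : A ⊗[K] H) :
    leftCrossedMul wA σ (leftCrossedMul wA σ u v) w =
      leftCrossedMul wA σ u (leftCrossedMul wA σ v w) := by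
  apply eq_of_tmul u
  · fun_prop
  · fun_prop
  intro a x
  simp only [leftCrossedMul_tmul, leftCrossedMul_smul]
  congr 1
  apply eq_of_tmul v
  · fun_prop
  · fun_prop
  intro a' x'
  simp only [leftCrossedMul_tmul, leftCrossedMulH_smul, leftCrossedMulH_tmul, bilin_sweedler,
    leftCrossedMulH_leftCrossedMulH h, mul_smul, smul_sweedler]

theorem leftCrossedMul_one_left (h : IsLeftCrossedProduct wA.act σ) (v : A ⊗[K] H) :
    leftCrossedMul wA σ (1 ⊗ₜ 1) v = v := by
  apply eq_of_tmul v
  · fun_prop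
  · fun_prop
  intro a x
  simp (disch := fun_prop) only [leftCrossedMul_tmul, leftCrossedMulH_tmul, sweedler_comul_one,
    wA.one_act, h.map_one_left, one_smul, one_mul, mul_smul_comm, mul_one,
    ← TensorProduct.smul_tmul', sweedler_counit_left]

theorem leftCrossedMul_one_right (h : IsLeftCrossedProduct wA.act σ) (u : A ⊗[K] H) :
    leftCrossedMul wA σ u (1 ⊗ₜ 1) = u := by
  apply eq_of_tmul u
  · fun_prop
  · fun_prop
  intro a x
  simp (disch := fun_prop) only [leftCrossedMul_tmul, leftCrossedMulH_tmul, sweedler_comul_one,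
    wA.act_one, h.map_one_right, mul_smul_comm, mul_one, ← TensorProduct.smul_tmul',
    sweedler_counit_left]
  rw [TensorProduct.smul_tmul', smul_eq_mul, mul_one]

/-- The left crossed product `A #^σ H`: the space `A ⊗ H` with the product
`(a ⊗ x)(a' ⊗ x') = a (x₁ ▷ a') σ(x₂, x'₁) ⊗ x₃ x'₂`. -/
def LeftCrossedProduct (_ : IsLeftCrossedProduct wA.act σ) : Type _ := A ⊗[K] H

noncomputable instance (h : IsLeftCrossedProduct wA.act σ) : AddCommGroup (LeftCrossedProduct h) :=
  inferInstanceAs (AddCommGroup (A ⊗[K] H))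

noncomputable instance (h : IsLeftCrossedProduct wA.act σ) : Module K (LeftCrossedProduct h) :=
  inferInstanceAs (Module K (A ⊗[K] H))

noncomputable instance (h : IsLeftCrossedProduct wA.act σ) : Ring (LeftCrossedProduct h) where
  __ := (inferInstance : AddCommGroup (LeftCrossedProduct h))
  mul := fun u v => leftCrossedMul wA σ u v
  one := ((1 : A) ⊗ₜ[K] (1 : H) : A ⊗[K] H)
  left_distrib u v w := (leftCrossedMul wA σ u).map_add v w
  right_distrib u v w := (leftCrossedMul wA σ).map_add₂ u v w
  zero_mul v := (leftCrossedMul wA σ).map_zero₂ v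
  mul_zero u := (leftCrossedMul wA σ u).map_zero
  mul_assoc := leftCrossedMul_assoc h
  one_mul := leftCrossedMul_one_left h
  mul_one := leftCrossedMul_one_right h

noncomputable instance (h : IsLeftCrossedProduct wA.act σ) : Algebra K (LeftCrossedProduct h) :=
  Algebra.ofModule (fun c u v => (leftCrossedMul wA σ).map_smul₂ c u v)
    (fun c u v => (leftCrossedMul wA σ u).map_smul c v)

/-- The identification of `A ⊗ H` with the underlying space of `A #^σ H`. -/
def toLeftCrossedProduct (h : IsLeftCrossedProduct wA.act σ) :
    A ⊗[K] H ≃ₗ[K] LeftCrossedProduct h := LinearEquiv.refl K (A ⊗[K] H)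

theorem toLeftCrossedProduct_mul (h : IsLeftCrossedProduct wA.act σ) (u v : A ⊗[K] H) :
    toLeftCrossedProduct h u * toLeftCrossedProduct h v =
      toLeftCrossedProduct h (leftCrossedMul wA σ u v) := rfl

end LeftCrossed

/-! ### The right crossed product -/

section RightCrossed

variable {K H B : Type*} [Field K] [Ring H] [Bialgebra K H] [Ring B] [Algebra K B]
  (wB : RightWeakAction K H B) (τ : H →ₗ[K] H →ₗ[K] B)

local notation "Δ" => Coalgebra.comul (R := K)
local notation:74 b:75 " ◁ " x:75 => RightWeakAction.act wB b x

/-- Multiplication by `b` from the right on the second factor of `H ⊗ B`. -/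
noncomputable def rightMul (K H : Type*) {B : Type*} [Field K] [AddCommGroup H] [Module K H]
    [Ring B] [Algebra K B] : B →ₗ[K] H ⊗[K] B →ₗ[K] H ⊗[K] B :=
  bilin (fun b w => sweedler w fun x c => x ⊗ₜ (c * b)) (by fun_prop) (by fun_prop)

theorem rightMul_tmul (b : B) (x : H) (c : B) : rightMul K H b (x ⊗ₜ c) = x ⊗ₜ (c * b) := by
  rw [rightMul, bilin_apply]
  simp (disch := fun_prop) only [sweedler_tmul]

theorem rightMul_mul (b c : B) (w : H ⊗[K] B) :
    rightMul K H (b * c) w = rightMul K H c (rightMul K H b w) := by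
  apply eq_of_tmul w
  · fun_prop
  · fun_prop
  intro x d
  simp only [rightMul_tmul, mul_assoc]

/-- The product `u (x' ⊗ 1)` in the right crossed product. -/
noncomputable def rightCrossedMulH : H →ₗ[K] H ⊗[K] B →ₗ[K] H ⊗[K] B :=
  bilin (fun x' u => sweedler u fun x b =>
    sweedler (Δ x) fun x₁ x₂ => sweedler (Δ x') fun y₁ d => sweedler (Δ d) fun y₂ y₃ =>
      (x₁ * y₁) ⊗ₜ[K] (τ x₂ y₂ * (b ◁ y₃))) (by fun_prop) (by fun_prop)

theorem rightCrossedMulH_tmul (x' x : H) (b : B) :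
    rightCrossedMulH wB τ x' (x ⊗ₜ b) = sweedler (Δ x) fun x₁ x₂ => sweedler (Δ x') fun y₁ d =>
      sweedler (Δ d) fun y₂ y₃ => (x₁ * y₁) ⊗ₜ[K] (τ x₂ y₂ * (b ◁ y₃)) := by
  rw [rightCrossedMulH, bilin_apply]
  simp (disch := fun_prop) only [sweedler_tmul]

theorem rightCrossedMulH_rightMul (x' : H) (b : B) (w : H ⊗[K] B) :
    rightCrossedMulH wB τ x' (rightMul K H b w) =
      sweedler (Δ x') fun y₁ y₂ => rightMul K H (b ◁ y₂) (rightCrossedMulH wB τ y₁ w) := by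
  apply eq_of_tmul w
  · fun_prop
  · fun_prop
  intro x c
  simp (disch := fun_prop) only [rightMul_tmul, rightCrossedMulH_tmul, wB.mul_act, Δ₂, mul_sweedler,
    tmul_sweedler_right, map_sweedler, mul_assoc]
  simp only [sweedler_pull (Δ x)]
  simp (disch := fun_prop) only [sweedler_coassoc]

variable {wB τ}

/-- The cocycle condition for `τ`, as associativity of `((x ⊗ 1) (x' ⊗ 1)) (x'' ⊗ 1)`. -/
theorem rightCrossedMulH_rightCrossedMulH_one (h : IsRightCrossedProduct wB.act τ) (x x' x'' : H) :
    rightCrossedMulH wB τ x'' (rightCrossedMulH wB τ x' (x ⊗ₜ 1)) =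
      sweedler (Δ x') fun y₁ y₂ => sweedler (Δ x'') fun z₁ z₂ =>
        rightMul K H (τ y₂ z₂) (rightCrossedMulH wB τ (y₁ * z₁) (x ⊗ₜ 1)) := by
  have e : ∀ x', rightCrossedMulH wB τ x' (x ⊗ₜ 1) = sweedler (Δ x) fun x₁ x₂ =>
      sweedler (Δ x') fun y₁ y₂ => (x₁ * y₁) ⊗ₜ τ x₂ y₂ := fun x' => by
    simp (disch := fun_prop) only [rightCrossedMulH_tmul, wB.one_act, mul_one, mul_smul_comm,
      TensorProduct.tmul_smul, sweedler_counit_right]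
  have key : (sweedler (Δ x) fun x₁ x₂₃ => sweedler (Δ x') fun y₁ y₂₃ => sweedler (Δ x'')
      fun z₁ z₂₃ => (x₁ * (y₁ * z₁)) ⊗ₜ[K]
        (sweedler (Δ x₂₃) fun x₂ x₃ => sweedler (Δ y₂₃) fun y₂ y₃ =>
        sweedler (Δ z₂₃) fun z₂ z₃ => τ (x₂ * y₂) z₂ * (τ x₃ y₃ ◁ z₃))) =
      sweedler (Δ x) fun x₁ x₂₃ => sweedler (Δ x') fun y₁ y₂₃ => sweedler (Δ x'')
      fun z₁ z₂₃ => (x₁ * (y₁ * z₁)) ⊗ₜ[K] (sweedler (Δ y₂₃) fun y₂ y₃ =>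
        sweedler (Δ z₂₃) fun z₂ z₃ => τ x₂₃ (y₂ * z₂) * τ y₃ z₃) :=
    sweedler_congr fun x₁ x₂₃ => sweedler_congr fun y₁ y₂₃ => sweedler_congr fun z₁ z₂₃ =>
      congrArg (_ ⊗ₜ[K] ·) (h.cocycle x₂₃ y₂₃ z₂₃)
  simp (disch := fun_prop) only [e, sweedler_comul_mul, map_sweedler, rightCrossedMulH_tmul,
    rightMul_tmul, sweedler_coassoc₂]
  simp (disch := fun_prop) only [tmul_sweedler_right] at key
  simp only [sweedler_pull (Δ x)]
  simp (disch := fun_prop) only [sweedler_coassoc₂]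
  simp only [sweedler_pull (Δ x'')] at key ⊢
  simpa only [mul_assoc] using key

/-- Associativity for the last two factors in `H`: on `H ⊗ 1` it is the cocycle condition, and
the twisted module condition moves an element of `B` past `x'` and `x''`. -/
theorem rightCrossedMulH_rightCrossedMulH (h : IsRightCrossedProduct wB.act τ) (x' x'' : H)
    (w : H ⊗[K] B) :
    rightCrossedMulH wB τ x'' (rightCrossedMulH wB τ x' w) =
      sweedler (Δ x') fun y₁ y₂ => sweedler (Δ x'') fun z₁ z₂ =>
        rightMul K H (τ y₂ z₂) (rightCrossedMulH wB τ (y₁ * z₁) w) := by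
  apply eq_of_tmul w
  · fun_prop
  · fun_prop
  intro x b
  have hb : x ⊗ₜ[K] b = rightMul K H b (x ⊗ₜ[K] (1 : B)) := by rw [rightMul_tmul, one_mul]
  have key : ∀ u : H ⊗[K] B,
      (sweedler (Δ x') fun y₁ y₂₃ => sweedler (Δ x'') fun z₁ z₂₃ =>
        rightMul K H (sweedler (Δ y₂₃) fun y₂ y₃ => sweedler (Δ z₂₃) fun z₂ z₃ =>
         τ y₂ z₂ * ((b ◁ y₃) ◁ z₃)) (rightCrossedMulH wB τ (y₁ * z₁) u)) =
      sweedler (Δ x') fun y₁ y₂₃ => sweedler (Δ x'') fun z₁ z₂₃ =>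
        rightMul K H (sweedler (Δ y₂₃) fun y₂ y₃ => sweedler (Δ z₂₃) fun z₂ z₃ =>
         (b ◁ (y₂ * z₂)) * τ y₃ z₃) (rightCrossedMulH wB τ (y₁ * z₁) u) := fun u =>
    sweedler_congr fun y₁ y₂₃ => sweedler_congr fun z₁ z₂₃ =>
      congrArg (rightMul K H · _) (h.twisted_module y₂₃ z₂₃ b)
  simp (disch := fun_prop) only [hb, rightCrossedMulH_rightMul, map_sweedler,
    rightCrossedMulH_rightCrossedMulH_one h, sweedler_comul_mul, ← rightMul_mul]
  simp (disch := fun_prop) only [bilin_sweedler] at key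
  simp (disch := fun_prop) only [sweedler_coassoc₂]
  exact key _

/-- The product of the right crossed product. -/
noncomputable def rightCrossedMul (wB : RightWeakAction K H B) (τ : H →ₗ[K] H →ₗ[K] B) :
    H ⊗[K] B →ₗ[K] H ⊗[K] B →ₗ[K] H ⊗[K] B :=
  bilin (fun u v => sweedler v fun x' b' => rightMul K H b' (rightCrossedMulH wB τ x' u))
    (by fun_prop) (by fun_prop)

theorem rightCrossedMul_tmul (u : H ⊗[K] B) (x' : H) (b' : B) :
    rightCrossedMul wB τ u (x' ⊗ₜ b') = rightMul K H b' (rightCrossedMulH wB τ x' u) := by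
  rw [rightCrossedMul, bilin_apply]
  simp (disch := fun_prop) only [sweedler_tmul]

theorem rightCrossedMul_rightMul (b : B) (u v : H ⊗[K] B) :
    rightCrossedMul wB τ u (rightMul K H b v) = rightMul K H b (rightCrossedMul wB τ u v) := by
  apply eq_of_tmul v
  · fun_prop
  · fun_prop
  intro x c
  simp only [rightMul_tmul, rightCrossedMul_tmul, rightMul_mul]

theorem rightCrossedMul_assoc (h : IsRightCrossedProduct wB.act τ) (u v w : H ⊗[K] B) :
    rightCrossedMul wB τ (rightCrossedMul wB τ u v) w =
      rightCrossedMul wB τ u (rightCrossedMul wB τ v w) := by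
  apply eq_of_tmul w
  · fun_prop
  · fun_prop
  intro x b
  simp only [rightCrossedMul_tmul, rightCrossedMul_rightMul]
  congr 1
  apply eq_of_tmul v
  · fun_prop
  · fun_prop
  intro y c
  simp only [rightCrossedMul_tmul, rightCrossedMulH_rightMul, rightCrossedMulH_tmul, map_sweedler,
    rightCrossedMulH_rightCrossedMulH h, rightMul_mul]
  rw [sweedler_comm]
  simp (disch := fun_prop) only [sweedler_coassoc]

theorem rightCrossedMul_one_left (h : IsRightCrossedProduct wB.act τ) (v : H ⊗[K] B) :
    rightCrossedMul wB τ (1 ⊗ₜ 1) v = v := by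
  apply eq_of_tmul v
  · fun_prop
  · fun_prop
  intro x b
  simp (disch := fun_prop) only [rightCrossedMul_tmul, rightCrossedMulH_tmul, sweedler_comul_one,
    wB.one_act, h.map_one_left, mul_smul_comm, one_mul, mul_one, TensorProduct.tmul_smul,
    sweedler_counit_right, rightMul_tmul]

theorem rightCrossedMul_one_right (h : IsRightCrossedProduct wB.act τ) (u : H ⊗[K] B) :
    rightCrossedMul wB τ u (1 ⊗ₜ 1) = u := by
  apply eq_of_tmul u
  · fun_prop
  · fun_prop
  intro x b
  simp (disch := fun_prop) only [rightCrossedMul_tmul, rightCrossedMulH_tmul, sweedler_comul_one,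
    wB.act_one, h.map_one_right, smul_mul_assoc, one_mul, mul_one, TensorProduct.tmul_smul,
    sweedler_counit_right, rightMul_tmul]

/-- The right crossed product `H ^τ# B`: the space `H ⊗ B` with the product
`(x ⊗ b)(x' ⊗ b') = x₁ x'₁ ⊗ τ(x₂, x'₂) (b ◁ x'₃) b'`. -/
def RightCrossedProduct (_ : IsRightCrossedProduct wB.act τ) : Type _ := H ⊗[K] B

noncomputable instance (h : IsRightCrossedProduct wB.act τ) :
    AddCommGroup (RightCrossedProduct h) := inferInstanceAs (AddCommGroup (H ⊗[K] B))

noncomputable instance (h : IsRightCrossedProduct wB.act τ) : Module K (RightCrossedProduct h) :=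
  inferInstanceAs (Module K (H ⊗[K] B))

noncomputable instance (h : IsRightCrossedProduct wB.act τ) : Ring (RightCrossedProduct h) where
  __ := (inferInstance : AddCommGroup (RightCrossedProduct h))
  mul := fun u v => rightCrossedMul wB τ u v
  one := ((1 : H) ⊗ₜ[K] (1 : B) : H ⊗[K] B)
  left_distrib u v w := (rightCrossedMul wB τ u).map_add v w
  right_distrib u v w := (rightCrossedMul wB τ).map_add₂ u v w
  zero_mul v := (rightCrossedMul wB τ).map_zero₂ v
  mul_zero u := (rightCrossedMul wB τ u).map_zero
  mul_assoc := rightCrossedMul_assoc h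
  one_mul := rightCrossedMul_one_left h
  mul_one := rightCrossedMul_one_right h

noncomputable instance (h : IsRightCrossedProduct wB.act τ) : Algebra K (RightCrossedProduct h) :=
  Algebra.ofModule (fun c u v => (rightCrossedMul wB τ).map_smul₂ c u v)
    (fun c u v => (rightCrossedMul wB τ u).map_smul c v)

/-- The identification of `H ⊗ B` with the underlying space of `H ^τ# B`. -/
def toRightCrossedProduct (h : IsRightCrossedProduct wB.act τ) :
    H ⊗[K] B ≃ₗ[K] RightCrossedProduct h := LinearEquiv.refl K (H ⊗[K] B)

theorem toRightCrossedProduct_mul (h : IsRightCrossedProduct wB.act τ) (u v : H ⊗[K] B) :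
    toRightCrossedProduct h u * toRightCrossedProduct h v =
      toRightCrossedProduct h (rightCrossedMul wB τ u v) := rfl

end RightCrossed

/-! ### The two-sided crossed product -/

section TwoSided

variable {K H A B : Type*} [Field K] [Ring H] [Bialgebra K H] [Ring A] [Algebra K A]
  [Ring B] [Algebra K B] {wA : LeftWeakAction K H A} {wB : RightWeakAction K H B}
  {σ : H →ₗ[K] H →ₗ[K] A} {τ : H →ₗ[K] H →ₗ[K] B}
  (hσ : IsLeftCrossedProduct wA.act σ) (hτ : IsRightCrossedProduct wB.act τ)

local notation "Δ" => Coalgebra.comul (R := K)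
local notation "ε" => Coalgebra.counit (R := K)

/-- The map `a ⊗ x ⊗ b ↦ (a ⊗ x₁) ⊗ (x₂ ⊗ b)`. -/
noncomputable def twoSidedEmbedding :
    A ⊗[K] (H ⊗[K] B) →ₗ[K] LeftCrossedProduct hσ ⊗[K] RightCrossedProduct hτ :=
  IsLinearMap.mk' (fun s => sweedler s fun a y => sweedler y fun x b => sweedler (Δ x) fun x₁ x₂ =>
    toLeftCrossedProduct hσ (a ⊗ₜ[K] x₁) ⊗ₜ[K] toRightCrossedProduct hτ (x₂ ⊗ₜ[K] b)) (by fun_prop)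

theorem twoSidedEmbedding_tmul (a : A) (x : H) (b : B) :
    twoSidedEmbedding hσ hτ (a ⊗ₜ (x ⊗ₜ b)) = sweedler (Δ x) fun x₁ x₂ =>
      toLeftCrossedProduct hσ (a ⊗ₜ[K] x₁) ⊗ₜ[K] toRightCrossedProduct hτ (x₂ ⊗ₜ[K] b) := by
  rw [twoSidedEmbedding, IsLinearMap.mk'_apply]
  simp (disch := fun_prop) only [sweedler_tmul]

theorem twoSidedEmbedding_injective : Function.Injective (twoSidedEmbedding hσ hτ) := by
  -- `(a ⊗ x) ⊗ (y ⊗ b) ↦ ε(x) a ⊗ y ⊗ b` is a left inverse.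
  refine Function.LeftInverse.injective (g := fun z => sweedler z fun u v =>
    sweedler ((toLeftCrossedProduct hσ).symm u) fun a x =>
      sweedler ((toRightCrossedProduct hτ).symm v) fun y b => ε x • a ⊗ₜ (y ⊗ₜ b)) fun s => ?_
  apply eq_of_tmul s
  · fun_prop
  · fun_prop
  intro a y
  apply eq_of_tmul y
  · fun_prop
  · fun_prop
  intro x b
  simp (disch := fun_prop) only [twoSidedEmbedding_tmul, sweedler_sweedler, sweedler_tmul,
    LinearEquiv.symm_apply_apply, sweedler_counit_left]

/-- The embedding is multiplicative, so the two-sided crossed product inherits associativity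
from `(A #^σ H) ⊗ (H ^τ# B)`. -/
theorem twoSidedEmbedding_mul (a : A) (x : H) (b : B) (a' : A) (x' : H) (b' : B) :
    twoSidedEmbedding hσ hτ (a ⊗ₜ (x ⊗ₜ b)) * twoSidedEmbedding hσ hτ (a' ⊗ₜ (x' ⊗ₜ b')) =
      twoSidedEmbedding hσ hτ (crossedMul wA.act wB.act σ τ a x b a' x' b') := by
  simp (disch := fun_prop) only [crossedMul, Δ₄, Δ₃, Δ₂, map_sweedler, linearEquiv_sweedler,
    twoSidedEmbedding_tmul, sweedler_mul, mul_sweedler, Algebra.TensorProduct.tmul_mul_tmul,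
    toLeftCrossedProduct_mul, toRightCrossedProduct_mul, leftCrossedMul_tmul, leftCrossedMulH_tmul,
    rightCrossedMul_tmul, rightCrossedMulH_tmul, rightMul_tmul, smul_sweedler,
    TensorProduct.smul_tmul', smul_eq_mul, sweedler_tmul_right, tmul_sweedler_right,
    sweedler_comul_mul, mul_assoc]
  rw [sweedler_comm]
  conv_lhs =>
    enter [2, x₁, x₂]
    simp only [sweedler_pull (Δ x₂)]
    simp only [sweedler_pull (Δ x₁)]
    enter [2, p₁, d]
    simp only [sweedler_pull (Δ d)]
    enter [2, p₂, p₃, 2, r₁, r₂, 2, y₁, y₂]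
    simp only [sweedler_pull (Δ y₁)]
  conv_rhs =>
    enter [2, x₁, d, 2, x₂, d', 2, x₃, x₄]
    simp only [sweedler_pull (Δ x₃)]
    enter [2, z₁, z₂, 2, q₁, w, 2, q₂, f]
    simp only [sweedler_pull (Δ q₂)]
  simp (disch := fun_prop) only [sweedler_coassoc]

/-- The two-sided crossed product, as a subalgebra of `(A #^σ H) ⊗ (H ^τ# B)`. -/
noncomputable def twoSidedCrossedProduct :
    Subalgebra K (LeftCrossedProduct hσ ⊗[K] RightCrossedProduct hτ) :=
  (LinearMap.range (twoSidedEmbedding hσ hτ)).toSubalgebra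
    ⟨1 ⊗ₜ (1 ⊗ₜ 1), by
      rw [twoSidedEmbedding_tmul]
      simp (disch := fun_prop) only [sweedler_comul_one]
      rfl⟩
    (by
      rintro _ _ ⟨s, rfl⟩ ⟨t, rfl⟩
      induction s with
      | zero => rw [map_zero, zero_mul]; exact zero_mem _
      | add s₁ s₂ h₁ h₂ => rw [map_add, add_mul]; exact add_mem h₁ h₂
      | tmul a y =>
      induction y with
      | zero => rw [TensorProduct.tmul_zero, map_zero, zero_mul]; exact zero_mem _
      | add s₁ s₂ h₁ h₂ => rw [TensorProduct.tmul_add, map_add, add_mul]; exact add_mem h₁ h₂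
      | tmul x b =>
      induction t with
      | zero => rw [map_zero, mul_zero]; exact zero_mem _
      | add s₁ s₂ h₁ h₂ => rw [map_add, mul_add]; exact add_mem h₁ h₂
      | tmul a' y' =>
      induction y' with
      | zero => rw [TensorProduct.tmul_zero, map_zero, mul_zero]; exact zero_mem _
      | add s₁ s₂ h₁ h₂ => rw [TensorProduct.tmul_add, map_add, mul_add]; exact add_mem h₁ h₂
      | tmul x' b' => exact ⟨_, (twoSidedEmbedding_mul hσ hτ a x b a' x' b').symm⟩)

/-- The identification of `A ⊗ H ⊗ B` with the two-sided crossed product. -/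
noncomputable def toTwoSidedCrossedProduct :
    A ⊗[K] (H ⊗[K] B) ≃ₗ[K] twoSidedCrossedProduct hσ hτ :=
  LinearEquiv.ofInjective (twoSidedEmbedding hσ hτ) (twoSidedEmbedding_injective hσ hτ)

theorem toTwoSidedCrossedProduct_mul (a : A) (x : H) (b : B) (a' : A) (x' : H) (b' : B) :
    toTwoSidedCrossedProduct hσ hτ (a ⊗ₜ (x ⊗ₜ b)) *
        toTwoSidedCrossedProduct hσ hτ (a' ⊗ₜ (x' ⊗ₜ b')) =
      toTwoSidedCrossedProduct hσ hτ (crossedMul wA.act wB.act σ τ a x b a' x' b') :=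
  Subtype.ext (twoSidedEmbedding_mul hσ hτ a x b a' x' b')

theorem toTwoSidedCrossedProduct_one :
    toTwoSidedCrossedProduct hσ hτ (1 ⊗ₜ (1 ⊗ₜ 1)) = 1 := by
  refine Subtype.ext ((twoSidedEmbedding_tmul hσ hτ 1 1 1).trans ?_)
  simp (disch := fun_prop) only [sweedler_comul_one]
  rfl

end TwoSided

/-! ### The two-sided smash coproduct -/

section Comodule

variable {K H A B P : Type*} [Field K] [Ring H] [Bialgebra K H] [AddCommGroup P] [Module K P]
  [AddCommGroup A] [Module K A] [Coalgebra K A] [AddCommGroup B] [Module K B] [Coalgebra K B]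
  (coA : LeftComoduleCoalgebra K H A) (coB : RightComoduleCoalgebra K H B)

local notation "Δ" => Coalgebra.comul (R := K)
local notation "ε" => Coalgebra.counit (R := K)

namespace LeftComoduleCoalgebra

theorem sweedler_coact_coact (a : A) (f : H → H → A → P)
    (h₁ : ∀ y z, IsLinearMap K fun x => f x y z) (h₂ : ∀ x z, IsLinearMap K fun y => f x y z)
    (h₃ : ∀ x y, IsLinearMap K fun z => f x y z) :
    (sweedler (coA.coact a) fun h₁ w => sweedler (coA.coact w) fun h₂ a₀ => f h₁ h₂ a₀) =
      sweedler (coA.coact a) fun h a₀ => sweedler (Δ h) fun h₁ h₂ => f h₁ h₂ a₀ := by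
  have h := congrArg (fun t => sweedler t fun x d => sweedler d fun y z => f x y z) (coA.coassoc a)
  simp (disch := fun_prop) only [sweedler_assoc, sweedler_rTensor, sweedler_lTensor] at h
  exact h.symm

theorem sweedler_counit_coact (a : A) (f : A → P) (hf : IsLinearMap K f) :
    (sweedler (coA.coact a) fun h a₀ => ε h • f a₀) = f a := by
  have h := congrArg (fun t => sweedler t fun x y => x • f y) (coA.counit_coact a)
  simp (disch := fun_prop) only [sweedler_rTensor, sweedler_tmul, one_smul] at h
  exact h

theorem sweedler_coact_comul (a : A) (f : H → A → A → P)
    (h₁ : ∀ y z, IsLinearMap K fun x => f x y z) (h₂ : ∀ x z, IsLinearMap K fun y => f x y z)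
    (h₃ : ∀ x y, IsLinearMap K fun z => f x y z) :
    (sweedler (coA.coact a) fun h a₀ => sweedler (Δ a₀) fun a₁ a₂ => f h a₁ a₂) =
      sweedler (Δ a) fun a₁ a₂ => sweedler (coA.coact a₁) fun h u =>
        sweedler (coA.coact a₂) fun k v => f (h * k) u v := by
  have h := congrArg (fun t => sweedler t fun x d => sweedler d fun y z => f x y z)
    (coA.coact_comul a)
  simp (disch := fun_prop) only [Δ₂, sweedler_lTensor, sweedler_sweedler, sweedler_tmul] at h
  exact h

theorem sweedler_coact_counit (a : A) (f : H → P) (hf : IsLinearMap K f) :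
    (sweedler (coA.coact a) fun h a₀ => ε a₀ • f h) = ε a • f 1 := by
  have h := congrArg hf.mk' (coA.coact_counit a)
  simpa only [map_sweedler, map_smul, IsLinearMap.mk'_apply] using h

/-- Coassociativity of `a ↦ a₁ ⊗ a₂₋₁ ⊗ a₂₀`, the restriction of the smash coproduct to `A`. -/
theorem sweedler_smash_coassoc (a : A) (f : A → H → A → H → A → P)
    (h₁ : ∀ x y z w, IsLinearMap K fun u => f u x y z w)
    (h₂ : ∀ u y z w, IsLinearMap K fun x => f u x y z w)
    (h₃ : ∀ u x z w, IsLinearMap K fun y => f u x y z w)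
    (h₄ : ∀ u x y w, IsLinearMap K fun z => f u x y z w)
    (h₅ : ∀ u x y z, IsLinearMap K fun w => f u x y z w) :
    (sweedler (Δ a) fun a₁ a₂ => sweedler (coA.coact a₂) fun h a₀ => sweedler (Δ a₁) fun p q =>
      sweedler (coA.coact q) fun l q₀ => sweedler (Δ h) fun h₁ h₂ => f p (l * h₁) q₀ h₂ a₀) =
    sweedler (Δ a) fun a₁ a₂ => sweedler (coA.coact a₂) fun h a₀ => sweedler (Δ a₀) fun p q =>
      sweedler (coA.coact q) fun l q₀ => f a₁ h p l q₀ := by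
  conv_lhs =>
    enter [2, a₁, a₂]
    rw [sweedler_comm]
  simp (disch := fun_prop) only [sweedler_coassoc, sweedler_coact_comul]
  refine sweedler_congr fun a₁ d => sweedler_congr fun p q => ?_
  rw [sweedler_comm]
  simp (disch := fun_prop) only [sweedler_coact_coact]

end LeftComoduleCoalgebra

namespace RightComoduleCoalgebra

theorem sweedler_coact_coact (b : B) (f : B → H → H → P)
    (h₁ : ∀ y z, IsLinearMap K fun x => f x y z) (h₂ : ∀ x z, IsLinearMap K fun y => f x y z)
    (h₃ : ∀ x y, IsLinearMap K fun z => f x y z) :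
    (sweedler (coB.coact b) fun w k₂ => sweedler (coB.coact w) fun b₀ k₁ => f b₀ k₁ k₂) =
      sweedler (coB.coact b) fun b₀ k => sweedler (Δ k) fun k₁ k₂ => f b₀ k₁ k₂ := by
  have h := congrArg (fun t => sweedler t fun x d => sweedler d fun y z => f x y z) (coB.coassoc b)
  simp (disch := fun_prop) only [sweedler_assoc, sweedler_rTensor, sweedler_lTensor] at h
  exact h

theorem sweedler_counit_coact (b : B) (f : B → P) (hf : IsLinearMap K f) :
    (sweedler (coB.coact b) fun b₀ k => ε k • f b₀) = f b := by
  have h := congrArg (fun t => sweedler t fun x y => y • f x) (coB.counit_coact b)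
  simp (disch := fun_prop) only [sweedler_lTensor, sweedler_tmul, one_smul] at h
  exact h

theorem sweedler_coact_comul (b : B) (f : B → B → H → P)
    (h₁ : ∀ y z, IsLinearMap K fun x => f x y z) (h₂ : ∀ x z, IsLinearMap K fun y => f x y z)
    (h₃ : ∀ x y, IsLinearMap K fun z => f x y z) :
    (sweedler (coB.coact b) fun b₀ k => sweedler (Δ b₀) fun b₁ b₂ => f b₁ b₂ k) =
      sweedler (Δ b) fun b₁ b₂ => sweedler (coB.coact b₁) fun u h =>
        sweedler (coB.coact b₂) fun v k => f u v (h * k) := by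
  have h := congrArg (fun t => sweedler t fun d z => sweedler d fun x y => f x y z)
    (coB.coact_comul b)
  simp (disch := fun_prop) only [Δ₂, sweedler_rTensor, sweedler_sweedler, sweedler_tmul] at h
  exact h

theorem sweedler_coact_counit (b : B) (f : H → P) (hf : IsLinearMap K f) :
    (sweedler (coB.coact b) fun b₀ k => ε b₀ • f k) = ε b • f 1 := by
  have h := congrArg hf.mk' (coB.coact_counit b)
  simpa only [map_sweedler, map_smul, IsLinearMap.mk'_apply] using h

/-- Coassociativity of `b ↦ b₁₍₀₎ ⊗ b₁₍₁₎ ⊗ b₂`, the restriction of the smash coproduct to `B`. -/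
theorem sweedler_smash_coassoc (b : B) (f : B → H → B → H → B → P)
    (h₁ : ∀ x y z w, IsLinearMap K fun u => f u x y z w)
    (h₂ : ∀ u y z w, IsLinearMap K fun x => f u x y z w)
    (h₃ : ∀ u x z w, IsLinearMap K fun y => f u x y z w)
    (h₄ : ∀ u x y w, IsLinearMap K fun z => f u x y z w)
    (h₅ : ∀ u x y z, IsLinearMap K fun w => f u x y z w) :
    (sweedler (Δ b) fun b₁ b₂ => sweedler (coB.coact b₁) fun b₀ k => sweedler (Δ b₀) fun r s =>
      sweedler (coB.coact r) fun r₀ m => f r₀ m s k b₂) =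
    sweedler (Δ b) fun b₁ b₂ => sweedler (coB.coact b₁) fun b₀ k => sweedler (Δ b₂) fun r s =>
      sweedler (coB.coact r) fun r₀ m => sweedler (Δ k) fun k₁ k₂ => f b₀ k₁ r₀ (k₂ * m) s := by
  simp (disch := fun_prop) only [sweedler_coassoc, sweedler_coact_comul]
  refine sweedler_congr fun b₁ d => ?_
  rw [sweedler_comm (coB.coact b₁)]
  refine sweedler_congr fun r s => ?_
  rw [sweedler_comm (coB.coact b₁), sweedler_comm (coB.coact b₁)]
  refine sweedler_congr fun r₀ m => ?_
  simp (disch := fun_prop) only [sweedler_coact_coact]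

end RightComoduleCoalgebra

section Smash

variable {E : Type*} [AddCommGroup E] [Module K E] (e : A ⊗[K] (H ⊗[K] B) ≃ₗ[K] E)

local notation "⟪" a ", " x ", " b "⟫" => e (a ⊗ₜ[K] (x ⊗ₜ[K] b))

/-- The two-sided smash coproduct, transported along `e`. -/
noncomputable def smashComulLinear : E →ₗ[K] E ⊗[K] E :=
  IsLinearMap.mk' (fun z => sweedler (e.symm z) fun a y => sweedler y fun x b =>
    sweedler (Δ a) fun a₁ a₂ => sweedler (coA.coact a₂) fun h a₀ => sweedler (Δ x) fun x₁ x₂ =>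
    sweedler (Δ b) fun b₁ b₂ => sweedler (coB.coact b₁) fun b₀ k =>
      ⟪a₁, h * x₁, b₀⟫ ⊗ₜ[K] ⟪a₀, x₂ * k, b₂⟫) (by fun_prop)

/-- The counit `ε_A ⊗ ε_H ⊗ ε_B`, transported along `e`. -/
noncomputable def smashCounitLinear : E →ₗ[K] K :=
  IsLinearMap.mk' (fun z => sweedler (e.symm z) fun a y => sweedler y fun x b =>
    ε a * ε x * ε b) (by fun_prop)

theorem smashComulLinear_tmul (a : A) (x : H) (b : B) :
    smashComulLinear coA coB e ⟪a, x, b⟫ =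
    sweedler (Δ a) fun a₁ a₂ => sweedler (coA.coact a₂) fun h a₀ => sweedler (Δ x) fun x₁ x₂ =>
    sweedler (Δ b) fun b₁ b₂ => sweedler (coB.coact b₁) fun b₀ k =>
      ⟪a₁, h * x₁, b₀⟫ ⊗ₜ[K] ⟪a₀, x₂ * k, b₂⟫ := by
  rw [smashComulLinear, IsLinearMap.mk'_apply]
  simp (disch := fun_prop) only [LinearEquiv.symm_apply_apply, sweedler_tmul]

theorem smashCounitLinear_tmul (a : A) (x : H) (b : B) :
    smashCounitLinear e ⟪a, x, b⟫ = ε a * ε x * ε b := by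
  rw [smashCounitLinear, IsLinearMap.mk'_apply]
  simp (disch := fun_prop) only [LinearEquiv.symm_apply_apply, sweedler_tmul]

variable {e} in
omit [Coalgebra K A] [Coalgebra K B] in
/-- Linear maps out of `E ≃ A ⊗ H ⊗ B` agree if they agree on pure tensors. -/
theorem eq_of_tmul_tmul {f g : E →ₗ[K] P} (h : ∀ a x b, f ⟪a, x, b⟫ = g ⟪a, x, b⟫) : f = g := by
  have : f ∘ₗ e.toLinearMap = g ∘ₗ e.toLinearMap :=
    TensorProduct.ext' fun a y => by
      apply eq_of_tmul y
      · fun_prop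
      · fun_prop
      exact fun x b => h a x b
  ext z
  simpa using DFunLike.congr_fun this (e.symm z)

theorem smashComulLinear_coassoc :
    TensorProduct.assoc K E E E ∘ₗ (smashComulLinear coA coB e).rTensor E ∘ₗ
      smashComulLinear coA coB e =
    (smashComulLinear coA coB e).lTensor E ∘ₗ smashComulLinear coA coB e := by
  refine eq_of_tmul_tmul (e := e) fun a x b => ?_
  simp (disch := fun_prop) only [LinearMap.comp_apply, LinearEquiv.coe_coe, smashComulLinear_tmul,
    map_sweedler, LinearMap.rTensor_tmul, LinearMap.lTensor_tmul, sweedler_tmul_right,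
    tmul_sweedler_right, TensorProduct.assoc_tmul, sweedler_comul_mul]
  conv_lhs =>
    enter [2, a₁, a₂, 2, h, a₀]
    simp only [sweedler_pull (Δ h)]
    simp only [sweedler_pull (Δ a₁)]
    enter [2, p, q]
    simp only [sweedler_pull (coA.coact q)]
    enter [2, l, q₀, 2, h₁, h₂, 2, x₁, x₂]
    simp only [sweedler_pull (Δ x₁)]
  conv_rhs =>
    enter [2, a₁, a₂, 2, h, a₀]
    simp only [sweedler_pull (Δ a₀)]
    enter [2, p, q]
    simp only [sweedler_pull (coA.coact q)]
    enter [2, l, q₀, 2, x₁, x₂]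
    simp only [sweedler_pull (Δ x₂)]
    enter [2, u, v, 2, b₁, b₂, 2, b₀, k]
    simp only [sweedler_pull (Δ b₂)]
    enter [2, r, s]
    simp only [sweedler_pull (coB.coact r)]
  simp (disch := fun_prop) only [sweedler_coassoc, ← mul_assoc]
  refine (coA.sweedler_smash_coassoc a (fun a₁ h₁ a₂ h₂ a₃ =>
    sweedler (Δ x) fun x₁ d => sweedler (Δ d) fun x₂ x₃ => sweedler (Δ b) fun b₁ b₂ =>
      sweedler (coB.coact b₁) fun b₀ k => sweedler (Δ b₀) fun r s =>
      sweedler (coB.coact r) fun r₀ m =>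
        ⟪a₁, h₁ * x₁, r₀⟫ ⊗ₜ[K] (⟪a₂, h₂ * x₂ * m, s⟫ ⊗ₜ[K] ⟪a₃, x₃ * k, b₂⟫)) (by fun_prop)
        (by fun_prop) (by fun_prop) (by fun_prop) (by fun_prop)).trans ?_
  refine sweedler_congr fun a₁ a₂ => sweedler_congr fun h a₀ => sweedler_congr fun p q =>
    sweedler_congr fun l q₀ => sweedler_congr fun x₁ d => sweedler_congr fun x₂ x₃ => ?_
  have hb := coB.sweedler_smash_coassoc b (fun b₁ k₁ b₂ k₂ b₃ =>
    ⟪a₁, h * x₁, b₁⟫ ⊗ₜ[K] (⟪p, l * x₂ * k₁, b₂⟫ ⊗ₜ[K] ⟪q₀, x₃ * k₂, b₃⟫)) (by fun_prop)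
        (by fun_prop) (by fun_prop) (by fun_prop) (by fun_prop)
  simp only [← mul_assoc] at hb
  exact hb

/-- The two-sided smash coproduct, transported along `e`. -/
noncomputable abbrev smashCoalgebra : Coalgebra K E where
  comul := smashComulLinear coA coB e
  counit := smashCounitLinear e
  coassoc := smashComulLinear_coassoc coA coB e
  rTensor_counit_comp_comul := by
    refine eq_of_tmul_tmul (e := e) fun a x b => ?_
    have hk : ∀ (c d : K) (z : E), (c * d) ⊗ₜ[K] z = (c * d) • ((1 : K) ⊗ₜ[K] z) :=
      fun c d z => by
      rw [TensorProduct.smul_tmul', smul_eq_mul, mul_one]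
    simp (disch := fun_prop) only [LinearMap.comp_apply, smashComulLinear_tmul, map_sweedler,
      LinearMap.rTensor_tmul, smashCounitLinear_tmul, Bialgebra.counit_mul, hk, mul_smul,
      sweedler_smul, coA.sweedler_counit_coact, coB.sweedler_coact_counit, sweedler_counit_left,
      mul_one, TensorProduct.mk_apply]
  lTensor_counit_comp_comul := by
    refine eq_of_tmul_tmul (e := e) fun a x b => ?_
    have hk : ∀ (c d : K) (z : E), z ⊗ₜ[K] (c * d) = (c * d) • (z ⊗ₜ[K] (1 : K)) :=
      fun c d z => by
      rw [← TensorProduct.tmul_smul, smul_eq_mul, mul_one]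
    simp (disch := fun_prop) only [LinearMap.comp_apply, smashComulLinear_tmul, map_sweedler,
      LinearMap.lTensor_tmul, smashCounitLinear_tmul, Bialgebra.counit_mul, hk, mul_smul,
      sweedler_smul, coB.sweedler_counit_coact, coA.sweedler_coact_counit, sweedler_counit_right,
      one_mul, LinearMap.flip_apply, TensorProduct.mk_apply]

end Smash

end Comodule

/-! ### Products in the two-sided crossed product -/

/-- `e` carries the two-sided crossed product multiplication to the multiplication of `E`. -/
def IsCrossedMul {K H A B E : Type*} [Field K] [Ring H] [Bialgebra K H] [Ring A] [Algebra K A]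
    [Ring B] [Algebra K B] [Ring E] [Algebra K E] (wA : LeftWeakAction K H A)
    (wB : RightWeakAction K H B) (σ : H →ₗ[K] H →ₗ[K] A) (τ : H →ₗ[K] H →ₗ[K] B)
    (e : A ⊗[K] (H ⊗[K] B) ≃ₗ[K] E) : Prop :=
  ∀ (a : A) (x : H) (b : B) (a' : A) (x' : H) (b' : B),
    e (a ⊗ₜ[K] (x ⊗ₜ[K] b)) * e (a' ⊗ₜ[K] (x' ⊗ₜ[K] b')) =
      e (crossedMul wA.act wB.act σ τ a x b a' x' b')

section Products

variable {K H A B E : Type*} [Field K] [Ring H] [Bialgebra K H] [Ring A] [Algebra K A]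
  [Ring B] [Algebra K B] {wA : LeftWeakAction K H A} {wB : RightWeakAction K H B}
  {σ : H →ₗ[K] H →ₗ[K] A} {τ : H →ₗ[K] H →ₗ[K] B}
  [Ring E] [Algebra K E] {e : A ⊗[K] (H ⊗[K] B) ≃ₗ[K] E}

local notation "Δ" => Coalgebra.comul (R := K)
local notation "⟪" a ", " x ", " b "⟫" => e (a ⊗ₜ[K] (x ⊗ₜ[K] b))
local notation:74 x:75 " ▷ " a:74 => LeftWeakAction.act wA x a
local notation:74 b:75 " ◁ " x:75 => RightWeakAction.act wB b x

variable (he : IsCrossedMul wA wB σ τ e)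

namespace IsCrossedMul
include he

theorem mul_eq (a : A) (x : H) (b : B) (a' : A) (x' : H) (b' : B) :
    ⟪a, x, b⟫ * ⟪a', x', b'⟫ =
      sweedler (Δ x) fun x₁ d => sweedler (Δ d) fun x₂ d => sweedler (Δ d) fun x₃ x₄ =>
      sweedler (Δ x') fun y₁ d => sweedler (Δ d) fun y₂ d => sweedler (Δ d) fun y₃ y₄ =>
        ⟪a * (x₁ ▷ a') * σ x₂ y₁, x₃ * y₂, τ x₄ y₃ * (b ◁ y₄) * b'⟫ := by
  rw [he]
  simp only [crossedMul, Δ₄, Δ₃, Δ₂, linearEquiv_sweedler]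

section Special

variable (hσ : IsLeftCrossedProduct wA.act σ) (hτ : IsRightCrossedProduct wB.act τ)
include hσ hτ

theorem mul_of_one_left (a a' : A) (x' : H) (b' : B) :
    ⟪a, 1, 1⟫ * ⟪a', x', b'⟫ = ⟪a * a', x', b'⟫ := by
  simp (disch := fun_prop) only [he.mul_eq, sweedler_comul_one, wA.one_act, wB.one_act,
    hσ.map_one_left, hτ.map_one_left, mul_smul_comm, smul_mul_assoc, one_mul, mul_one,
    ← TensorProduct.smul_tmul', TensorProduct.tmul_smul, map_smul, sweedler_smul,
    sweedler_counit_left, sweedler_counit_right]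

theorem mul_of_one_right (a : A) (x : H) (b b' : B) :
    ⟪a, x, b⟫ * ⟪1, 1, b'⟫ = ⟪a, x, b * b'⟫ := by
  simp (disch := fun_prop) only [he.mul_eq, sweedler_comul_one, wA.act_one, wB.act_one,
    hσ.map_one_right, hτ.map_one_right, mul_smul_comm, smul_mul_assoc, one_mul, mul_one,
    ← TensorProduct.smul_tmul', TensorProduct.tmul_smul, map_smul, sweedler_smul,
    sweedler_counit_left, sweedler_counit_right]

theorem H_mul_A (x : H) (a : A) :
    ⟪1, x, 1⟫ * ⟪a, 1, 1⟫ = sweedler (Δ x) fun x₁ x₂ => ⟪x₁ ▷ a, x₂, 1⟫ := by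
  simp (disch := fun_prop) only [he.mul_eq, sweedler_comul_one, wB.act_one, hσ.map_one_right,
    hτ.map_one_right, mul_smul_comm, one_mul, mul_one, ← TensorProduct.smul_tmul',
    TensorProduct.tmul_smul, map_smul, sweedler_smul, sweedler_counit_left, sweedler_counit_right]

theorem B_mul_H (b : B) (x : H) :
    ⟪1, 1, b⟫ * ⟪1, x, 1⟫ = sweedler (Δ x) fun x₁ x₂ => ⟪1, x₁, b ◁ x₂⟫ := by
  simp (disch := fun_prop) only [he.mul_eq, sweedler_comul_one, wA.act_one, hσ.map_one_left,
    hτ.map_one_left, mul_smul_comm, smul_mul_assoc, one_mul, mul_one, ← TensorProduct.smul_tmul',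
    TensorProduct.tmul_smul, map_smul, sweedler_smul, sweedler_counit_left]

theorem BH_mul_A (k : H) (b : B) (a : A) :
    ⟪1, k, b⟫ * ⟪a, 1, 1⟫ = sweedler (Δ k) fun k₁ k₂ => ⟪k₁ ▷ a, k₂, b⟫ := by
  simp (disch := fun_prop) only [he.mul_eq, sweedler_comul_one, wB.act_one, hσ.map_one_right,
    hτ.map_one_right, mul_smul_comm, smul_mul_assoc, one_mul, mul_one, ← TensorProduct.smul_tmul',
    TensorProduct.tmul_smul, map_smul, sweedler_smul, sweedler_counit_left, sweedler_counit_right]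

theorem B_mul_AH (b : B) (a : A) (h : H) :
    ⟪1, 1, b⟫ * ⟪a, h, 1⟫ = sweedler (Δ h) fun h₁ h₂ => ⟪a, h₁, b ◁ h₂⟫ := by
  simp (disch := fun_prop) only [he.mul_eq, sweedler_comul_one, wA.one_act, hσ.map_one_left,
    hτ.map_one_left, mul_smul_comm, smul_mul_assoc, one_mul, mul_one, ← TensorProduct.smul_tmul',
    TensorProduct.tmul_smul, map_smul, sweedler_smul, sweedler_counit_left]

theorem B_mul_A (b : B) (a : A) : ⟪1, 1, b⟫ * ⟪a, 1, 1⟫ = ⟪a, 1, b⟫ := by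
  simp (disch := fun_prop) only [he.BH_mul_A hσ hτ, sweedler_comul_one, wA.one_act]

theorem A_mul_H_mul_B (a : A) (x : H) (b : B) :
    ⟪a, 1, 1⟫ * ⟪1, x, 1⟫ * ⟪1, 1, b⟫ = ⟪a, x, b⟫ := by
  rw [he.mul_of_one_left hσ hτ, he.mul_of_one_right hσ hτ, mul_one, one_mul]

end Special

theorem AH_mul_AH (a : A) (x : H) (a' : A) (x' : H) :
    ⟪a, x, 1⟫ * ⟪a', x', 1⟫ = sweedler (Δ x) fun x₁ d => sweedler (Δ d) fun x₂ d =>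
      sweedler (Δ d) fun x₃ x₄ => sweedler (Δ x') fun y₁ d => sweedler (Δ d) fun y₂ y₃ =>
        ⟪a * (x₁ ▷ a') * σ x₂ y₁, x₃ * y₂, τ x₄ y₃⟫ := by
  simp (disch := fun_prop) only [he.mul_eq, wB.one_act, mul_smul_comm, mul_one,
    TensorProduct.tmul_smul, map_smul, sweedler_counit_right]

theorem HB_mul_HB (x : H) (b : B) (x' : H) (b' : B) :
    ⟪1, x, b⟫ * ⟪1, x', b'⟫ = sweedler (Δ x) fun x₁ d => sweedler (Δ d) fun x₂ x₃ =>
      sweedler (Δ x') fun y₁ d => sweedler (Δ d) fun y₂ d => sweedler (Δ d) fun y₃ y₄ =>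
        ⟪σ x₁ y₁, x₂ * y₂, τ x₃ y₃ * (b ◁ y₄) * b'⟫ := by
  simp (disch := fun_prop) only [he.mul_eq, wA.act_one, smul_mul_assoc, mul_smul_comm, one_mul,
    ← TensorProduct.smul_tmul', map_smul, sweedler_smul, sweedler_counit_left]

theorem H_mul_H (x x' : H) : ⟪1, x, 1⟫ * ⟪1, x', 1⟫ = sweedler (Δ x) fun x₁ d =>
    sweedler (Δ d) fun x₂ x₃ => sweedler (Δ x') fun y₁ d => sweedler (Δ d) fun y₂ y₃ =>
      ⟪σ x₁ y₁, x₂ * y₂, τ x₃ y₃⟫ := by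
  simp (disch := fun_prop) only [he.HB_mul_HB, wB.one_act, mul_smul_comm, mul_one,
    TensorProduct.tmul_smul, map_smul, sweedler_counit_right]

end IsCrossedMul

/-- The linear map on `E` that is given on the elements `e (a ⊗ x ⊗ b)` by a trilinear `f`. -/
noncomputable def tripleLift {P : Type*} [AddCommGroup P] [Module K P]
    (e : A ⊗[K] (H ⊗[K] B) ≃ₗ[K] E) (f : A → H → B → P)
    (h₁ : ∀ x b, IsLinearMap K fun a => f a x b) (h₂ : ∀ a b, IsLinearMap K fun x => f a x b)
    (h₃ : ∀ a x, IsLinearMap K fun b => f a x b) : E →ₗ[K] P :=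
  IsLinearMap.mk' (fun z => sweedler (e.symm z) fun a y => sweedler y fun x b => f a x b)
    (by fun_prop)

theorem tripleLift_tmul {P : Type*} [AddCommGroup P] [Module K P] (f : A → H → B → P)
    (h₁ : ∀ x b, IsLinearMap K fun a => f a x b) (h₂ : ∀ a b, IsLinearMap K fun x => f a x b)
    (h₃ : ∀ a x, IsLinearMap K fun b => f a x b) (a : A) (x : H) (b : B) :
    tripleLift e f h₁ h₂ h₃ ⟪a, x, b⟫ = f a x b := by
  rw [tripleLift, IsLinearMap.mk'_apply]
  simp (disch := fun_prop) only [LinearEquiv.symm_apply_apply, sweedler_tmul]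

end Products

/-! ### Projections to the tensor factors -/

/-- The counit of `A` is compatible with the structure maps of a left crossed product `A #^σ H`. -/
structure LeftCounital {K H A : Type*} [Field K] [Ring H] [Bialgebra K H] [Ring A] [Algebra K A]
    [Coalgebra K A] (wA : LeftWeakAction K H A) (σ : H →ₗ[K] H →ₗ[K] A) : Prop where
  counit_mul : ∀ a a' : A, Coalgebra.counit (R := K) (a * a') =
    Coalgebra.counit (R := K) a * Coalgebra.counit (R := K) a'
  counit_act : ∀ (x : H) (a : A), Coalgebra.counit (R := K) (wA.act x a) =
    Coalgebra.counit (R := K) a * Coalgebra.counit (R := K) x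
  counit_cocycle : ∀ x x' : H, Coalgebra.counit (R := K) (σ x x') =
    Coalgebra.counit (R := K) x * Coalgebra.counit (R := K) x'

/-- The counit of `B` is compatible with the structure maps of a right crossed product `H ^τ# B`. -/
structure RightCounital {K H B : Type*} [Field K] [Ring H] [Bialgebra K H] [Ring B] [Algebra K B]
    [Coalgebra K B] (wB : RightWeakAction K H B) (τ : H →ₗ[K] H →ₗ[K] B) : Prop where
  counit_mul : ∀ b b' : B, Coalgebra.counit (R := K) (b * b') =
    Coalgebra.counit (R := K) b * Coalgebra.counit (R := K) b'
  counit_act : ∀ (b : B) (x : H), Coalgebra.counit (R := K) (wB.act b x) =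
    Coalgebra.counit (R := K) b * Coalgebra.counit (R := K) x
  counit_cocycle : ∀ x x' : H, Coalgebra.counit (R := K) (τ x x') =
    Coalgebra.counit (R := K) x * Coalgebra.counit (R := K) x'

section Projections

variable {K H A B E : Type*} [Field K] [Ring H] [Bialgebra K H] [Ring A] [Algebra K A]
  [Coalgebra K A] [Ring B] [Algebra K B] [Coalgebra K B] {wA : LeftWeakAction K H A}
  {wB : RightWeakAction K H B} {σ : H →ₗ[K] H →ₗ[K] A} {τ : H →ₗ[K] H →ₗ[K] B}
  [Ring E] [Algebra K E] (e : A ⊗[K] (H ⊗[K] B) ≃ₗ[K] E)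

local notation "Δ" => Coalgebra.comul (R := K)
local notation "ε" => Coalgebra.counit (R := K)
local notation "⟪" a ", " x ", " b "⟫" => e (a ⊗ₜ[K] (x ⊗ₜ[K] b))
local notation:74 x:75 " ▷ " a:74 => LeftWeakAction.act wA x a
local notation:74 b:75 " ◁ " x:75 => RightWeakAction.act wB b x

/-- The projection `a ⊗ x ⊗ b ↦ ε(x) ε(b) a`. -/
noncomputable def projA : E →ₗ[K] A :=
  tripleLift e (fun a x b => ε x • ε b • a) (by fun_prop) (by fun_prop) (by fun_prop)

/-- The projection `a ⊗ x ⊗ b ↦ ε(a) ε(b) x`. -/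
noncomputable def projH : E →ₗ[K] H :=
  tripleLift e (fun a x b => ε a • ε b • x) (by fun_prop) (by fun_prop) (by fun_prop)

/-- The projection `a ⊗ x ⊗ b ↦ ε(a) ε(x) b`. -/
noncomputable def projB : E →ₗ[K] B :=
  tripleLift e (fun a x b => ε a • ε x • b) (by fun_prop) (by fun_prop) (by fun_prop)

/-- The projection `a ⊗ x ⊗ b ↦ ε(b) a ⊗ x`. -/
noncomputable def projAH : E →ₗ[K] A ⊗[K] H :=
  tripleLift e (fun a x b => ε b • a ⊗ₜ x) (by fun_prop) (by fun_prop) (by fun_prop)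

/-- The projection `a ⊗ x ⊗ b ↦ ε(a) x ⊗ b`. -/
noncomputable def projHB : E →ₗ[K] H ⊗[K] B :=
  tripleLift e (fun a x b => ε a • x ⊗ₜ b) (by fun_prop) (by fun_prop) (by fun_prop)

omit [Coalgebra K A] in
theorem projA_tmul (a : A) (x : H) (b : B) : projA e ⟪a, x, b⟫ = ε x • ε b • a :=
  tripleLift_tmul ..

theorem projH_tmul (a : A) (x : H) (b : B) : projH e ⟪a, x, b⟫ = ε a • ε b • x :=
  tripleLift_tmul ..

omit [Coalgebra K B] in
theorem projB_tmul (a : A) (x : H) (b : B) : projB e ⟪a, x, b⟫ = ε a • ε x • b :=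
  tripleLift_tmul ..

omit [Coalgebra K A] in
theorem projAH_tmul (a : A) (x : H) (b : B) : projAH e ⟪a, x, b⟫ = ε b • a ⊗ₜ x :=
  tripleLift_tmul ..

omit [Coalgebra K B] in
theorem projHB_tmul (a : A) (x : H) (b : B) : projHB e ⟪a, x, b⟫ = ε a • x ⊗ₜ b :=
  tripleLift_tmul ..

variable {e} (he : IsCrossedMul wA wB σ τ e)
include he

omit [Coalgebra K A] in
theorem projA_mul (hB : RightCounital wB τ) (a : A) (x : H) (b : B) (a' : A) (x' : H) (b' : B) :
    projA e (⟪a, x, b⟫ * ⟪a', x', b'⟫) =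
      ε b • ε b' • sweedler (Δ x) fun x₁ x₂ => a * (x₁ ▷ a') * σ x₂ x' := by
  simp (disch := fun_prop) only [he.mul_eq, map_sweedler, projA_tmul, hB.counit_mul, hB.counit_act,
    hB.counit_cocycle, Bialgebra.counit_mul, mul_smul, sweedler_smul, sweedler_counit_left,
    sweedler_counit_right, smul_comm (_ : K) (ε b)]

omit [Coalgebra K A] in
theorem projAH_mul (hB : RightCounital wB τ) (a : A) (x : H) (b : B) (a' : A) (x' : H) (b' : B) :
    projAH e (⟪a, x, b⟫ * ⟪a', x', b'⟫) =
      ε b • ε b' • sweedler (Δ x) fun x₁ d => sweedler (Δ d) fun x₂ x₃ =>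
        sweedler (Δ x') fun y₁ y₂ => (a * (x₁ ▷ a') * σ x₂ y₁) ⊗ₜ[K] (x₃ * y₂) := by
  simp (disch := fun_prop) only [he.mul_eq, map_sweedler, projAH_tmul, hB.counit_mul, hB.counit_act,
    hB.counit_cocycle, mul_smul, sweedler_smul, sweedler_counit_left, sweedler_counit_right]

omit [Coalgebra K B] in
theorem projB_mul (hA : LeftCounital wA σ) (a : A) (x : H) (b : B) (a' : A) (x' : H) (b' : B) :
    projB e (⟪a, x, b⟫ * ⟪a', x', b'⟫) =
      ε a • ε a' • sweedler (Δ x') fun y₁ y₂ => τ x y₁ * (b ◁ y₂) * b' := by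
  simp (disch := fun_prop) only [he.mul_eq, map_sweedler, projB_tmul, hA.counit_mul, hA.counit_act,
    hA.counit_cocycle, Bialgebra.counit_mul, mul_smul, sweedler_smul, sweedler_counit_left]

omit [Coalgebra K B] in
theorem projHB_mul (hA : LeftCounital wA σ) (a : A) (x : H) (b : B) (a' : A) (x' : H) (b' : B) :
    projHB e (⟪a, x, b⟫ * ⟪a', x', b'⟫) =
      ε a • ε a' • sweedler (Δ x) fun x₁ x₂ => sweedler (Δ x') fun y₁ d =>
        sweedler (Δ d) fun y₂ y₃ => (x₁ * y₁) ⊗ₜ[K] (τ x₂ y₂ * (b ◁ y₃) * b') := by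
  simp (disch := fun_prop) only [he.mul_eq, map_sweedler, projHB_tmul, hA.counit_mul, hA.counit_act,
    hA.counit_cocycle, mul_smul, sweedler_smul, sweedler_counit_left]

theorem projH_mul (hA : LeftCounital wA σ) (hB : RightCounital wB τ)
    (a : A) (x : H) (b : B) (a' : A) (x' : H) (b' : B) :
    projH e (⟪a, x, b⟫ * ⟪a', x', b'⟫) =
      ε a • ε a' • ε b • ε b' • (x * x') := by
  simp (disch := fun_prop) only [he.mul_eq, map_sweedler, projH_tmul, hA.counit_mul, hA.counit_act,
    hA.counit_cocycle, hB.counit_mul, hB.counit_act, hB.counit_cocycle, mul_smul, sweedler_smul,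
    sweedler_counit_left, sweedler_counit_right]

end Projections

/-! ### Biproducts: counits, units and coproducts of the three factors -/

/-- The linear isomorphism `e` identifies the bialgebra `E` with the two-sided crossed product
`A #^σ H ^τ# B`, carrying the two-sided smash coproduct. -/
structure IsBiproduct {K H A B E : Type*} [Field K] [Ring H] [Bialgebra K H] [Ring A] [Algebra K A]
    [Coalgebra K A] [Ring B] [Algebra K B] [Coalgebra K B] [Ring E] [Bialgebra K E]
    (coA : LeftComoduleCoalgebra K H A) (coB : RightComoduleCoalgebra K H B)
    (wA : LeftWeakAction K H A) (wB : RightWeakAction K H B)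
    (σ : H →ₗ[K] H →ₗ[K] A) (τ : H →ₗ[K] H →ₗ[K] B)
    (e : A ⊗[K] (H ⊗[K] B) ≃ₗ[K] E) : Prop where
  mul : IsCrossedMul wA wB σ τ e
  one : e (1 ⊗ₜ[K] (1 ⊗ₜ[K] 1)) = 1
  comul : Coalgebra.comul = smashComulLinear coA coB e
  counit : Coalgebra.counit = smashCounitLinear (A := A) (H := H) (B := B) e

namespace IsBiproduct

variable {K H A B E : Type*} [Field K] [Ring H] [Bialgebra K H] [Ring A] [Algebra K A]
  [Coalgebra K A] [Ring B] [Algebra K B] [Coalgebra K B] [Ring E] [Bialgebra K E]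
  {coA : LeftComoduleCoalgebra K H A} {coB : RightComoduleCoalgebra K H B}
  {wA : LeftWeakAction K H A} {wB : RightWeakAction K H B}
  {σ : H →ₗ[K] H →ₗ[K] A} {τ : H →ₗ[K] H →ₗ[K] B}
  {e : A ⊗[K] (H ⊗[K] B) ≃ₗ[K] E}

local notation "Δ" => Coalgebra.comul (R := K)
local notation "ε" => Coalgebra.counit (R := K)
local notation "⟪" a ", " x ", " b "⟫" => e (a ⊗ₜ[K] (x ⊗ₜ[K] b))
local notation:74 x:75 " ▷ " a:74 => LeftWeakAction.act wA x a
local notation:74 b:75 " ◁ " x:75 => RightWeakAction.act wB b x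

variable (hE : IsBiproduct coA coB wA wB σ τ e)
include hE

theorem comul_tmul (a : A) (x : H) (b : B) : Δ ⟪a, x, b⟫ =
    sweedler (Δ a) fun a₁ a₂ => sweedler (coA.coact a₂) fun h a₀ => sweedler (Δ x) fun x₁ x₂ =>
      sweedler (Δ b) fun b₁ b₂ => sweedler (coB.coact b₁) fun b₀ k =>
        ⟪a₁, h * x₁, b₀⟫ ⊗ₜ[K] ⟪a₀, x₂ * k, b₂⟫ := by
  rw [hE.comul, smashComulLinear_tmul]

theorem counit_tmul (a : A) (x : H) (b : B) : ε ⟪a, x, b⟫ = ε a * ε x * ε b := by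
  rw [hE.counit, smashCounitLinear_tmul]

/-- The counit of `E` is multiplicative on `A A` and on `H A`. -/
theorem leftCounital (hσ : IsLeftCrossedProduct wA.act σ) (hτ : IsRightCrossedProduct wB.act τ)
    (hA : Coalgebra.counit (R := K) (1 : A) = 1) (hB : Coalgebra.counit (R := K) (1 : B) = 1)
    (hεσ : ∀ x x' : H, Coalgebra.counit (R := K) (σ x x') =
      Coalgebra.counit (R := K) x * Coalgebra.counit (R := K) x') : LeftCounital wA σ where
  counit_mul a a' := by
    have := Bialgebra.counit_mul (R := K) ⟪a, 1, 1⟫ ⟪a', 1, 1⟫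
    simpa only [hE.mul.mul_of_one_left hσ hτ, hE.counit_tmul, Bialgebra.counit_one, hB, mul_one]
      using this
  counit_act x a := by
    have := Bialgebra.counit_mul (R := K) ⟪1, x, 1⟫ ⟪a, 1, 1⟫
    simp (disch := fun_prop) only [hE.mul.H_mul_A hσ hτ, map_sweedler, hE.counit_tmul,
      Bialgebra.counit_one, hA, hB, mul_one, one_mul] at this
    have h := sweedler_counit_right (K := K) x (fun x₁ => ε (x₁ ▷ a)) (by fun_prop)
    simp only [smul_eq_mul] at h
    rw [← h, mul_comm (ε a), ← this]
    exact sweedler_congr fun _ _ => mul_comm _ _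
  counit_cocycle := hεσ

/-- The counit of `E` is multiplicative on `B B` and on `B H`. -/
theorem rightCounital (hσ : IsLeftCrossedProduct wA.act σ) (hτ : IsRightCrossedProduct wB.act τ)
    (hA : Coalgebra.counit (R := K) (1 : A) = 1) (hB : Coalgebra.counit (R := K) (1 : B) = 1)
    (hετ : ∀ x x' : H, Coalgebra.counit (R := K) (τ x x') =
      Coalgebra.counit (R := K) x * Coalgebra.counit (R := K) x') : RightCounital wB τ where
  counit_mul b b' := by
    have := Bialgebra.counit_mul (R := K) ⟪1, 1, b⟫ ⟪1, 1, b'⟫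
    simpa only [hE.mul.mul_of_one_right hσ hτ, hE.counit_tmul, Bialgebra.counit_one, hA, one_mul]
      using this
  counit_act b x := by
    have := Bialgebra.counit_mul (R := K) ⟪1, 1, b⟫ ⟪1, x, 1⟫
    simp (disch := fun_prop) only [hE.mul.B_mul_H hσ hτ, map_sweedler, hE.counit_tmul,
      Bialgebra.counit_one, hA, hB, mul_one, one_mul] at this
    rw [← this]
    exact (sweedler_counit_left x (fun x₂ => ε (b ◁ x₂)) (by fun_prop)).symm
  counit_cocycle := hετ

variable (hA : Coalgebra.counit (R := K) (1 : A) = 1) (hB : Coalgebra.counit (R := K) (1 : B) = 1)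
include hA hB

omit hA in
theorem comul_oneA : Δ (1 : A) = 1 ⊗ₜ 1 := by
  have h := congrArg (TensorProduct.map (projA e) (projA e))
    (Bialgebra.comul_one (R := K) (A := E))
  simp (disch := fun_prop) only [← hE.one, Algebra.TensorProduct.one_def, hE.comul_tmul,
    map_sweedler, TensorProduct.map_tmul, projA_tmul, sweedler_comul_one, Bialgebra.counit_one,
    one_smul, mul_one, one_mul, hB, ← TensorProduct.smul_tmul', TensorProduct.tmul_smul,
    sweedler_counit_right, coA.sweedler_counit_coact, coB.sweedler_counit_coact,
    sweedler_tmul_eq] at h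
  exact h

omit hB in
theorem comul_oneB : Δ (1 : B) = 1 ⊗ₜ 1 := by
  have h := congrArg (TensorProduct.map (projB e) (projB e))
    (Bialgebra.comul_one (R := K) (A := E))
  simp (disch := fun_prop) only [← hE.one, Algebra.TensorProduct.one_def, hE.comul_tmul,
    map_sweedler, TensorProduct.map_tmul, projB_tmul, sweedler_comul_one, Bialgebra.counit_one,
    one_smul, mul_one, one_mul, hA, ← TensorProduct.smul_tmul', TensorProduct.tmul_smul,
    sweedler_smul, sweedler_counit_right, coA.sweedler_coact_counit, coB.sweedler_counit_coact,
    sweedler_tmul_eq] at h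
  exact h

theorem coact_oneA : coA.coact (1 : A) = 1 ⊗ₜ 1 := by
  have h := congrArg (TensorProduct.map (projH e) (projA e))
    (Bialgebra.comul_one (R := K) (A := E))
  simp (disch := fun_prop) only [← hE.one, Algebra.TensorProduct.one_def, hE.comul_tmul,
    map_sweedler, TensorProduct.map_tmul, projA_tmul, projH_tmul, sweedler_comul_one,
    Bialgebra.counit_one, one_smul, mul_one, one_mul, hA, hB, ← TensorProduct.smul_tmul',
    TensorProduct.tmul_smul, sweedler_smul, sweedler_counit_left, sweedler_counit_right,
    coB.sweedler_counit_coact, sweedler_tmul_eq] at h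
  exact h

theorem coact_oneB : coB.coact (1 : B) = 1 ⊗ₜ 1 := by
  have h := congrArg (TensorProduct.map (projB e) (projH e))
    (Bialgebra.comul_one (R := K) (A := E))
  simp (disch := fun_prop) only [← hE.one, Algebra.TensorProduct.one_def, hE.comul_tmul,
    map_sweedler, TensorProduct.map_tmul, projB_tmul, projH_tmul, sweedler_comul_one,
    Bialgebra.counit_one, one_smul, mul_one, one_mul, hA, hB, ← TensorProduct.smul_tmul',
    TensorProduct.tmul_smul, sweedler_smul, sweedler_counit_right, coA.sweedler_coact_counit,
    sweedler_tmul_eq] at h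
  exact h

theorem comul_A (a : A) : Δ ⟪a, 1, 1⟫ = sweedler (Δ a) fun a₁ a₂ =>
    sweedler (coA.coact a₂) fun h a₀ => ⟪a₁, h, 1⟫ ⊗ₜ[K] ⟪a₀, 1, 1⟫ := by
  simp (disch := fun_prop) only [hE.comul_tmul, sweedler_comul_one, hE.comul_oneB hA,
    hE.coact_oneB hA hB, sweedler_tmul, mul_one]

theorem comul_H (x : H) : Δ ⟪1, x, 1⟫ = sweedler (Δ x) fun x₁ x₂ =>
    ⟪1, x₁, 1⟫ ⊗ₜ[K] ⟪1, x₂, 1⟫ := by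
  simp (disch := fun_prop) only [hE.comul_tmul, hE.comul_oneB hA, hE.coact_oneB hA hB,
    hE.comul_oneA hB, hE.coact_oneA hA hB, sweedler_tmul, mul_one, one_mul]

theorem comul_B (b : B) : Δ ⟪1, 1, b⟫ = sweedler (Δ b) fun b₁ b₂ =>
    sweedler (coB.coact b₁) fun b₀ k => ⟪1, 1, b₀⟫ ⊗ₜ[K] ⟪1, k, b₂⟫ := by
  simp (disch := fun_prop) only [hE.comul_tmul, sweedler_comul_one, hE.comul_oneA hB,
    hE.coact_oneA hA hB, sweedler_tmul, one_mul]

end IsBiproduct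

/-! ### Conditions read off from products of two factors -/

namespace IsBiproduct

variable {K H A B E : Type*} [Field K] [Ring H] [Bialgebra K H] [Ring A] [Algebra K A]
  [Coalgebra K A] [Ring B] [Algebra K B] [Coalgebra K B] [Ring E] [Bialgebra K E]
  {coA : LeftComoduleCoalgebra K H A} {coB : RightComoduleCoalgebra K H B}
  {wA : LeftWeakAction K H A} {wB : RightWeakAction K H B}
  {σ : H →ₗ[K] H →ₗ[K] A} {τ : H →ₗ[K] H →ₗ[K] B}
  {e : A ⊗[K] (H ⊗[K] B) ≃ₗ[K] E}

local notation "Δ" => Coalgebra.comul (R := K)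
local notation "⟪" a ", " x ", " b "⟫" => e (a ⊗ₜ[K] (x ⊗ₜ[K] b))
local notation:74 x:75 " ▷ " a:74 => LeftWeakAction.act wA x a
local notation:74 b:75 " ◁ " x:75 => RightWeakAction.act wB b x

variable (hE : IsBiproduct coA coB wA wB σ τ e)
include hE

variable (hA : LeftCounital wA σ) (hB : RightCounital wB τ)
  (hA₁ : Coalgebra.counit (R := K) (1 : A) = 1) (hB₁ : Coalgebra.counit (R := K) (1 : B) = 1)
  (hσ : IsLeftCrossedProduct wA.act σ) (hτ : IsRightCrossedProduct wB.act τ)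
include hA hB hA₁ hB₁ hσ hτ

omit hA in
/-- From `Δ(aa') = Δ(a)Δ(a')`, projected to `A ⊗ A`. -/
theorem comul_mulA (a a' : A) : Δ (a * a') =
    sweedler (Δ a) fun a₁ a₂ => sweedler (Δ a') fun a'₁ a'₂ =>
      sweedler (coA.coact a₂) fun h a₀ => sweedler (coA.coact a'₂) fun h' a'₀ =>
      sweedler (Δ h) fun h₁ h₂ => (a₁ * (h₁ ▷ a'₁) * σ h₂ h') ⊗ₜ[K] (a₀ * a'₀) := by
  have h := congrArg (TensorProduct.map (projA e) (projA e))
    (Bialgebra.comul_mul (R := K) ⟪a, 1, 1⟫ ⟪a', 1, 1⟫)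
  rw [hE.mul.mul_of_one_left hσ hτ, hE.comul_A hA₁ hB₁ a,
    hE.comul_A hA₁ hB₁ a'] at h
  simp only [sweedler_mul_sweedler] at h
  simp only [map_sweedler, hE.comul_tmul, Algebra.TensorProduct.tmul_mul_tmul,
    TensorProduct.map_tmul, projA_mul hE.mul hB, projA_tmul] at h
  simp (disch := fun_prop) only [Bialgebra.counit_one, Bialgebra.counit_mul, one_smul, mul_one, hB₁,
    wA.one_act, hσ.map_one_right, hE.comul_oneB hA₁, sweedler_tmul, mul_smul, mul_smul_comm,
    ← TensorProduct.smul_tmul', TensorProduct.tmul_smul, sweedler_smul, sweedler_tmul_right,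
    sweedler_counit_right, coA.sweedler_counit_coact, coB.sweedler_counit_coact,
    sweedler_tmul_eq] at h
  exact h

/-- From `Δ(aa') = Δ(a)Δ(a')`, projected to `H ⊗ A`. -/
theorem coact_mulA (a a' : A) : coA.coact (a * a') =
    sweedler (coA.coact a) fun h a₀ => sweedler (coA.coact a') fun h' a'₀ =>
      (h * h') ⊗ₜ[K] (a₀ * a'₀) := by
  have h := congrArg (TensorProduct.map (projH e) (projA e))
    (Bialgebra.comul_mul (R := K) ⟪a, 1, 1⟫ ⟪a', 1, 1⟫)
  rw [hE.mul.mul_of_one_left hσ hτ, hE.comul_A hA₁ hB₁ a,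
    hE.comul_A hA₁ hB₁ a'] at h
  simp only [sweedler_mul_sweedler] at h
  simp only [map_sweedler, hE.comul_tmul, Algebra.TensorProduct.tmul_mul_tmul,
    TensorProduct.map_tmul, projH_mul hE.mul hA hB, projA_mul hE.mul hB, projH_tmul,
    projA_tmul] at h
  simp (disch := fun_prop) only [Bialgebra.counit_mul, one_smul, mul_one, hB₁, wA.one_act,
    hσ.map_one_right, hE.comul_oneB hA₁, sweedler_tmul, mul_smul, mul_smul_comm,
    ← TensorProduct.smul_tmul', TensorProduct.tmul_smul, sweedler_smul, sweedler_counit_left,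
    sweedler_counit_right, coB.sweedler_counit_coact, sweedler_tmul_eq] at h
  exact h

omit hB in
/-- From `Δ(bb') = Δ(b)Δ(b')`, projected to `B ⊗ B`. -/
theorem comul_mulB (b b' : B) : Δ (b * b') =
    sweedler (Δ b) fun b₁ b₂ => sweedler (Δ b') fun b'₁ b'₂ =>
      sweedler (coB.coact b₁) fun b₀ k => sweedler (coB.coact b'₁) fun b'₀ k' =>
      sweedler (Δ k') fun k₁ k₂ => (b₀ * b'₀) ⊗ₜ[K] (τ k k₁ * (b₂ ◁ k₂) * b'₂) := by
  have h := congrArg (TensorProduct.map (projB e) (projB e))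
    (Bialgebra.comul_mul (R := K) ⟪1, 1, b⟫ ⟪1, 1, b'⟫)
  rw [hE.mul.mul_of_one_right hσ hτ, hE.comul_B hA₁ hB₁ b,
    hE.comul_B hA₁ hB₁ b'] at h
  simp only [sweedler_mul_sweedler] at h
  simp only [map_sweedler, hE.comul_tmul, Algebra.TensorProduct.tmul_mul_tmul,
    TensorProduct.map_tmul, projB_mul hE.mul hA, projB_tmul] at h
  simp (disch := fun_prop) only [Bialgebra.counit_one, Bialgebra.counit_mul, one_smul, one_mul, hA₁,
    wB.act_one, hτ.map_one_left, hE.comul_oneA hB₁, sweedler_tmul, mul_smul, smul_mul_assoc,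
    ← TensorProduct.smul_tmul', TensorProduct.tmul_smul, sweedler_smul, tmul_sweedler_right,
    sweedler_counit_left, sweedler_counit_right, coB.sweedler_counit_coact,
    coA.sweedler_coact_counit, sweedler_tmul_eq] at h
  exact h

/-- From `Δ(bb') = Δ(b)Δ(b')`, projected to `B ⊗ H`. -/
theorem coact_mulB (b b' : B) : coB.coact (b * b') =
    sweedler (coB.coact b) fun b₀ k => sweedler (coB.coact b') fun b'₀ k' =>
      (b₀ * b'₀) ⊗ₜ[K] (k * k') := by
  have h := congrArg (TensorProduct.map (projB e) (projH e))
    (Bialgebra.comul_mul (R := K) ⟪1, 1, b⟫ ⟪1, 1, b'⟫)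
  rw [hE.mul.mul_of_one_right hσ hτ, hE.comul_B hA₁ hB₁ b,
    hE.comul_B hA₁ hB₁ b'] at h
  simp only [sweedler_mul_sweedler] at h
  simp only [map_sweedler, hE.comul_tmul, Algebra.TensorProduct.tmul_mul_tmul,
    TensorProduct.map_tmul, projB_mul hE.mul hA, projH_mul hE.mul hA hB, projB_tmul,
    projH_tmul] at h
  simp (disch := fun_prop) only [Bialgebra.counit_one, Bialgebra.counit_mul, one_smul, one_mul, hA₁,
    wB.act_one, hτ.map_one_left, hE.comul_oneA hB₁, sweedler_tmul, mul_smul, smul_mul_assoc,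
    ← TensorProduct.smul_tmul', TensorProduct.tmul_smul, sweedler_smul, sweedler_counit_left,
    sweedler_counit_right, coA.sweedler_coact_counit, sweedler_tmul_eq] at h
  exact h

omit hσ hτ in
/-- From `Δ(xx') = Δ(x)Δ(x')`, projected to `H ⊗ A`. -/
theorem coact_σ (x x' : H) :
    (sweedler (Δ x) fun x₁ x₂ => sweedler (Δ x') fun y₁ y₂ =>
      sweedler (coA.coact (σ x₁ y₁)) fun h s => (h * x₂ * y₂) ⊗ₜ[K] s) =
    sweedler (Δ x) fun x₁ x₂ => sweedler (Δ x') fun y₁ y₂ => (x₁ * y₁) ⊗ₜ[K] σ x₂ y₂ := by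
  have h := congrArg (TensorProduct.map (projH e) (projA e))
    (Bialgebra.comul_mul (R := K) ⟪1, x, 1⟫ ⟪1, x', 1⟫)
  rw [hE.mul.H_mul_H, hE.comul_H hA₁ hB₁ x,
    hE.comul_H hA₁ hB₁ x'] at h
  simp only [sweedler_mul_sweedler] at h
  simp only [map_sweedler, hE.comul_tmul, Algebra.TensorProduct.tmul_mul_tmul,
    TensorProduct.map_tmul, projH_mul hE.mul hA hB, projA_mul hE.mul hB, projH_tmul,
    projA_tmul] at h
  simp (disch := fun_prop) only [Bialgebra.counit_mul, one_smul, mul_one, one_mul, hA₁, hB₁,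
    wA.act_one, hB.counit_cocycle, mul_smul, mul_smul_comm, smul_mul_assoc,
    ← TensorProduct.smul_tmul', TensorProduct.tmul_smul, sweedler_smul, sweedler_counit_left,
    sweedler_counit_right, coB.sweedler_counit_coact] at h
  simpa only [mul_assoc] using h

omit hA hσ hτ in
/-- From `Δ(xx') = Δ(x)Δ(x')`, projected to `A ⊗ A`. -/
theorem comul_σ (x x' : H) : Δ (σ x x') =
    sweedler (Δ x) fun x₁ x₂ => sweedler (Δ x') fun y₁ y₂ => σ x₁ y₁ ⊗ₜ[K] σ x₂ y₂ := by
  have h := congrArg (TensorProduct.map (projA e) (projA e))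
    (Bialgebra.comul_mul (R := K) ⟪1, x, 1⟫ ⟪1, x', 1⟫)
  rw [hE.mul.H_mul_H, hE.comul_H hA₁ hB₁ x,
    hE.comul_H hA₁ hB₁ x'] at h
  simp only [sweedler_mul_sweedler] at h
  simp only [map_sweedler, hE.comul_tmul, Algebra.TensorProduct.tmul_mul_tmul,
    TensorProduct.map_tmul, projA_mul hE.mul hB, projA_tmul] at h
  simp (disch := fun_prop) only [Bialgebra.counit_mul, one_smul, mul_one, one_mul, hB₁, wA.act_one,
    hB.counit_cocycle, mul_smul, mul_smul_comm, smul_mul_assoc, ← TensorProduct.smul_tmul',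
    TensorProduct.tmul_smul, sweedler_smul, sweedler_counit_left, sweedler_counit_right,
    coA.sweedler_counit_coact, coB.sweedler_counit_coact, sweedler_tmul_eq] at h
  exact h

omit hσ hτ in
/-- From `Δ(xx') = Δ(x)Δ(x')`, projected to `B ⊗ H`. -/
theorem coact_τ (x x' : H) :
    (sweedler (Δ x) fun x₁ x₂ => sweedler (Δ x') fun y₁ y₂ =>
      sweedler (coB.coact (τ x₂ y₂)) fun t k => t ⊗ₜ[K] (x₁ * y₁ * k)) =
    sweedler (Δ x) fun x₁ x₂ => sweedler (Δ x') fun y₁ y₂ => τ x₁ y₁ ⊗ₜ[K] (x₂ * y₂) := by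
  have h := congrArg (TensorProduct.map (projB e) (projH e))
    (Bialgebra.comul_mul (R := K) ⟪1, x, 1⟫ ⟪1, x', 1⟫)
  rw [hE.mul.H_mul_H, hE.comul_H hA₁ hB₁ x,
    hE.comul_H hA₁ hB₁ x'] at h
  simp only [sweedler_mul_sweedler] at h
  simp only [map_sweedler, hE.comul_tmul, Algebra.TensorProduct.tmul_mul_tmul,
    TensorProduct.map_tmul, projB_mul hE.mul hA, projH_mul hE.mul hA hB, projB_tmul,
    projH_tmul] at h
  simp (disch := fun_prop) only [Bialgebra.counit_one, Bialgebra.counit_mul, one_smul, mul_one, hA₁,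
    hB₁, wB.one_act, hA.counit_cocycle, mul_smul, mul_smul_comm, ← TensorProduct.smul_tmul',
    TensorProduct.tmul_smul, sweedler_smul, sweedler_counit_left, sweedler_counit_right,
    coA.sweedler_coact_counit] at h
  exact h

omit hB hσ hτ in
/-- From `Δ(xx') = Δ(x)Δ(x')`, projected to `B ⊗ B`. -/
theorem comul_τ (x x' : H) : Δ (τ x x') =
    sweedler (Δ x) fun x₁ x₂ => sweedler (Δ x') fun y₁ y₂ => τ x₁ y₁ ⊗ₜ[K] τ x₂ y₂ := by
  have h := congrArg (TensorProduct.map (projB e) (projB e))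
    (Bialgebra.comul_mul (R := K) ⟪1, x, 1⟫ ⟪1, x', 1⟫)
  rw [hE.mul.H_mul_H, hE.comul_H hA₁ hB₁ x,
    hE.comul_H hA₁ hB₁ x'] at h
  simp only [sweedler_mul_sweedler] at h
  simp only [map_sweedler, hE.comul_tmul, Algebra.TensorProduct.tmul_mul_tmul,
    TensorProduct.map_tmul, projB_mul hE.mul hA, projB_tmul] at h
  simp (disch := fun_prop) only [Bialgebra.counit_one, Bialgebra.counit_mul, one_smul, mul_one, hA₁,
    wB.one_act, hA.counit_cocycle, mul_smul, mul_smul_comm, ← TensorProduct.smul_tmul',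
    TensorProduct.tmul_smul, sweedler_smul, sweedler_counit_left, sweedler_counit_right,
    coB.sweedler_counit_coact, coA.sweedler_coact_counit, sweedler_tmul_eq] at h
  exact h

omit hA in
/-- From `Δ(xa) = Δ(x)Δ(a)`, projected to `A ⊗ A`. -/
theorem comul_actA (x : H) (a : A) : Δ (x ▷ a) =
    sweedler (Δ x) fun x₁ d => sweedler (Δ d) fun x₂ x₃ => sweedler (Δ a) fun a₁ a₂ =>
      sweedler (coA.coact a₂) fun h a₀ => ((x₁ ▷ a₁) * σ x₂ h) ⊗ₜ[K] (x₃ ▷ a₀) := by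
  have h := congrArg (TensorProduct.map (projA e) (projA e))
    (Bialgebra.comul_mul (R := K) ⟪1, x, 1⟫ ⟪a, 1, 1⟫)
  rw [hE.mul.H_mul_A hσ hτ, hE.comul_H hA₁ hB₁, hE.comul_A hA₁ hB₁] at h
  simp only [sweedler_mul_sweedler] at h
  simp only [map_sweedler, hE.comul_tmul, mul_sweedler, Algebra.TensorProduct.tmul_mul_tmul,
    TensorProduct.map_tmul, projA_mul hE.mul hB, projA_tmul] at h
  simp (disch := fun_prop) only [Bialgebra.counit_mul, one_smul, mul_one, one_mul, hB₁,
    hσ.map_one_right, hE.comul_oneB hA₁, sweedler_tmul, mul_smul, mul_smul_comm,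
    ← TensorProduct.smul_tmul', TensorProduct.tmul_smul, sweedler_smul, sweedler_tmul_right,
    sweedler_counit_right, coA.sweedler_counit_coact, coB.sweedler_counit_coact,
    sweedler_tmul_eq] at h
  rw [h]
  simp only [sweedler_pull (Δ a)]
  refine sweedler_congr fun a₁ a₂ => ?_
  simp only [sweedler_pull (coA.coact a₂)]
  refine sweedler_congr fun _ _ => ?_
  simp (disch := fun_prop) only [sweedler_coassoc]

/-- From `Δ(xa) = Δ(x)Δ(a)`, projected to `H ⊗ A`. -/
theorem coact_actA (x : H) (a : A) :
    (sweedler (Δ x) fun x₁ x₂ => sweedler (coA.coact (x₁ ▷ a)) fun h c => (h * x₂) ⊗ₜ[K] c) =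
    sweedler (Δ x) fun x₁ x₂ => sweedler (coA.coact a) fun h a₀ => (x₁ * h) ⊗ₜ[K] (x₂ ▷ a₀) := by
  have h := congrArg (TensorProduct.map (projH e) (projA e))
    (Bialgebra.comul_mul (R := K) ⟪1, x, 1⟫ ⟪a, 1, 1⟫)
  rw [hE.mul.H_mul_A hσ hτ, hE.comul_H hA₁ hB₁, hE.comul_A hA₁ hB₁] at h
  simp only [sweedler_mul_sweedler] at h
  simp only [map_sweedler, hE.comul_tmul, mul_sweedler, Algebra.TensorProduct.tmul_mul_tmul,
    TensorProduct.map_tmul, projH_mul hE.mul hA hB, projA_mul hE.mul hB, projH_tmul,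
    projA_tmul] at h
  simp (disch := fun_prop) only [Bialgebra.counit_mul, one_smul, mul_one, one_mul, hA₁, hB₁,
    hσ.map_one_right, hE.comul_oneB hA₁, sweedler_tmul, mul_smul, mul_smul_comm,
    ← TensorProduct.smul_tmul', TensorProduct.tmul_smul, sweedler_smul, sweedler_counit_left,
    sweedler_counit_right, coB.sweedler_counit_coact] at h
  exact h

/-- From `Δ(bx) = Δ(b)Δ(x)`, projected to `B ⊗ H`. -/
theorem coact_actB (b : B) (x : H) :
    (sweedler (Δ x) fun x₁ x₂ => sweedler (coB.coact (b ◁ x₂)) fun c k => c ⊗ₜ[K] (x₁ * k)) =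
    sweedler (Δ x) fun x₁ x₂ => sweedler (coB.coact b) fun b₀ k => (b₀ ◁ x₁) ⊗ₜ[K] (k * x₂) := by
  have h := congrArg (TensorProduct.map (projB e) (projH e))
    (Bialgebra.comul_mul (R := K) ⟪1, 1, b⟫ ⟪1, x, 1⟫)
  rw [hE.mul.B_mul_H hσ hτ, hE.comul_B hA₁ hB₁, hE.comul_H hA₁ hB₁] at h
  simp only [sweedler_mul_sweedler] at h
  simp only [map_sweedler, hE.comul_tmul, sweedler_mul, Algebra.TensorProduct.tmul_mul_tmul,
    TensorProduct.map_tmul, projB_mul hE.mul hA, projH_mul hE.mul hA hB, projB_tmul,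
    projH_tmul] at h
  simp (disch := fun_prop) only [Bialgebra.counit_one, Bialgebra.counit_mul, one_smul, mul_one,
    one_mul, hA₁, hB₁, hτ.map_one_left, hE.comul_oneA hB₁, sweedler_tmul, mul_smul, smul_mul_assoc,
    ← TensorProduct.smul_tmul', TensorProduct.tmul_smul, sweedler_smul, sweedler_counit_left,
    sweedler_counit_right, coA.sweedler_coact_counit] at h
  exact h

omit hB in
/-- From `Δ(bx) = Δ(b)Δ(x)`, projected to `B ⊗ B`. -/
theorem comul_actB (b : B) (x : H) : Δ (b ◁ x) =
    sweedler (Δ b) fun b₁ b₂ => sweedler (coB.coact b₁) fun b₀ k =>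
      sweedler (Δ x) fun x₁ d => sweedler (Δ d) fun x₂ x₃ =>
        (b₀ ◁ x₁) ⊗ₜ[K] (τ k x₂ * (b₂ ◁ x₃)) := by
  have h := congrArg (TensorProduct.map (projB e) (projB e))
    (Bialgebra.comul_mul (R := K) ⟪1, 1, b⟫ ⟪1, x, 1⟫)
  rw [hE.mul.B_mul_H hσ hτ, hE.comul_B hA₁ hB₁, hE.comul_H hA₁ hB₁] at h
  simp only [sweedler_mul_sweedler] at h
  simp only [map_sweedler, hE.comul_tmul, sweedler_mul, Algebra.TensorProduct.tmul_mul_tmul,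
    TensorProduct.map_tmul, projB_mul hE.mul hA, projB_tmul] at h
  simp (disch := fun_prop) only [Bialgebra.counit_one, Bialgebra.counit_mul, one_smul, mul_one,
    one_mul, hA₁, hτ.map_one_left, hE.comul_oneA hB₁, sweedler_tmul, mul_smul, smul_mul_assoc,
    ← TensorProduct.smul_tmul', TensorProduct.tmul_smul, sweedler_smul, tmul_sweedler_right,
    sweedler_counit_left, sweedler_counit_right, coB.sweedler_counit_coact,
    coA.sweedler_coact_counit, sweedler_tmul_eq] at h
  rw [h]
  refine sweedler_congr fun b₁ b₂ => ?_
  simp only [sweedler_pull (coB.coact b₁)]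

omit hA in
/-- From `Δ(ax) = Δ(a)Δ(x)`, projected to `(A ⊗ H) ⊗ A`. -/
theorem twisted_comoduleA (a : A) (x : H) :
    (sweedler (Δ a) fun a₁ a₂ => sweedler (coA.coact a₂) fun h a₀ =>
      a₁ ⊗ₜ[K] ((h * x) ⊗ₜ[K] a₀)) =
    sweedler (Δ a) fun a₁ a₂ => sweedler (coA.coact a₂) fun h a₀ => sweedler (Δ h) fun h₁ h₂ =>
      sweedler (Δ x) fun x₁ x₂ => (a₁ * σ h₁ x₁) ⊗ₜ[K] ((h₂ * x₂) ⊗ₜ[K] a₀) := by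
  have h := congrArg
    (fun t => TensorProduct.assoc K _ _ _ (TensorProduct.map (projAH e) (projA e) t))
    (Bialgebra.comul_mul (R := K) ⟪a, 1, 1⟫ ⟪1, x, 1⟫)
  rw [hE.mul.mul_of_one_left hσ hτ, hE.comul_A hA₁ hB₁, hE.comul_H hA₁ hB₁] at h
  simp only [sweedler_mul_sweedler] at h
  simp only [map_sweedler, linearEquiv_sweedler, hE.comul_tmul, sweedler_mul,
    Algebra.TensorProduct.tmul_mul_tmul, TensorProduct.map_tmul, projAH_mul hE.mul hB,
    projA_mul hE.mul hB, projAH_tmul, projA_tmul] at h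
  simp (disch := fun_prop) only [Bialgebra.counit_mul, one_smul, mul_one, hB₁, wA.act_one,
    hσ.map_one_left, hE.comul_oneB hA₁, sweedler_tmul, mul_smul, mul_smul_comm, smul_mul_assoc,
    ← TensorProduct.smul_tmul', TensorProduct.tmul_smul, sweedler_smul, sweedler_tmul_right,
    sweedler_counit_left, sweedler_counit_right, coB.sweedler_counit_coact, linearEquiv_sweedler,
    map_smul, TensorProduct.assoc_tmul] at h
  exact h

/-- From `Δ(ax) = Δ(a)Δ(x)`, projected to `(H ⊗ B) ⊗ A`. -/
theorem coactA_τ (a : A) (x : H) :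
    (sweedler (coA.coact a) fun h a₀ => (h * x) ⊗ₜ[K] ((1 : B) ⊗ₜ[K] a₀)) =
    sweedler (coA.coact a) fun h a₀ => sweedler (Δ h) fun h₁ h₂ => sweedler (Δ x) fun x₁ x₂ =>
      (h₁ * x₁) ⊗ₜ[K] (τ h₂ x₂ ⊗ₜ[K] a₀) := by
  have h := congrArg
    (fun t => TensorProduct.assoc K _ _ _ (TensorProduct.map (projHB e) (projA e) t))
    (Bialgebra.comul_mul (R := K) ⟪a, 1, 1⟫ ⟪1, x, 1⟫)
  rw [hE.mul.mul_of_one_left hσ hτ, hE.comul_A hA₁ hB₁, hE.comul_H hA₁ hB₁] at h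
  simp only [sweedler_mul_sweedler] at h
  simp only [map_sweedler, linearEquiv_sweedler, hE.comul_tmul, sweedler_mul,
    Algebra.TensorProduct.tmul_mul_tmul, TensorProduct.map_tmul, projHB_mul hE.mul hA,
    projA_mul hE.mul hB, projHB_tmul, projA_tmul] at h
  simp (disch := fun_prop) only [Bialgebra.counit_mul, one_smul, mul_one, hA₁, hB₁, wA.act_one,
    wB.one_act, hσ.map_one_left, hE.comul_oneB hA₁, sweedler_tmul, mul_smul, mul_smul_comm,
    smul_mul_assoc, ← TensorProduct.smul_tmul', TensorProduct.tmul_smul, sweedler_smul,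
    sweedler_tmul_right, sweedler_counit_left, sweedler_counit_right, coB.sweedler_counit_coact,
    linearEquiv_sweedler, map_smul, TensorProduct.assoc_tmul] at h
  exact h

omit hB in
/-- From `Δ(xb) = Δ(x)Δ(b)`, projected to `B ⊗ (H ⊗ B)`. -/
theorem twisted_comoduleB (b : B) (x : H) :
    (sweedler (Δ b) fun b₁ b₂ => sweedler (coB.coact b₁) fun b₀ k =>
      b₀ ⊗ₜ[K] ((x * k) ⊗ₜ[K] b₂)) =
    sweedler (Δ b) fun b₁ b₂ => sweedler (coB.coact b₁) fun b₀ k => sweedler (Δ x) fun x₁ x₂ =>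
      sweedler (Δ k) fun k₁ k₂ => b₀ ⊗ₜ[K] ((x₁ * k₁) ⊗ₜ[K] (τ x₂ k₂ * b₂)) := by
  have h := congrArg (TensorProduct.map (projB e) (projHB e))
    (Bialgebra.comul_mul (R := K) ⟪1, x, 1⟫ ⟪1, 1, b⟫)
  rw [hE.mul.mul_of_one_right hσ hτ, hE.comul_H hA₁ hB₁, hE.comul_B hA₁ hB₁] at h
  simp only [sweedler_mul_sweedler] at h
  simp only [map_sweedler, hE.comul_tmul, mul_sweedler, Algebra.TensorProduct.tmul_mul_tmul,
    TensorProduct.map_tmul, projB_mul hE.mul hA, projHB_mul hE.mul hA, projB_tmul, projHB_tmul] at h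
  simp (disch := fun_prop) only [Bialgebra.counit_one, Bialgebra.counit_mul, one_smul, mul_one,
    one_mul, hA₁, wB.one_act, hτ.map_one_right, hE.comul_oneA hB₁, sweedler_tmul, mul_smul,
    mul_smul_comm, smul_mul_assoc, ← TensorProduct.smul_tmul', TensorProduct.tmul_smul,
    sweedler_smul, tmul_sweedler_right, sweedler_counit_left, sweedler_counit_right,
    coA.sweedler_coact_counit] at h
  exact h

/-- From `Δ(xb) = Δ(x)Δ(b)`, projected to `B ⊗ (A ⊗ H)`. -/
theorem coactB_σ (b : B) (x : H) :
    (sweedler (coB.coact b) fun b₀ k => b₀ ⊗ₜ[K] ((1 : A) ⊗ₜ[K] (x * k))) =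
    sweedler (coB.coact b) fun b₀ k => sweedler (Δ x) fun x₁ x₂ => sweedler (Δ k) fun k₁ k₂ =>
      b₀ ⊗ₜ[K] (σ x₁ k₁ ⊗ₜ[K] (x₂ * k₂)) := by
  have h := congrArg (TensorProduct.map (projB e) (projAH e))
    (Bialgebra.comul_mul (R := K) ⟪1, x, 1⟫ ⟪1, 1, b⟫)
  rw [hE.mul.mul_of_one_right hσ hτ, hE.comul_H hA₁ hB₁, hE.comul_B hA₁ hB₁] at h
  simp only [sweedler_mul_sweedler] at h
  simp only [map_sweedler, hE.comul_tmul, mul_sweedler, Algebra.TensorProduct.tmul_mul_tmul,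
    TensorProduct.map_tmul, projB_mul hE.mul hA, projAH_mul hE.mul hB, projB_tmul, projAH_tmul] at h
  simp (disch := fun_prop) only [Bialgebra.counit_mul, one_smul, mul_one, one_mul, hA₁, hB₁,
    wA.act_one, wB.one_act, hτ.map_one_right, hE.comul_oneA hB₁, sweedler_tmul, mul_smul,
    mul_smul_comm, smul_mul_assoc, ← TensorProduct.smul_tmul', TensorProduct.tmul_smul,
    sweedler_smul, tmul_sweedler_right, sweedler_counit_left, sweedler_counit_right,
    coA.sweedler_counit_coact] at h
  exact h

/-- From `Δ(ba) = Δ(b)Δ(a)`, projected to `B ⊗ A`. -/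
theorem double (a : A) (b : B) :
    (sweedler (coA.coact a) fun h a₀ => sweedler (coB.coact b) fun b₀ k =>
      (k ▷ a₀) ⊗ₜ[K] (b₀ ◁ h)) = a ⊗ₜ[K] b := by
  have h := congrArg
    (fun t => TensorProduct.comm K _ _ (TensorProduct.map (projB e) (projA e) t))
    (Bialgebra.comul_mul (R := K) ⟪1, 1, b⟫ ⟪a, 1, 1⟫)
  rw [hE.mul.B_mul_A hσ hτ, hE.comul_B hA₁ hB₁, hE.comul_A hA₁ hB₁] at h
  simp only [sweedler_mul_sweedler] at h
  simp only [map_sweedler, linearEquiv_sweedler, hE.comul_tmul, Algebra.TensorProduct.tmul_mul_tmul,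
    TensorProduct.map_tmul, projB_mul hE.mul hA, projA_mul hE.mul hB, projB_tmul, projA_tmul] at h
  simp (disch := fun_prop) only [Bialgebra.counit_one, Bialgebra.counit_mul, one_smul, mul_one,
    one_mul, hA₁, hB₁, hσ.map_one_right, hτ.map_one_left, mul_smul, mul_smul_comm, smul_mul_assoc,
    ← TensorProduct.smul_tmul', TensorProduct.tmul_smul, sweedler_smul, sweedler_counit_left,
    sweedler_counit_right, coA.sweedler_counit_coact, coB.sweedler_counit_coact, map_smul,
    TensorProduct.comm_tmul] at h
  rw [h, sweedler_comm]

end IsBiproduct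

/-! ### Absorbing coactions turn weak actions into actions -/

section Twisted

variable {K H A B P : Type*} [Field K] [Ring H] [Bialgebra K H] [AddCommGroup P] [Module K P]

local notation "Δ" => Coalgebra.comul (R := K)

/-- In the presence of a coaction that absorbs the cocycle `τ`, the weak action `◁` behaves like an
action. -/
theorem RightWeakAction.sweedler_act_mul [AddCommGroup A] [Module K A] [Coalgebra K A]
    [Ring B] [Algebra K B] (coA : LeftComoduleCoalgebra K H A) (wB : RightWeakAction K H B)
    {τ : H →ₗ[K] H →ₗ[K] B} (hτ : IsRightCrossedProduct wB.act τ)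
    (habs : ∀ (a : A) (x : H),
      (sweedler (coA.coact a) fun h a₀ => (h * x) ⊗ₜ[K] ((1 : B) ⊗ₜ[K] a₀)) =
      sweedler (coA.coact a) fun h a₀ => sweedler (Δ h) fun h₁ h₂ => sweedler (Δ x) fun x₁ x₂ =>
        (h₁ * x₁) ⊗ₜ[K] (τ h₂ x₂ ⊗ₜ[K] a₀))
    (a : A) (x : H) (b : B) (f : H → B → A → P) (h₁ : ∀ y z, IsLinearMap K fun x => f x y z)
    (h₂ : ∀ x z, IsLinearMap K fun y => f x y z) (h₃ : ∀ x y, IsLinearMap K fun z => f x y z) :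
    (sweedler (coA.coact a) fun h a₀ => sweedler (Δ h) fun h₁ h₂ => sweedler (Δ x) fun x₁ x₂ =>
      f (h₁ * x₁) (wB.act b (h₂ * x₂)) a₀) =
    sweedler (coA.coact a) fun h a₀ => sweedler (Δ h) fun h₁ h₂ => sweedler (Δ x) fun x₁ x₂ =>
      f (h₁ * x₁) (wB.act (wB.act b h₂) x₂) a₀ := by
  have key : ∀ (a : A) (x : H) (g : H → B → A → P) (_ : ∀ y z, IsLinearMap K fun x => g x y z)
      (_ : ∀ x z, IsLinearMap K fun y => g x y z) (_ : ∀ x y, IsLinearMap K fun z => g x y z),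
      (sweedler (coA.coact a) fun h a₀ => g (h * x) 1 a₀) =
      sweedler (coA.coact a) fun h a₀ => sweedler (Δ h) fun h₁ h₂ => sweedler (Δ x) fun x₁ x₂ =>
        g (h₁ * x₁) (τ h₂ x₂) a₀ := by
    intro a x g g₁ g₂ g₃
    have h := congrArg (fun t => sweedler t fun y d => sweedler d fun t a => g y t a) (habs a x)
    simpa (disch := fun_prop) only [sweedler_sweedler, sweedler_tmul] using h
  have h := key a x (fun y t a => sweedler (Δ y) fun y₁ y₂ => f y₁ (wB.act b y₂ * t) a)
    (by fun_prop) (by fun_prop) (by fun_prop)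
  simp (disch := fun_prop) only [sweedler_comul_mul, mul_one] at h
  rw [h]
  -- A cocycle value has been inserted; the twisted module condition moves it to the other side of
  -- the action, where it is absorbed again.
  have tw : ∀ (d d' : H) (g : B → P) (_ : IsLinearMap K g),
      (sweedler (Δ d) fun h₁ h₂ => sweedler (Δ d') fun x₁ x₂ => g (wB.act b (h₁ * x₁) * τ h₂ x₂)) =
      sweedler (Δ d) fun h₁ h₂ => sweedler (Δ d') fun x₁ x₂ =>
        g (τ h₁ x₁ * wB.act (wB.act b h₂) x₂) := by
    intro d d' g hg
    have h := congrArg hg.mk' (hτ.twisted_module d d' b)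
    simp only [Δ₂, map_sweedler, IsLinearMap.mk'_apply] at h
    exact h.symm
  trans sweedler (coA.coact a) fun h a₀ => sweedler (Δ h) fun h₁ d => sweedler (Δ x) fun x₁ d' =>
    sweedler (Δ d) fun h₂ h₃ => sweedler (Δ d') fun x₂ x₃ =>
      f (h₁ * x₁) (τ h₂ x₂ * wB.act (wB.act b h₃) x₃) a₀
  · refine sweedler_congr fun h a₀ => ?_
    rw [sweedler_coassoc₂ h x (fun h₁ x₁ h₂ x₂ h₃ x₃ =>
      f (h₁ * x₁) (wB.act b (h₂ * x₂) * τ h₃ x₃) a₀) (by fun_prop) (by fun_prop) (by fun_prop)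
      (by fun_prop) (by fun_prop) (by fun_prop)]
    exact sweedler_congr fun h₁ d => sweedler_congr fun x₁ d' =>
      tw d d' (fun t => f (h₁ * x₁) t a₀) (by fun_prop)
  trans sweedler (Δ x) fun y x₃ => sweedler (coA.coact a) fun h v => sweedler (Δ h) fun h₁ h₂ =>
    sweedler (Δ y) fun x₁ x₂ => sweedler (coA.coact v) fun h₃ a₀ =>
      f (h₁ * x₁) (τ h₂ x₂ * wB.act (wB.act b h₃) x₃) a₀
  · conv_rhs =>
      enter [2, y, x₃]
      enter [2, h, v]
      simp only [sweedler_pull (coA.coact v)]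
    simp (disch := fun_prop) only [coA.sweedler_coact_coact, sweedler_coassoc]
    simp only [sweedler_pull (Δ x)]
    conv_lhs =>
      enter [2, x₁, d']
      simp only [sweedler_pull (Δ d')]
    conv_rhs =>
      enter [2, y, x₃]
      simp only [sweedler_pull (Δ y)]
    simp (disch := fun_prop) only [sweedler_coassoc]
  trans sweedler (Δ x) fun x₁ x₂ => sweedler (coA.coact a) fun h v =>
    sweedler (coA.coact v) fun h₂ a₀ => f (h * x₁) (wB.act (wB.act b h₂) x₂) a₀
  · refine sweedler_congr fun y x₃ => ?_
    have h := key a y (fun z t v => sweedler (coA.coact v) fun h₃ a₀ =>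
      f z (t * wB.act (wB.act b h₃) x₃) a₀) (by fun_prop) (by fun_prop) (by fun_prop)
    simp only [one_mul] at h
    exact h.symm
  · simp (disch := fun_prop) only [coA.sweedler_coact_coact]
    simp only [sweedler_pull (Δ x)]

/-- In the presence of a coaction that absorbs the cocycle `σ`, the weak action `▷` behaves like an
action. -/
theorem LeftWeakAction.sweedler_mul_act [AddCommGroup B] [Module K B] [Coalgebra K B]
    [Ring A] [Algebra K A] (coB : RightComoduleCoalgebra K H B) (wA : LeftWeakAction K H A)
    {σ : H →ₗ[K] H →ₗ[K] A} (hσ : IsLeftCrossedProduct wA.act σ)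
    (habs : ∀ (b : B) (x : H),
      (sweedler (coB.coact b) fun b₀ k => b₀ ⊗ₜ[K] ((1 : A) ⊗ₜ[K] (x * k))) =
      sweedler (coB.coact b) fun b₀ k => sweedler (Δ x) fun x₁ x₂ => sweedler (Δ k) fun k₁ k₂ =>
        b₀ ⊗ₜ[K] (σ x₁ k₁ ⊗ₜ[K] (x₂ * k₂)))
    (b : B) (x : H) (a : A) (f : B → A → H → P) (h₁ : ∀ y z, IsLinearMap K fun x => f x y z)
    (h₂ : ∀ x z, IsLinearMap K fun y => f x y z) (h₃ : ∀ x y, IsLinearMap K fun z => f x y z) :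
    (sweedler (coB.coact b) fun b₀ k => sweedler (Δ x) fun x₁ x₂ => sweedler (Δ k) fun k₁ k₂ =>
      f b₀ (wA.act (x₁ * k₁) a) (x₂ * k₂)) =
    sweedler (coB.coact b) fun b₀ k => sweedler (Δ x) fun x₁ x₂ => sweedler (Δ k) fun k₁ k₂ =>
      f b₀ (wA.act x₁ (wA.act k₁ a)) (x₂ * k₂) := by
  have key : ∀ (b : B) (x : H) (g : B → A → H → P) (_ : ∀ y z, IsLinearMap K fun x => g x y z)
      (_ : ∀ x z, IsLinearMap K fun y => g x y z) (_ : ∀ x y, IsLinearMap K fun z => g x y z),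
      (sweedler (coB.coact b) fun b₀ k => g b₀ 1 (x * k)) =
      sweedler (coB.coact b) fun b₀ k => sweedler (Δ x) fun x₁ x₂ => sweedler (Δ k) fun k₁ k₂ =>
        g b₀ (σ x₁ k₁) (x₂ * k₂) := by
    intro b x g g₁ g₂ g₃
    have h := congrArg (fun t => sweedler t fun b d => sweedler d fun s y => g b s y) (habs b x)
    simpa (disch := fun_prop) only [sweedler_sweedler, sweedler_tmul] using h
  have h := key b x (fun b s y => sweedler (Δ y) fun y₁ y₂ => f b (s * wA.act y₁ a) y₂)
    (by fun_prop) (by fun_prop) (by fun_prop)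
  simp (disch := fun_prop) only [sweedler_comul_mul, one_mul] at h
  rw [h]
  -- As for the right action: insert a cocycle value, move it past the action, absorb it.
  have tw : ∀ (d d' : H) (g : A → P) (_ : IsLinearMap K g),
      (sweedler (Δ d) fun x₁ x₂ => sweedler (Δ d') fun k₁ k₂ => g (σ x₁ k₁ * wA.act (x₂ * k₂) a)) =
      sweedler (Δ d) fun x₁ x₂ => sweedler (Δ d') fun k₁ k₂ =>
        g (wA.act x₁ (wA.act k₁ a) * σ x₂ k₂) := by
    intro d d' g hg
    have h := congrArg hg.mk' (hσ.twisted_module d d' a)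
    simp only [Δ₂, map_sweedler, IsLinearMap.mk'_apply] at h
    exact h.symm
  trans sweedler (coB.coact b) fun b₀ k => sweedler (Δ x) fun d x₃ => sweedler (Δ k) fun d' k₃ =>
    sweedler (Δ d) fun x₁ x₂ => sweedler (Δ d') fun k₁ k₂ =>
      f b₀ (wA.act x₁ (wA.act k₁ a) * σ x₂ k₂) (x₃ * k₃)
  · refine sweedler_congr fun b₀ k => ?_
    rw [← sweedler_coassoc₂ x k (fun x₁ k₁ x₂ k₂ x₃ k₃ =>
      f b₀ (σ x₁ k₁ * wA.act (x₂ * k₂) a) (x₃ * k₃)) (by fun_prop) (by fun_prop) (by fun_prop)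
      (by fun_prop) (by fun_prop) (by fun_prop)]
    exact sweedler_congr fun d x₃ => sweedler_congr fun d' k₃ =>
      tw d d' (fun t => f b₀ t (x₃ * k₃)) (by fun_prop)
  trans sweedler (Δ x) fun x₁ y => sweedler (coB.coact b) fun v k => sweedler (Δ y) fun x₂ x₃ =>
    sweedler (Δ k) fun k₂ k₃ => sweedler (coB.coact v) fun b₀ k₁ =>
      f b₀ (wA.act x₁ (wA.act k₁ a) * σ x₂ k₂) (x₃ * k₃)
  · conv_rhs =>
      enter [2, x₁, y]
      enter [2, v, k]
      simp only [sweedler_pull (coB.coact v)]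
    conv_rhs =>
      enter [2, x₁, y]
      simp (disch := fun_prop) only [coB.sweedler_coact_coact]
      simp only [sweedler_pull (Δ y)]
    simp only [sweedler_pull (Δ x)]
    conv_lhs =>
      enter [2, d, x₃]
      simp only [sweedler_pull (Δ d)]
    simp (disch := fun_prop) only [sweedler_coassoc]
  trans sweedler (Δ x) fun x₁ x₂ => sweedler (coB.coact b) fun v k =>
    sweedler (coB.coact v) fun b₀ k₁ => f b₀ (wA.act x₁ (wA.act k₁ a)) (x₂ * k)
  · refine sweedler_congr fun x₁ y => ?_
    have h := key b y (fun v t z => sweedler (coB.coact v) fun b₀ k₁ =>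
      f b₀ (wA.act x₁ (wA.act k₁ a) * t) z) (by fun_prop) (by fun_prop) (by fun_prop)
    simp only [mul_one] at h
    exact h.symm
  · simp (disch := fun_prop) only [coB.sweedler_coact_coact]
    simp only [sweedler_pull (Δ x)]

end Twisted

/-! ### The exchange condition of a biproduct -/

namespace IsBiproduct

variable {K H A B E : Type*} [Field K] [Ring H] [Bialgebra K H] [Ring A] [Algebra K A]
  [Coalgebra K A] [Ring B] [Algebra K B] [Coalgebra K B] [Ring E] [Bialgebra K E]
  {coA : LeftComoduleCoalgebra K H A} {coB : RightComoduleCoalgebra K H B}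
  {wA : LeftWeakAction K H A} {wB : RightWeakAction K H B}
  {σ : H →ₗ[K] H →ₗ[K] A} {τ : H →ₗ[K] H →ₗ[K] B}
  {e : A ⊗[K] (H ⊗[K] B) ≃ₗ[K] E}

local notation "Δ" => Coalgebra.comul (R := K)
local notation "ε" => Coalgebra.counit (R := K)
local notation "⟪" a ", " x ", " b "⟫" => e (a ⊗ₜ[K] (x ⊗ₜ[K] b))
local notation:74 x:75 " ▷ " a:74 => LeftWeakAction.act wA x a
local notation:74 b:75 " ◁ " x:75 => RightWeakAction.act wB b x

variable (hE : IsBiproduct coA coB wA wB σ τ e)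
include hE

variable (hA : LeftCounital wA σ) (hB : RightCounital wB τ)
  (hA₁ : Coalgebra.counit (R := K) (1 : A) = 1) (hB₁ : Coalgebra.counit (R := K) (1 : B) = 1)
  (hσ : IsLeftCrossedProduct wA.act σ) (hτ : IsRightCrossedProduct wB.act τ)
include hA hB hA₁ hB₁ hσ hτ

/-- The projection of `Δ(uv) = Δ(u)Δ(v)` to `B ⊗ A` for arbitrary pure tensors `u`, `v`. It
contains `b₍₀₎ ◁ (a'₋₁₂ x'₂)` and `(x₂ b₍₁₎₁) ▷ a'₀`. The conditions `coactA_τ` and `coactB_σ`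
split these into iterated actions, in which `double` cancels the coactions of `a'` and `b`. -/
theorem exchange (a a' : A) (x x' : H) (b b' : B) :
    (sweedler (Δ x) fun x₁ d => sweedler (Δ d) fun x₂ x₃ =>
      sweedler (Δ x') fun y₁ d => sweedler (Δ d) fun y₂ y₃ =>
        (τ x₃ y₂ * (b ◁ y₃) * b') ⊗ₜ[K] (a * (x₁ ▷ a') * σ x₂ y₁)) =
    sweedler (coA.coact a) fun h a₀ => sweedler (coA.coact a') fun h' a'₀ =>
    sweedler (coB.coact b) fun b₀ k => sweedler (coB.coact b') fun b'₀ k' =>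
    sweedler (Δ x) fun x₁ d => sweedler (Δ d) fun x₂ x₃ =>
      sweedler (Δ x') fun y₁ d => sweedler (Δ d) fun y₂ y₃ =>
        (τ (h * x₁) (h' * y₁) * (b₀ ◁ y₂) * b'₀) ⊗ₜ[K]
          (a₀ * (x₂ ▷ a'₀) * σ (x₃ * k) (y₃ * k')) := by
  have map_comul : ∀ a x b, TensorProduct.map (projB e) (projA e) (Δ ⟪a, x, b⟫) =
      ε x • b ⊗ₜ[K] a := by
    intro a x b
    simp (disch := fun_prop) only [hE.comul_tmul, map_sweedler, TensorProduct.map_tmul, projA_tmul,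
      projB_tmul, Bialgebra.counit_mul, mul_smul, ← TensorProduct.smul_tmul',
      TensorProduct.tmul_smul, sweedler_smul, sweedler_counit_left, sweedler_counit_right,
      coA.sweedler_counit_coact, coB.sweedler_counit_coact]
  have h := congrArg (TensorProduct.map (projB e) (projA e))
    (Bialgebra.comul_mul (R := K) ⟪a, x, b⟫ ⟪a', x', b'⟫)
  rw [hE.mul.mul_eq, hE.comul_tmul a x b, hE.comul_tmul a' x' b'] at h
  simp only [sweedler_mul_sweedler] at h
  simp only [map_sweedler, map_comul, Algebra.TensorProduct.tmul_mul_tmul, TensorProduct.map_tmul,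
    projB_mul hE.mul hA, projA_mul hE.mul hB] at h
  simp (disch := fun_prop) only [Bialgebra.counit_mul, mul_smul, sweedler_smul,
    ← TensorProduct.smul_tmul', TensorProduct.tmul_smul, sweedler_smul, sweedler_counit_left,
    sweedler_counit_right, sweedler_tmul_right, tmul_sweedler_right, sweedler_comul_mul] at h
  rw [h]
  clear h
  -- Move the sums over `a'` and `b` inside the others.
  trans sweedler (coA.coact a) fun h a₀ => sweedler (Δ x) fun x₁ d => sweedler (Δ x') fun y y₃ =>
    sweedler (coB.coact b') fun b'₀ k' => sweedler (coB.coact b) fun b₀ k =>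
    sweedler (coA.coact a') fun h' a'₀ => sweedler (Δ h') fun h₁ h₂ => sweedler (Δ y) fun y₁ y₂ =>
    sweedler (Δ d) fun x₂ x₃ => sweedler (Δ k) fun k₁ k₂ =>
      (τ (h * x₁) (h₁ * y₁) * (b₀ ◁ (h₂ * y₂)) * b'₀) ⊗ₜ[K]
        (a₀ * ((x₂ * k₁) ▷ a'₀) * σ (x₃ * k₂) (y₃ * k'))
  · refine sweedler_congr fun h a₀ => ?_
    simp only [sweedler_pull (coA.coact a')]
    simp only [sweedler_pull (coB.coact b)]
    simp only [sweedler_pull (coB.coact b')]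
    simp only [sweedler_pull (Δ x')]
    simp only [sweedler_pull (Δ x)]
    refine sweedler_congr fun _ d => sweedler_congr fun y _ => sweedler_congr fun _ _ =>
      sweedler_congr fun _ _ => sweedler_congr fun h' _ => ?_
    simp only [sweedler_pull (Δ y)]
    simp only [sweedler_pull (Δ h')]
  -- Split both products in the acting arguments, using the absorption of `τ` and of `σ`.
  trans sweedler (coA.coact a) fun h a₀ => sweedler (Δ x) fun x₁ d => sweedler (Δ x') fun y y₃ =>
    sweedler (coB.coact b') fun b'₀ k' => sweedler (coB.coact b) fun b₀ k =>
    sweedler (coA.coact a') fun h' a'₀ => sweedler (Δ h') fun h₁ h₂ => sweedler (Δ y) fun y₁ y₂ =>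
    sweedler (Δ d) fun x₂ x₃ => sweedler (Δ k) fun k₁ k₂ =>
      (τ (h * x₁) (h₁ * y₁) * ((b₀ ◁ h₂) ◁ y₂) * b'₀) ⊗ₜ[K]
        (a₀ * (x₂ ▷ (k₁ ▷ a'₀)) * σ (x₃ * k₂) (y₃ * k'))
  · refine sweedler_congr fun h a₀ => sweedler_congr fun x₁ d => sweedler_congr fun y y₃ =>
      sweedler_congr fun b'₀ k' => ?_
    trans sweedler (coB.coact b) fun b₀ k =>
      sweedler (coA.coact a') fun h' a'₀ => sweedler (Δ h') fun h₁ h₂ => sweedler (Δ y) fun y₁ y₂ =>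
      sweedler (Δ d) fun x₂ x₃ => sweedler (Δ k) fun k₁ k₂ =>
        (τ (h * x₁) (h₁ * y₁) * ((b₀ ◁ h₂) ◁ y₂) * b'₀) ⊗ₜ[K]
          (a₀ * ((x₂ * k₁) ▷ a'₀) * σ (x₃ * k₂) (y₃ * k'))
    · exact sweedler_congr fun b₀ k => wB.sweedler_act_mul coA hτ
        (hE.coactA_τ hA hB hA₁ hB₁ hσ hτ) a' y b₀
        (fun z β α => sweedler (Δ d) fun x₂ x₃ => sweedler (Δ k) fun k₁ k₂ =>
          (τ (h * x₁) z * β * b'₀) ⊗ₜ[K] (a₀ * ((x₂ * k₁) ▷ α) * σ (x₃ * k₂) (y₃ * k')))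
        (by fun_prop) (by fun_prop) (by fun_prop)
    · simp only [sweedler_pull (coA.coact a')]
      refine sweedler_congr fun h' a'₀ => ?_
      simp only [sweedler_pull (Δ y)]
      simp only [sweedler_pull (Δ h')]
      exact sweedler_congr fun h₁ h₂ => sweedler_congr fun y₁ y₂ => wA.sweedler_mul_act coB hσ
        (hE.coactB_σ hA hB hA₁ hB₁ hσ hτ) b d a'₀
        (fun β α z => (τ (h * x₁) (h₁ * y₁) * ((β ◁ h₂) ◁ y₂) * b'₀) ⊗ₜ[K]
          (a₀ * α * σ z (y₃ * k')))
        (by fun_prop) (by fun_prop) (by fun_prop)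
  have key : ∀ (v : A) (w : B) (g : B → A → B ⊗[K] A) (_ : ∀ y, IsLinearMap K fun x => g x y)
      (_ : ∀ x, IsLinearMap K fun y => g x y), (sweedler (coA.coact v) fun h α =>
      sweedler (coB.coact w) fun β k => g (β ◁ h) (k ▷ α)) = g w v := by
    intro v w g g₁ g₂
    have h := congrArg (fun t => sweedler t fun x y => g y x)
      (hE.double hA hB hA₁ hB₁ hσ hτ v w)
    simpa (disch := fun_prop) only [sweedler_sweedler, sweedler_tmul] using h
  -- The inner actions now form `b₍₁₎ ▷ a'₀ ⊗ b₍₀₎ ◁ a'₋₁`, which equals `a' ⊗ b`.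
  trans sweedler (coA.coact a) fun h a₀ => sweedler (Δ x) fun x₁ d => sweedler (Δ x') fun y y₃ =>
    sweedler (coB.coact b') fun b'₀ k' => sweedler (Δ y) fun y₁ y₂ =>
    sweedler (Δ d) fun x₂ x₃ => sweedler (coB.coact b) fun w k =>
    sweedler (coA.coact a') fun h' v =>
      (τ (h * x₁) (h' * y₁) * (w ◁ y₂) * b'₀) ⊗ₜ[K]
        (a₀ * (x₂ ▷ v) * σ (x₃ * k) (y₃ * k'))
  · refine sweedler_congr fun h a₀ => sweedler_congr fun x₁ d => sweedler_congr fun y y₃ =>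
      sweedler_congr fun b'₀ k' => ?_
    simp only [sweedler_pull (Δ d)]
    simp only [sweedler_pull (Δ y)]
    refine sweedler_congr fun y₁ y₂ => sweedler_congr fun x₂ x₃ => ?_
    trans sweedler (coB.coact b) fun w k => sweedler (coA.coact a') fun h' v =>
      sweedler (coA.coact v) fun h₂ α => sweedler (coB.coact w) fun β k₁ =>
      (τ (h * x₁) (h' * y₁) * ((β ◁ h₂) ◁ y₂) * b'₀) ⊗ₜ[K]
        (a₀ * (x₂ ▷ (k₁ ▷ α)) * σ (x₃ * k) (y₃ * k'))
    · conv_rhs =>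
        enter [2, w, k]
        simp only [sweedler_pull (coB.coact w)]
      simp (disch := fun_prop) only [coA.sweedler_coact_coact, coB.sweedler_coact_coact]
      refine sweedler_congr fun b₀ k => ?_
      simp only [sweedler_pull (Δ k)]
    · exact sweedler_congr fun w k => sweedler_congr fun h' v => key v w (fun β α =>
        (τ (h * x₁) (h' * y₁) * (β ◁ y₂) * b'₀) ⊗ₜ[K]
          (a₀ * (x₂ ▷ α) * σ (x₃ * k) (y₃ * k'))) (by fun_prop) (by fun_prop)
  refine sweedler_congr fun h a₀ => ?_
  simp only [sweedler_pull (coA.coact a')]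
  simp only [sweedler_pull (coB.coact b)]
  simp only [sweedler_pull (coB.coact b')]
  simp only [sweedler_pull (Δ x')]
  simp only [sweedler_pull (Δ x)]
  refine sweedler_congr fun x₁ d => ?_
  simp only [sweedler_pull (Δ d)]
  refine sweedler_congr fun x₂ x₃ => ?_
  conv_lhs =>
    enter [2, y, y₃]
    simp only [sweedler_pull (Δ y)]
  conv_rhs =>
    enter [2, y₁, y]
    simp only [sweedler_pull (Δ y)]
  simp (disch := fun_prop) only [sweedler_coassoc]

end IsBiproduct

/-! ### Compatibility conditions inside multilinear expressions -/

namespace CompatibilityConditions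

variable {K H A B P : Type*} [Field K] [Ring H] [Bialgebra K H] [Ring A] [Algebra K A]
  [Coalgebra K A] [Ring B] [Algebra K B] [Coalgebra K B] [AddCommGroup P] [Module K P]
  {coA : LeftComoduleCoalgebra K H A} {coB : RightComoduleCoalgebra K H B}
  {wA : LeftWeakAction K H A} {wB : RightWeakAction K H B}
  {σ : H →ₗ[K] H →ₗ[K] A} {τ : H →ₗ[K] H →ₗ[K] B}

local notation "Δ" => Coalgebra.comul (R := K)
local notation:74 x:75 " ▷ " a:74 => LeftWeakAction.act wA x a
local notation:74 b:75 " ◁ " x:75 => RightWeakAction.act wB b x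

variable (C : CompatibilityConditions coA.coact coB.coact wA.act wB.act σ τ)
include C

theorem sweedler_twisted_comoduleA (a : A) (x : H) (f : A → H → A → P)
    (h₁ : ∀ y z, IsLinearMap K fun x => f x y z) (h₂ : ∀ x z, IsLinearMap K fun y => f x y z)
    (h₃ : ∀ x y, IsLinearMap K fun z => f x y z) :
    (sweedler (Δ a) fun a₁ a₂ => sweedler (coA.coact a₂) fun h a₀ => f a₁ (h * x) a₀) =
    sweedler (Δ a) fun a₁ a₂ => sweedler (coA.coact a₂) fun h a₀ => sweedler (Δ h) fun h₁ h₂ =>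
      sweedler (Δ x) fun x₁ x₂ => f (a₁ * σ h₁ x₁) (h₂ * x₂) a₀ := by
  have h := congrArg (fun t => sweedler t fun x d => sweedler d fun y z => f x y z)
    (C.twisted_comoduleA a x)
  simpa (disch := fun_prop) only [Δ₂, sweedler_sweedler, sweedler_tmul] using h

theorem sweedler_twisted_comoduleB (b : B) (x : H) (f : B → H → B → P)
    (h₁ : ∀ y z, IsLinearMap K fun x => f x y z) (h₂ : ∀ x z, IsLinearMap K fun y => f x y z)
    (h₃ : ∀ x y, IsLinearMap K fun z => f x y z) :
    (sweedler (Δ b) fun b₁ b₂ => sweedler (coB.coact b₁) fun b₀ k => f b₀ (x * k) b₂) =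
    sweedler (Δ b) fun b₁ b₂ => sweedler (coB.coact b₁) fun b₀ k => sweedler (Δ x) fun x₁ x₂ =>
      sweedler (Δ k) fun k₁ k₂ => f b₀ (x₁ * k₁) (τ x₂ k₂ * b₂) := by
  have h := congrArg (fun t => sweedler t fun x d => sweedler d fun y z => f x y z)
    (C.twisted_comoduleB b x)
  simpa (disch := fun_prop) only [Δ₂, sweedler_sweedler, sweedler_tmul] using h

theorem sweedler_coactA_τ (a : A) (x : H) (f : H → B → A → P)
    (h₁ : ∀ y z, IsLinearMap K fun x => f x y z) (h₂ : ∀ x z, IsLinearMap K fun y => f x y z)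
    (h₃ : ∀ x y, IsLinearMap K fun z => f x y z) :
    (sweedler (coA.coact a) fun h a₀ => f (h * x) 1 a₀) =
    sweedler (coA.coact a) fun h a₀ => sweedler (Δ h) fun h₁ h₂ => sweedler (Δ x) fun x₁ x₂ =>
      f (h₁ * x₁) (τ h₂ x₂) a₀ := by
  have h := congrArg (fun t => sweedler t fun x d => sweedler d fun y z => f x y z)
    (C.coactA_τ a x)
  simpa (disch := fun_prop) only [Δ₂, sweedler_sweedler, sweedler_tmul] using h

theorem sweedler_coactB_σ (b : B) (x : H) (f : B → A → H → P)
    (h₁ : ∀ y z, IsLinearMap K fun x => f x y z) (h₂ : ∀ x z, IsLinearMap K fun y => f x y z)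
    (h₃ : ∀ x y, IsLinearMap K fun z => f x y z) :
    (sweedler (coB.coact b) fun b₀ k => f b₀ 1 (x * k)) =
    sweedler (coB.coact b) fun b₀ k => sweedler (Δ x) fun x₁ x₂ => sweedler (Δ k) fun k₁ k₂ =>
      f b₀ (σ x₁ k₁) (x₂ * k₂) := by
  have h := congrArg (fun t => sweedler t fun x d => sweedler d fun y z => f x y z)
    (C.coactB_σ b x)
  simpa (disch := fun_prop) only [Δ₂, sweedler_sweedler, sweedler_tmul] using h

theorem sweedler_coact_σ (x x' : H) (f : H → A → P)
    (h₁ : ∀ y, IsLinearMap K fun x => f x y) (h₂ : ∀ x, IsLinearMap K fun y => f x y) :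
    (sweedler (Δ x) fun x₁ x₂ => sweedler (Δ x') fun y₁ y₂ =>
      sweedler (coA.coact (σ x₁ y₁)) fun h s => f (h * (x₂ * y₂)) s) =
    sweedler (Δ x) fun x₁ x₂ => sweedler (Δ x') fun y₁ y₂ => f (x₁ * y₁) (σ x₂ y₂) := by
  have h := congrArg (fun t => sweedler t fun x y => f x y) (C.coact_σ x x')
  simpa (disch := fun_prop) only [Δ₂, Δ₃, sweedler_sweedler, sweedler_tmul, mul_assoc] using h

theorem sweedler_coact_actA (x : H) (a : A) (f : H → A → P)
    (h₁ : ∀ y, IsLinearMap K fun x => f x y) (h₂ : ∀ x, IsLinearMap K fun y => f x y) :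
    (sweedler (Δ x) fun x₁ x₂ => sweedler (coA.coact (x₁ ▷ a)) fun h c => f (h * x₂) c) =
    sweedler (Δ x) fun x₁ x₂ => sweedler (coA.coact a) fun h a₀ => f (x₁ * h) (x₂ ▷ a₀) := by
  have h := congrArg (fun t => sweedler t fun x y => f x y) (C.coact_actA x a)
  simpa (disch := fun_prop) only [Δ₂, Δ₃, sweedler_sweedler, sweedler_tmul] using h

theorem sweedler_coact_actB (b : B) (x : H) (f : B → H → P)
    (h₁ : ∀ y, IsLinearMap K fun x => f x y) (h₂ : ∀ x, IsLinearMap K fun y => f x y) :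
    (sweedler (Δ x) fun x₁ x₂ => sweedler (coB.coact (b ◁ x₂)) fun c k => f c (x₁ * k)) =
    sweedler (Δ x) fun x₁ x₂ => sweedler (coB.coact b) fun b₀ k => f (b₀ ◁ x₁) (k * x₂) := by
  have h := congrArg (fun t => sweedler t fun x y => f x y) (C.coact_actB b x)
  simpa (disch := fun_prop) only [Δ₂, Δ₃, sweedler_sweedler, sweedler_tmul] using h

theorem sweedler_double (a : A) (b : B) (f : A → B → P)
    (h₁ : ∀ y, IsLinearMap K fun x => f x y) (h₂ : ∀ x, IsLinearMap K fun y => f x y) :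
    (sweedler (coA.coact a) fun h a₀ => sweedler (coB.coact b) fun b₀ k => f (k ▷ a₀) (b₀ ◁ h)) =
    f a b := by
  have h := congrArg (fun t => sweedler t fun x y => f x y) (C.double a b)
  simpa (disch := fun_prop) only [Δ₂, Δ₃, sweedler_sweedler, sweedler_tmul] using h

section Exchange

variable (hσ : IsLeftCrossedProduct wA.act σ) (hτ : IsRightCrossedProduct wB.act τ)
include hσ hτ

omit hσ hτ in
/-- The exchange condition for `a = a' = 1` and `b = b' = 1`. -/
theorem sweedler_τ_σ (x x' : H) (f : B → A → P)
    (h₁ : ∀ y, IsLinearMap K fun x => f x y) (h₂ : ∀ x, IsLinearMap K fun y => f x y) :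
    (sweedler (Δ x) fun x₁ x₂ => sweedler (Δ x') fun y₁ y₂ => f (τ x₂ y₂) (σ x₁ y₁)) =
    sweedler (Δ x) fun x₁ x₂ => sweedler (Δ x') fun y₁ y₂ => f (τ x₁ y₁) (σ x₂ y₂) := by
  have h := C.exchange 1 1 x x' 1 1
  simp (disch := fun_prop) only [Δ₂, Δ₃, sweedler_tmul, C.coact_oneA, C.coact_oneB, wA.act_one,
    wB.one_act, one_mul, mul_one, smul_mul_assoc, mul_smul_comm, ← TensorProduct.smul_tmul',
    TensorProduct.tmul_smul, sweedler_smul, sweedler_counit_left, sweedler_counit_right] at h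
  have h := congrArg (fun t => sweedler t fun x y => f x y) h
  simpa (disch := fun_prop) only [sweedler_sweedler, sweedler_tmul] using h

/-- The exchange condition for `x a'`, all other arguments being `1`. -/
theorem sweedler_τ_actA (x : H) (a : A) (f : B → A → P)
    (h₁ : ∀ y, IsLinearMap K fun x => f x y) (h₂ : ∀ x, IsLinearMap K fun y => f x y) :
    (sweedler (coA.coact a) fun h a₀ => sweedler (Δ x) fun x₁ x₂ => f (τ x₁ h) (x₂ ▷ a₀)) =
    f 1 (x ▷ a) := by
  have h := (C.exchange 1 a x 1 1 1).symm
  simp (disch := fun_prop) only [Δ₂, Δ₃, sweedler_tmul, C.coact_oneA, C.coact_oneB,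
    sweedler_comul_one, wB.act_one, wB.one_act, hσ.map_one_right, hτ.map_one_right, one_mul,
    mul_one, mul_smul_comm, ← TensorProduct.smul_tmul', TensorProduct.tmul_smul,
    sweedler_counit_left, sweedler_counit_right] at h
  have h := congrArg (fun t => sweedler t fun x y => f x y) h
  simpa (disch := fun_prop) only [sweedler_sweedler, sweedler_tmul] using h

/-- The exchange condition for `b x'`, all other arguments being `1`. -/
theorem sweedler_σ_actB (b : B) (x : H) (f : B → A → P)
    (h₁ : ∀ y, IsLinearMap K fun x => f x y) (h₂ : ∀ x, IsLinearMap K fun y => f x y) :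
    (sweedler (coB.coact b) fun b₀ k => sweedler (Δ x) fun x₁ x₂ => f (b₀ ◁ x₁) (σ k x₂)) =
    f (b ◁ x) 1 := by
  have h := (C.exchange 1 1 1 x b 1).symm
  simp (disch := fun_prop) only [Δ₂, Δ₃, sweedler_tmul, C.coact_oneA, C.coact_oneB,
    sweedler_comul_one, wA.act_one, wA.one_act, hσ.map_one_left, hτ.map_one_left, one_mul, mul_one,
    smul_mul_assoc, mul_smul_comm, ← TensorProduct.smul_tmul', TensorProduct.tmul_smul,
    sweedler_smul, sweedler_counit_left] at h
  have h := congrArg (fun t => sweedler t fun x y => f x y) h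
  simpa (disch := fun_prop) only [sweedler_sweedler, sweedler_tmul] using h

end Exchange

end CompatibilityConditions

/-! ### The smash coproduct and products in the order `A`, `H`, `B` -/

namespace CompatibilityConditions

variable {K H A B E P : Type*} [Field K] [Ring H] [Bialgebra K H] [Ring A] [Algebra K A]
  [Coalgebra K A] [Ring B] [Algebra K B] [Coalgebra K B] [Ring E] [Algebra K E]
  [AddCommGroup P] [Module K P]
  {coA : LeftComoduleCoalgebra K H A} {coB : RightComoduleCoalgebra K H B}
  {wA : LeftWeakAction K H A} {wB : RightWeakAction K H B}
  {σ : H →ₗ[K] H →ₗ[K] A} {τ : H →ₗ[K] H →ₗ[K] B}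
  {e : A ⊗[K] (H ⊗[K] B) ≃ₗ[K] E}

local notation "Δ" => Coalgebra.comul (R := K)
local notation "⟪" a ", " x ", " b "⟫" => e (a ⊗ₜ[K] (x ⊗ₜ[K] b))
local notation:74 x:75 " ▷ " a:74 => LeftWeakAction.act wA x a
local notation:74 b:75 " ◁ " x:75 => RightWeakAction.act wB b x
local notation "D" => smashComulLinear coA coB e

variable (C : CompatibilityConditions coA.coact coB.coact wA.act wB.act σ τ)
include C

/-- The coaction on `a₂` absorbs both cocycles: `a₁ σ(a₂₋₁₁, x₁) ⊗ a₂₋₁₂ x₂ ⊗ τ(a₂₋₁₃, x₃) ⊗ a₂₀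
= a₁ ⊗ a₂₋₁ x ⊗ 1 ⊗ a₂₀`. -/
theorem absorb_left (a : A) (x : H) (f : A → H → B → A → P)
    (h₁ : ∀ y z w, IsLinearMap K fun x => f x y z w)
    (h₂ : ∀ x z w, IsLinearMap K fun y => f x y z w)
    (h₃ : ∀ x y w, IsLinearMap K fun z => f x y z w)
    (h₄ : ∀ x y z, IsLinearMap K fun w => f x y z w) :
    (sweedler (Δ a) fun a₁ a₂ => sweedler (coA.coact a₂) fun h a₀ =>
      sweedler (Δ h) fun h₁ d => sweedler (Δ d) fun h₂ h₃ =>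
      sweedler (Δ x) fun x₁ d' => sweedler (Δ d') fun x₂ x₃ =>
        f (a₁ * σ h₁ x₁) (h₂ * x₂) (τ h₃ x₃) a₀) =
    sweedler (Δ a) fun a₁ a₂ => sweedler (coA.coact a₂) fun h a₀ => f a₁ (h * x) 1 a₀ := by
  trans sweedler (Δ x) fun y x₃ => sweedler (Δ a) fun a₁ a₂ => sweedler (coA.coact a₂) fun h w =>
    sweedler (Δ h) fun h₁ h₂ => sweedler (Δ y) fun x₁ x₂ => sweedler (coA.coact w) fun h₃ a₀ =>
      f (a₁ * σ h₁ x₁) (h₂ * x₂) (τ h₃ x₃) a₀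
  · conv_rhs =>
      enter [2, y, x₃, 2, a₁, a₂, 2, h, w]
      simp only [sweedler_pull (coA.coact w)]
    simp (disch := fun_prop) only [coA.sweedler_coact_coact]
    simp only [sweedler_pull (Δ x)]
    conv_rhs =>
      enter [2, y, x₃]
      simp only [sweedler_pull (Δ y)]
    conv_lhs =>
      enter [2, x₁, d']
      simp only [sweedler_pull (Δ d')]
    simp (disch := fun_prop) only [sweedler_coassoc]
  trans sweedler (Δ x) fun x₁ x₂ => sweedler (Δ a) fun a₁ a₂ => sweedler (coA.coact a₂) fun h w =>
    sweedler (coA.coact w) fun h' a₀ => f a₁ (h * x₁) (τ h' x₂) a₀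
  · exact sweedler_congr fun y x₃ => (C.sweedler_twisted_comoduleA a y (fun a₁ z w =>
      sweedler (coA.coact w) fun h₃ a₀ => f a₁ z (τ h₃ x₃) a₀)
      (by fun_prop) (by fun_prop) (by fun_prop)).symm
  · simp (disch := fun_prop) only [coA.sweedler_coact_coact]
    simp only [sweedler_pull (Δ a)]
    refine sweedler_congr fun a₁ a₂ => ?_
    rw [C.sweedler_coactA_τ a₂ x (fun y t a₀ => f a₁ y t a₀)
      (by fun_prop) (by fun_prop) (by fun_prop)]
    simp only [sweedler_pull (Δ x)]

/-- The coaction on `b₁` absorbs both cocycles: `b₁₍₀₎ ⊗ σ(x₁, b₁₍₁₎₁) ⊗ x₂ b₁₍₁₎₂ ⊗ τ(x₃,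
b₁₍₁₎₃) b₂ = b₁₍₀₎ ⊗ 1 ⊗ x b₁₍₁₎ ⊗ b₂`. -/
theorem absorb_right (b : B) (x : H) (f : B → A → H → B → P)
    (h₁ : ∀ y z w, IsLinearMap K fun x => f x y z w)
    (h₂ : ∀ x z w, IsLinearMap K fun y => f x y z w)
    (h₃ : ∀ x y w, IsLinearMap K fun z => f x y z w)
    (h₄ : ∀ x y z, IsLinearMap K fun w => f x y z w) :
    (sweedler (Δ b) fun b₁ b₂ => sweedler (coB.coact b₁) fun b₀ k =>
      sweedler (Δ x) fun x₁ d => sweedler (Δ d) fun x₂ x₃ =>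
      sweedler (Δ k) fun k₁ d' => sweedler (Δ d') fun k₂ k₃ =>
        f b₀ (σ x₁ k₁) (x₂ * k₂) (τ x₃ k₃ * b₂)) =
    sweedler (Δ b) fun b₁ b₂ => sweedler (coB.coact b₁) fun b₀ k => f b₀ 1 (x * k) b₂ := by
  trans sweedler (Δ x) fun x₁ y => sweedler (Δ b) fun b₁ b₂ => sweedler (coB.coact b₁) fun w k =>
    sweedler (Δ y) fun x₂ x₃ => sweedler (Δ k) fun k₂ k₃ => sweedler (coB.coact w) fun b₀ k₁ =>
      f b₀ (σ x₁ k₁) (x₂ * k₂) (τ x₃ k₃ * b₂)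
  · conv_rhs =>
      enter [2, x₁, y, 2, b₁, b₂, 2, w, k]
      simp only [sweedler_pull (coB.coact w)]
    conv_rhs =>
      enter [2, x₁, y]
      simp (disch := fun_prop) only [coB.sweedler_coact_coact]
      simp only [sweedler_pull (Δ y)]
    simp only [sweedler_pull (Δ x)]
    conv_lhs =>
      enter [2, x₁, d]
      simp only [sweedler_pull (Δ d)]
  trans sweedler (Δ x) fun x₁ x₂ => sweedler (Δ b) fun b₁ b₂ => sweedler (coB.coact b₁) fun w k =>
    sweedler (coB.coact w) fun b₀ k' => f b₀ (σ x₁ k') (x₂ * k) b₂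
  · exact sweedler_congr fun x₁ y => (C.sweedler_twisted_comoduleB b y (fun w z b₂ =>
      sweedler (coB.coact w) fun b₀ k₁ => f b₀ (σ x₁ k₁) z b₂)
      (by fun_prop) (by fun_prop) (by fun_prop)).symm
  · simp (disch := fun_prop) only [coB.sweedler_coact_coact]
    simp only [sweedler_pull (Δ b)]
    refine sweedler_congr fun b₁ b₂ => ?_
    rw [C.sweedler_coactB_σ b₁ x (fun b₀ s y => f b₀ s y b₂)
      (by fun_prop) (by fun_prop) (by fun_prop)]
    simp only [sweedler_pull (Δ x)]

theorem comul_A (a : A) : D ⟪a, 1, 1⟫ = sweedler (Δ a) fun a₁ a₂ =>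
    sweedler (coA.coact a₂) fun h a₀ => ⟪a₁, h, 1⟫ ⊗ₜ[K] ⟪a₀, 1, 1⟫ := by
  simp (disch := fun_prop) only [smashComulLinear_tmul, sweedler_comul_one, C.comul_oneB,
    C.coact_oneB, sweedler_tmul, mul_one]

theorem comul_H (x : H) : D ⟪1, x, 1⟫ = sweedler (Δ x) fun x₁ x₂ =>
    ⟪1, x₁, 1⟫ ⊗ₜ[K] ⟪1, x₂, 1⟫ := by
  simp (disch := fun_prop) only [smashComulLinear_tmul, C.comul_oneB, C.coact_oneB, C.comul_oneA,
    C.coact_oneA, sweedler_tmul, mul_one, one_mul]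

theorem comul_B (b : B) : D ⟪1, 1, b⟫ = sweedler (Δ b) fun b₁ b₂ =>
    sweedler (coB.coact b₁) fun b₀ k => ⟪1, 1, b₀⟫ ⊗ₜ[K] ⟪1, k, b₂⟫ := by
  simp (disch := fun_prop) only [smashComulLinear_tmul, sweedler_comul_one, C.comul_oneA,
    C.coact_oneA, sweedler_tmul, one_mul]

variable (he : IsCrossedMul wA wB σ τ e)
  (hσ : IsLeftCrossedProduct wA.act σ) (hτ : IsRightCrossedProduct wB.act τ)
include he hσ hτ

/-- `Δ(a)Δ(x) = Δ(ax)`. -/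
theorem comul_A_mul_comul_H (a : A) (x : H) : D ⟪a, 1, 1⟫ * D ⟪1, x, 1⟫ = D ⟪a, x, 1⟫ := by
  rw [C.comul_A, C.comul_H, smashComulLinear_tmul]
  simp only [sweedler_mul, mul_sweedler]
  simp (disch := fun_prop) only [Algebra.TensorProduct.tmul_mul_tmul, he.mul_of_one_left hσ hτ,
    mul_one, he.AH_mul_AH, wA.act_one, smul_mul_assoc, mul_smul_comm, ← TensorProduct.smul_tmul',
    map_smul, sweedler_smul, sweedler_counit_left, sweedler_tmul_right, C.comul_oneB, C.coact_oneB,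
    sweedler_tmul]
  simp only [sweedler_pull (Δ x)]
  refine sweedler_congr fun y x₂ => ?_
  exact C.absorb_left a y (fun a₁ z t a₀ => ⟪a₁, z, t⟫ ⊗ₜ[K] ⟪a₀, x₂, 1⟫)
    (by fun_prop) (by fun_prop) (by fun_prop) (by fun_prop)

/-- `Δ(ax)Δ(b) = Δ(axb)`. -/
theorem comul_AH_mul_comul_B (a : A) (x : H) (b : B) :
    D ⟪a, x, 1⟫ * D ⟪1, 1, b⟫ = D ⟪a, x, b⟫ := by
  have mul : ∀ (a : A) (x : H) (x' : H) (b' : B), ⟪a, x, 1⟫ * ⟪1, x', b'⟫ =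
      sweedler (Δ x) fun x₁ d => sweedler (Δ d) fun x₂ x₃ => sweedler (Δ x') fun y₁ d' =>
      sweedler (Δ d') fun y₂ y₃ => ⟪a * σ x₁ y₁, x₂ * y₂, τ x₃ y₃ * b'⟫ := by
    intro a x x' b'
    simp (disch := fun_prop) only [he.mul_eq, wA.act_one, wB.one_act, smul_mul_assoc, mul_smul_comm,
      mul_one, ← TensorProduct.smul_tmul', TensorProduct.tmul_smul, map_smul, sweedler_smul,
      sweedler_counit_left, sweedler_counit_right]
  rw [C.comul_B, smashComulLinear_tmul, smashComulLinear_tmul]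
  simp (disch := fun_prop) only [C.comul_oneB, C.coact_oneB, sweedler_tmul, mul_one]
  simp only [sweedler_mul, mul_sweedler]
  simp only [Algebra.TensorProduct.tmul_mul_tmul, he.mul_of_one_right hσ hτ, one_mul, mul,
    tmul_sweedler_right]
  simp only [sweedler_pull (Δ x)]
  simp only [sweedler_pull (Δ a)]
  refine sweedler_congr fun a₁ a₂ => ?_
  simp only [sweedler_pull (coA.coact a₂)]
  refine sweedler_congr fun h a₀ => ?_
  refine sweedler_congr fun x₁ x₂ => ?_
  have := C.absorb_right b x₂ (fun b₀ s z t => ⟪a₁, h * x₁, b₀⟫ ⊗ₜ[K] ⟪a₀ * s, z, t⟫)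
    (by fun_prop) (by fun_prop) (by fun_prop) (by fun_prop)
  simpa only [mul_one] using this

theorem comul_mul_comul_mul_comul (a : A) (x : H) (b : B) :
    D ⟪a, x, b⟫ = D ⟪a, 1, 1⟫ * D ⟪1, x, 1⟫ * D ⟪1, 1, b⟫ := by
  rw [C.comul_A_mul_comul_H he hσ hτ, C.comul_AH_mul_comul_B he hσ hτ]

/-- `Δ(aa') = Δ(a)Δ(a')`. -/
theorem comul_A_mul_comul_A (a a' : A) : D ⟪a, 1, 1⟫ * D ⟪a', 1, 1⟫ = D ⟪a * a', 1, 1⟫ := by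
  rw [C.comul_A, C.comul_A, C.comul_A]
  simp (disch := fun_prop) only [C.comul_mulA, C.coact_mulA, Δ₂, sweedler_sweedler, sweedler_tmul]
  simp only [sweedler_mul_sweedler]
  simp only [Algebra.TensorProduct.tmul_mul_tmul, he.mul_of_one_left hσ hτ, he.AH_mul_AH,
    sweedler_tmul_right]
  refine sweedler_congr fun a₁ a₂ => sweedler_congr fun a'₁ a'₂ => ?_
  trans sweedler (coA.coact a₂) fun g w => sweedler (coA.coact a'₂) fun p w' =>
    sweedler (Δ g) fun h₁ h₂ => sweedler (coA.coact w) fun d a₀ =>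
    sweedler (coA.coact w') fun q a'₀ => sweedler (Δ d) fun h₃ h₄ => sweedler (Δ q) fun r s =>
      ⟪a₁ * (h₁ ▷ a'₁) * σ h₂ p, h₃ * r, τ h₄ s⟫ ⊗ₜ[K] ⟪a₀ * a'₀, 1, 1⟫
  · conv_rhs =>
      enter [2, g, w, 2, p, w']
      simp only [sweedler_pull (coA.coact w')]
    conv_rhs =>
      enter [2, g, w]
      simp only [sweedler_pull (coA.coact w)]
    simp (disch := fun_prop) only [coA.sweedler_coact_coact]
    simp only [sweedler_pull (coA.coact a'₂)]
    refine sweedler_congr fun h' a'₀ => sweedler_congr fun h a₀ => ?_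
    conv_rhs =>
      enter [2, g, d]
      simp only [sweedler_pull (Δ g)]
    simp (disch := fun_prop) only [sweedler_coassoc]
    refine sweedler_congr fun h₁ n => sweedler_congr fun h₂ d => ?_
    simp only [sweedler_pull (Δ d)]
  · refine sweedler_congr fun g w => sweedler_congr fun p w' => sweedler_congr fun h₁ h₂ => ?_
    simp only [sweedler_pull (coA.coact w')]
    exact sweedler_congr fun q a'₀ => (C.sweedler_coactA_τ w q (fun z t a₀ =>
      ⟪a₁ * (h₁ ▷ a'₁) * σ h₂ p, z, t⟫ ⊗ₜ[K] ⟪a₀ * a'₀, 1, 1⟫)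
      (by fun_prop) (by fun_prop) (by fun_prop)).symm

/-- `Δ(bb') = Δ(b)Δ(b')`. -/
theorem comul_B_mul_comul_B (b b' : B) : D ⟪1, 1, b⟫ * D ⟪1, 1, b'⟫ = D ⟪1, 1, b * b'⟫ := by
  rw [C.comul_B, C.comul_B, C.comul_B]
  simp (disch := fun_prop) only [C.comul_mulB, C.coact_mulB, Δ₂, sweedler_sweedler, sweedler_tmul]
  simp only [sweedler_mul_sweedler]
  simp only [Algebra.TensorProduct.tmul_mul_tmul, he.mul_of_one_right hσ hτ, he.HB_mul_HB,
    tmul_sweedler_right]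
  refine sweedler_congr fun b₁ b₂ => sweedler_congr fun b'₁ b'₂ => ?_
  trans sweedler (coB.coact b₁) fun w q => sweedler (coB.coact b'₁) fun w' g =>
    sweedler (Δ g) fun h₁ h₂ => sweedler (coB.coact w) fun b₀ p =>
    sweedler (coB.coact w') fun b'₀ d => sweedler (Δ p) fun r s => sweedler (Δ d) fun h₃ h₄ =>
      ⟪1, 1, b₀ * b'₀⟫ ⊗ₜ[K] ⟪σ r h₃, s * h₄, τ q h₁ * (b₂ ◁ h₂) * b'₂⟫
  · conv_rhs =>
      enter [2, w, q, 2, w', g]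
      simp only [sweedler_pull (coB.coact w')]
    conv_rhs =>
      enter [2, w, q]
      simp only [sweedler_pull (coB.coact w)]
    simp (disch := fun_prop) only [coB.sweedler_coact_coact]
    refine sweedler_congr fun b₀ k => ?_
    simp only [sweedler_pull (coB.coact b'₁)]
    refine sweedler_congr fun b'₀ k' => ?_
    conv_rhs =>
      enter [2, d, q]
      simp only [sweedler_pull (Δ d)]
    conv_rhs =>
      enter [2, d, q, 2, r, s, 2, d', g]
      simp only [sweedler_pull (Δ d')]
    simp (disch := fun_prop) only [sweedler_coassoc]
  · refine sweedler_congr fun w q => sweedler_congr fun w' g => sweedler_congr fun h₁ h₂ => ?_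
    exact sweedler_congr fun b₀ p => (C.sweedler_coactB_σ w' p (fun b'₀ s z =>
      ⟪1, 1, b₀ * b'₀⟫ ⊗ₜ[K] ⟪s, z, τ q h₁ * (b₂ ◁ h₂) * b'₂⟫)
      (by fun_prop) (by fun_prop) (by fun_prop)).symm

end CompatibilityConditions

/-! ### The smash coproduct and products in the reverse order -/

namespace CompatibilityConditions

variable {K H A B E P : Type*} [Field K] [Ring H] [Bialgebra K H] [Ring A] [Algebra K A]
  [Coalgebra K A] [Ring B] [Algebra K B] [Coalgebra K B] [Ring E] [Algebra K E]
  [AddCommGroup P] [Module K P]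
  {coA : LeftComoduleCoalgebra K H A} {coB : RightComoduleCoalgebra K H B}
  {wA : LeftWeakAction K H A} {wB : RightWeakAction K H B}
  {σ : H →ₗ[K] H →ₗ[K] A} {τ : H →ₗ[K] H →ₗ[K] B}
  {e : A ⊗[K] (H ⊗[K] B) ≃ₗ[K] E}

local notation "Δ" => Coalgebra.comul (R := K)
local notation "⟪" a ", " x ", " b "⟫" => e (a ⊗ₜ[K] (x ⊗ₜ[K] b))
local notation:74 x:75 " ▷ " a:74 => LeftWeakAction.act wA x a
local notation:74 b:75 " ◁ " x:75 => RightWeakAction.act wB b x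
local notation "D" => smashComulLinear coA coB e

/-- The comultiplicativity of a map `z ↦ s(z₁) ⊗ m(z₂) ⊗ t(z₃)` from a coalgebra. The product of
`x, x' ∈ H` has this form, with `z = x ⊗ x'`, `s = σ`, `t = τ` and `m` the multiplication. -/
theorem comul_convolution {Q : Type*} [AddCommGroup Q] [Module K Q] [Coalgebra K Q]
    (s : Q →ₗ[K] A) (m : Q →ₗ[K] H) (t : Q →ₗ[K] B)
    (hs : ∀ z, Δ (s z) = sweedler (Δ z) fun z₁ z₂ => s z₁ ⊗ₜ[K] s z₂)
    (hm : ∀ z, Δ (m z) = sweedler (Δ z) fun z₁ z₂ => m z₁ ⊗ₜ[K] m z₂)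
    (ht : ∀ z, Δ (t z) = sweedler (Δ z) fun z₁ z₂ => t z₁ ⊗ₜ[K] t z₂)
    (hsm : ∀ z, (sweedler (Δ z) fun z₁ z₂ => sweedler (coA.coact (s z₁)) fun h c =>
      (h * m z₂) ⊗ₜ[K] c) = sweedler (Δ z) fun z₁ z₂ => m z₁ ⊗ₜ[K] s z₂)
    (htm : ∀ z, (sweedler (Δ z) fun z₁ z₂ => sweedler (coB.coact (t z₂)) fun c k =>
      c ⊗ₜ[K] (m z₁ * k)) = sweedler (Δ z) fun z₁ z₂ => t z₁ ⊗ₜ[K] m z₂)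
    (hts : ∀ z, (sweedler (Δ z) fun z₁ z₂ => t z₂ ⊗ₜ[K] s z₁) =
      sweedler (Δ z) fun z₁ z₂ => t z₁ ⊗ₜ[K] s z₂) (z : Q) :
    D (sweedler (Δ z) fun z₁ d => sweedler (Δ d) fun z₂ z₃ => ⟪s z₁, m z₂, t z₃⟫) =
      sweedler (Δ z) fun c d =>
        (sweedler (Δ c) fun z₁ d => sweedler (Δ d) fun z₂ z₃ => ⟪s z₁, m z₂, t z₃⟫) ⊗ₜ[K]
        (sweedler (Δ d) fun z₁ d => sweedler (Δ d) fun z₂ z₃ => ⟪s z₁, m z₂, t z₃⟫) := by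
  simp (disch := fun_prop) only [map_sweedler, smashComulLinear_tmul, hs, hm, ht, sweedler_sweedler,
    sweedler_tmul, sweedler_tmul_right, tmul_sweedler_right]
  trans sweedler (Δ z) fun p d => sweedler (Δ d) fun g d => sweedler (Δ d) fun g' w =>
    sweedler (Δ g) fun q u => sweedler (coA.coact (s q)) fun h c =>
    sweedler (Δ g') fun v r => sweedler (coB.coact (t r)) fun β k =>
      ⟪s p, h * m u, β⟫ ⊗ₜ[K] ⟪c, m v * k, t w⟫
  · conv_lhs =>
      enter [2, z₁, d]
      simp only [sweedler_pull (Δ z₁)]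
    conv_lhs =>
      enter [2, z₁, d, 2, x, y, 2, c, n]
      simp only [sweedler_pull (Δ n)]
    conv_lhs =>
      enter [2, z₁, d, 2, x, y, 2, c, n]
      simp only [sweedler_pull (Δ c)]
    conv_rhs =>
      enter [2, p, d, 2, g, d, 2, g', w]
      simp only [sweedler_pull (Δ g')]
    conv_rhs =>
      enter [2, p, d, 2, g, d, 2, g', w]
      simp only [sweedler_pull (Δ g)]
    conv_rhs =>
      enter [2, p, d, 2, g, d]
      simp only [sweedler_pull (Δ g)]
    simp (disch := fun_prop) only [sweedler_coassoc]
  -- Use `hsm` and `htm` on two separate inner coproducts.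
  trans sweedler (Δ z) fun p d => sweedler (Δ d) fun g d => sweedler (Δ d) fun g' w =>
    sweedler (Δ g) fun q u => sweedler (Δ g') fun v r =>
      ⟪s p, m q, t v⟫ ⊗ₜ[K] ⟪s u, m r, t w⟫
  · refine sweedler_congr fun p d => sweedler_congr fun g d => sweedler_congr fun g' w => ?_
    trans sweedler (Δ g) fun q u => sweedler (coA.coact (s q)) fun h c =>
      sweedler (Δ g') fun v r => ⟪s p, h * m u, t v⟫ ⊗ₜ[K] ⟪c, m r, t w⟫
    · refine sweedler_congr fun q u => sweedler_congr fun h c => ?_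
      have := congrArg (fun t' => sweedler t' fun β y =>
        ⟪s p, h * m u, β⟫ ⊗ₜ[K] ⟪c, y, t w⟫) (htm g')
      simpa (disch := fun_prop) only [sweedler_sweedler, sweedler_tmul] using this
    · have := congrArg (fun t' => sweedler t' fun y c => sweedler (Δ g') fun v r =>
        ⟪s p, y, t v⟫ ⊗ₜ[K] ⟪c, m r, t w⟫) (hsm g)
      simpa (disch := fun_prop) only [sweedler_sweedler, sweedler_tmul] using this
  trans sweedler (Δ z) fun p d => sweedler (Δ d) fun q d => sweedler (Δ d) fun g d =>
    sweedler (Δ d) fun r w => sweedler (Δ g) fun u v =>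
      ⟪s p, m q, t v⟫ ⊗ₜ[K] ⟪s u, m r, t w⟫
  · conv_lhs =>
      enter [2, p, d, 2, g, d]
      simp only [sweedler_pull (Δ g)]
    conv_rhs =>
      enter [2, p, d, 2, q, d, 2, g, d]
      simp only [sweedler_pull (Δ g)]
    simp (disch := fun_prop) only [sweedler_coassoc]
  -- The arguments of `s` and `t` in the middle are now adjacent, and `hts` exchanges them.
  trans sweedler (Δ z) fun p d => sweedler (Δ d) fun q d => sweedler (Δ d) fun g d =>
    sweedler (Δ d) fun r w => sweedler (Δ g) fun u v =>
      ⟪s p, m q, t u⟫ ⊗ₜ[K] ⟪s v, m r, t w⟫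
  · refine sweedler_congr fun p d => sweedler_congr fun q d => sweedler_congr fun g d =>
      sweedler_congr fun r w => ?_
    have := congrArg (fun t' => sweedler t' fun β c =>
      ⟪s p, m q, β⟫ ⊗ₜ[K] ⟪c, m r, t w⟫) (hts g)
    simpa (disch := fun_prop) only [sweedler_sweedler, sweedler_tmul] using this
  · conv_lhs =>
      enter [2, p, d, 2, q, d, 2, g, d]
      simp only [sweedler_pull (Δ g)]
    conv_rhs =>
      enter [2, c, d]
      simp only [sweedler_pull (Δ c)]
    conv_rhs =>
      enter [2, c, d, 2, z₁, c]
      simp only [sweedler_pull (Δ c)]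
    simp (disch := fun_prop) only [sweedler_coassoc]

variable (C : CompatibilityConditions coA.coact coB.coact wA.act wB.act σ τ)
include C

variable (he : IsCrossedMul wA wB σ τ e)
  (hσ : IsLeftCrossedProduct wA.act σ) (hτ : IsRightCrossedProduct wB.act τ)
include he hσ hτ

/-- `Δ(b)Δ(a) = Δ(ba)`, since `ba = a ⊗ 1 ⊗ b`. -/
theorem comul_B_mul_comul_A (b : B) (a : A) : D ⟪1, 1, b⟫ * D ⟪a, 1, 1⟫ = D ⟪a, 1, b⟫ := by
  rw [C.comul_A, C.comul_B, smashComulLinear_tmul]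
  simp only [sweedler_mul_sweedler]
  simp (disch := fun_prop) only [Algebra.TensorProduct.tmul_mul_tmul, he.B_mul_AH hσ hτ,
    he.BH_mul_A hσ hτ, sweedler_tmul_right, tmul_sweedler_right, sweedler_comul_one, mul_one,
    one_mul]
  trans sweedler (Δ a) fun a₁ a₂ => sweedler (Δ b) fun b₁ b₂ => sweedler (coA.coact a₂) fun h w =>
    sweedler (coB.coact b₁) fun v k => sweedler (coA.coact w) fun h' a₀ =>
    sweedler (coB.coact v) fun b₀ k' => ⟪a₁, h, b₀ ◁ h'⟫ ⊗ₜ[K] ⟪k' ▷ a₀, k, b₂⟫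
  · conv_rhs =>
      enter [2, a₁, a₂, 2, b₁, b₂]
      enter [2, h, w]
      simp only [sweedler_pull (coA.coact w)]
    simp (disch := fun_prop) only [coA.sweedler_coact_coact]
    conv_rhs =>
      enter [2, a₁, a₂, 2, b₁, b₂, 2, h, a₀, 2, h₁, h₂]
      simp (disch := fun_prop) only [coB.sweedler_coact_coact]
    simp only [sweedler_pull (Δ b)]
    refine sweedler_congr fun b₁ b₂ => sweedler_congr fun a₁ a₂ => ?_
    simp only [sweedler_pull (coB.coact b₁)]
    refine sweedler_congr fun b₀ k => sweedler_congr fun h a₀ => ?_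
    simp only [sweedler_pull (Δ k)]
  · refine sweedler_congr fun a₁ a₂ => ?_
    simp only [sweedler_pull (coA.coact a₂)]
    exact sweedler_congr fun h w => sweedler_congr fun b₁ b₂ => sweedler_congr fun v k =>
      C.sweedler_double w v (fun a b => ⟪a₁, h, b⟫ ⊗ₜ[K] ⟪a, k, b₂⟫) (by fun_prop) (by fun_prop)

/-- `Δ(x)Δ(a) = Δ(xa)`. -/
theorem comul_H_mul_comul_A (x : H) (a : A) :
    D ⟪1, x, 1⟫ * D ⟪a, 1, 1⟫ = D (⟪1, x, 1⟫ * ⟪a, 1, 1⟫) := by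
  rw [he.H_mul_A hσ hτ, C.comul_H, C.comul_A]
  simp only [sweedler_mul, mul_sweedler]
  simp (disch := fun_prop) only [Algebra.TensorProduct.tmul_mul_tmul, he.H_mul_A hσ hτ,
    he.AH_mul_AH, one_mul, sweedler_tmul_right, tmul_sweedler_right, map_sweedler,
    smashComulLinear_tmul, C.comul_actA, mul_one, C.comul_oneB, C.coact_oneB, Δ₂, Δ₃,
    sweedler_sweedler, sweedler_tmul]
  simp only [sweedler_pull (Δ a)]
  refine sweedler_congr fun a₁ a₂ => ?_
  simp only [sweedler_pull (coA.coact a₂)]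
  trans sweedler (coA.coact a₂) fun h w => sweedler (Δ h) fun h₁ h₂ =>
    sweedler (Δ x) fun x₁ d => sweedler (Δ d) fun x₂ d => sweedler (Δ d) fun x₃ d =>
    sweedler (Δ d) fun g x₆ => sweedler (coA.coact w) fun h₃ a₀ => sweedler (Δ g) fun x₄ x₅ =>
      ⟪(x₁ ▷ a₁) * σ x₂ h₁, x₃ * h₂, τ x₄ h₃⟫ ⊗ₜ[K] ⟪x₅ ▷ a₀, x₆, 1⟫
  · conv_rhs =>
      enter [2, h, w]
      simp only [sweedler_pull (coA.coact w)]
    simp (disch := fun_prop) only [coA.sweedler_coact_coact]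
    refine sweedler_congr fun h a₀ => ?_
    simp only [sweedler_pull (Δ x)]
    conv_lhs =>
      enter [2, y, z]
      simp only [sweedler_pull (Δ y)]
    conv_lhs =>
      enter [2, y, z, 2, x₁, d]
      simp only [sweedler_pull (Δ d)]
    conv_lhs =>
      enter [2, y, z, 2, x₁, d, 2, x₂, d]
      simp only [sweedler_pull (Δ d)]
    simp only [sweedler_pull (Δ h)]
    conv_lhs =>
      enter [2, h₁, d]
      simp only [sweedler_pull (Δ d)]
    conv_rhs =>
      enter [2, d, h₃]
      simp only [sweedler_pull (Δ d)]
    simp (disch := fun_prop) only [sweedler_coassoc]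
  -- Remove `τ` by the exchange condition for `x` and `a`.
  trans sweedler (coA.coact a₂) fun h w => sweedler (Δ h) fun h₁ h₂ =>
    sweedler (Δ x) fun x₁ d => sweedler (Δ d) fun x₂ d => sweedler (Δ d) fun x₃ d =>
    sweedler (Δ d) fun x₄ x₅ => ⟪(x₁ ▷ a₁) * σ x₂ h₁, x₃ * h₂, 1⟫ ⊗ₜ[K] ⟪x₄ ▷ w, x₅, 1⟫
  · exact sweedler_congr fun h w => sweedler_congr fun h₁ h₂ => sweedler_congr fun x₁ d =>
      sweedler_congr fun x₂ d => sweedler_congr fun x₃ d => sweedler_congr fun g x₆ =>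
      C.sweedler_τ_actA hσ hτ g w (fun t c =>
        ⟪(x₁ ▷ a₁) * σ x₂ h₁, x₃ * h₂, t⟫ ⊗ₜ[K] ⟪c, x₆, 1⟫) (by fun_prop) (by fun_prop)
  trans sweedler (coA.coact a₂) fun h a₀ =>
    sweedler (Δ x) fun x₁ d => sweedler (Δ d) fun x₂ d => sweedler (Δ d) fun g x₅ =>
    sweedler (Δ g) fun x₃ x₄ => sweedler (coA.coact a₀) fun h' c =>
      ⟪(x₁ ▷ a₁) * σ x₂ h, x₃ * h', 1⟫ ⊗ₜ[K] ⟪x₄ ▷ c, x₅, 1⟫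
  · conv_rhs =>
      enter [2, h, a₀]
      simp only [sweedler_pull (coA.coact a₀)]
    simp (disch := fun_prop) only [coA.sweedler_coact_coact, sweedler_coassoc]
  -- The coaction of `x ▷ a`.
  trans sweedler (coA.coact a₂) fun h a₀ =>
    sweedler (Δ x) fun x₁ d => sweedler (Δ d) fun x₂ d => sweedler (Δ d) fun g x₅ =>
    sweedler (Δ g) fun x₃ x₄ => sweedler (coA.coact (x₃ ▷ a₀)) fun h' c =>
      ⟪(x₁ ▷ a₁) * σ x₂ h, h' * x₄, 1⟫ ⊗ₜ[K] ⟪c, x₅, 1⟫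
  · exact sweedler_congr fun h a₀ => sweedler_congr fun x₁ d =>
      sweedler_congr fun x₂ d => sweedler_congr fun g x₅ => (C.sweedler_coact_actA g a₀ (fun y c =>
        ⟪(x₁ ▷ a₁) * σ x₂ h, y, 1⟫ ⊗ₜ[K] ⟪c, x₅, 1⟫) (by fun_prop) (by fun_prop)).symm
  · refine sweedler_congr fun h a₀ => ?_
    conv_rhs =>
      enter [2, y, z, 2, x₁, d, 2, x₂, c]
      simp only [sweedler_pull (Δ z)]
    simp (disch := fun_prop) only [sweedler_coassoc]

/-- `Δ(b)Δ(x) = Δ(bx)`. -/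
theorem comul_B_mul_comul_H (b : B) (x : H) :
    D ⟪1, 1, b⟫ * D ⟪1, x, 1⟫ = D (⟪1, 1, b⟫ * ⟪1, x, 1⟫) := by
  rw [he.B_mul_H hσ hτ, C.comul_H, C.comul_B]
  simp only [sweedler_mul, mul_sweedler]
  simp (disch := fun_prop) only [Algebra.TensorProduct.tmul_mul_tmul, he.B_mul_H hσ hτ,
    he.HB_mul_HB, mul_one, sweedler_tmul_right, tmul_sweedler_right, map_sweedler,
    smashComulLinear_tmul, C.comul_actB, one_mul, C.comul_oneA, C.coact_oneA, Δ₂, Δ₃,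
    sweedler_sweedler, sweedler_tmul]
  simp only [sweedler_pull (Δ b)]
  refine sweedler_congr fun b₁ b₂ => ?_
  simp only [sweedler_pull (coB.coact b₁)]
  trans sweedler (coB.coact b₁) fun v k => sweedler (Δ k) fun k₂ k₃ =>
    sweedler (Δ x) fun x₁ d => sweedler (Δ d) fun g d => sweedler (Δ d) fun x₄ d =>
    sweedler (Δ d) fun x₅ x₆ => sweedler (coB.coact v) fun b₀ k₁ => sweedler (Δ g) fun x₂ x₃ =>
      ⟪1, x₁, b₀ ◁ x₂⟫ ⊗ₜ[K] ⟪σ k₁ x₃, k₂ * x₄, τ k₃ x₅ * (b₂ ◁ x₆)⟫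
  · conv_rhs =>
      enter [2, v, k]
      simp only [sweedler_pull (coB.coact v)]
    simp (disch := fun_prop) only [coB.sweedler_coact_coact]
    refine sweedler_congr fun b₀ k => ?_
    conv_lhs =>
      enter [2, y, z]
      simp only [sweedler_pull (Δ y)]
    simp only [sweedler_pull (Δ k)]
    conv_lhs =>
      enter [2, k₁, d]
      simp only [sweedler_pull (Δ d)]
    conv_rhs =>
      enter [2, k₁, d, 2, k₂, k₃, 2, x₁, d, 2, g, d]
      simp only [sweedler_pull (Δ g)]
    simp (disch := fun_prop) only [sweedler_coassoc]
  -- Remove `σ` by the exchange condition for `b` and `x`.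
  trans sweedler (coB.coact b₁) fun v k => sweedler (Δ k) fun k₂ k₃ =>
    sweedler (Δ x) fun x₁ d => sweedler (Δ d) fun x₂ d => sweedler (Δ d) fun x₃ d =>
    sweedler (Δ d) fun x₄ x₅ => ⟪1, x₁, v ◁ x₂⟫ ⊗ₜ[K] ⟪1, k₂ * x₃, τ k₃ x₄ * (b₂ ◁ x₅)⟫
  · exact sweedler_congr fun v k => sweedler_congr fun k₂ k₃ => sweedler_congr fun x₁ d =>
      sweedler_congr fun g d => sweedler_congr fun x₄ d => sweedler_congr fun x₅ x₆ =>
      C.sweedler_σ_actB hσ hτ v g (fun c s =>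
        ⟪1, x₁, c⟫ ⊗ₜ[K] ⟪s, k₂ * x₄, τ k₃ x₅ * (b₂ ◁ x₆)⟫) (by fun_prop) (by fun_prop)
  trans sweedler (coB.coact b₁) fun b₀ k =>
    sweedler (Δ x) fun x₁ d => sweedler (Δ d) fun g d => sweedler (Δ d) fun x₄ x₅ =>
    sweedler (Δ g) fun x₂ x₃ => sweedler (coB.coact b₀) fun c k' =>
      ⟪1, x₁, c ◁ x₂⟫ ⊗ₜ[K] ⟪1, k' * x₃, τ k x₄ * (b₂ ◁ x₅)⟫
  · conv_rhs =>
      enter [2, b₀, k]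
      simp only [sweedler_pull (coB.coact b₀)]
    simp (disch := fun_prop) only [coB.sweedler_coact_coact]
    refine sweedler_congr fun b₀ k => sweedler_congr fun k₁ k₂ => sweedler_congr fun x₁ d => ?_
    conv_rhs =>
      enter [2, g, d]
      simp only [sweedler_pull (Δ g)]
    simp (disch := fun_prop) only [sweedler_coassoc]
  -- The coaction of `b ◁ x`.
  trans sweedler (coB.coact b₁) fun b₀ k =>
    sweedler (Δ x) fun x₁ d => sweedler (Δ d) fun g d => sweedler (Δ d) fun x₄ x₅ =>
    sweedler (Δ g) fun x₂ x₃ => sweedler (coB.coact (b₀ ◁ x₃)) fun c k' =>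
      ⟪1, x₁, c⟫ ⊗ₜ[K] ⟪1, x₂ * k', τ k x₄ * (b₂ ◁ x₅)⟫
  · exact sweedler_congr fun b₀ k => sweedler_congr fun x₁ d =>
      sweedler_congr fun g d => sweedler_congr fun x₄ x₅ => (C.sweedler_coact_actB b₀ g (fun c y =>
        ⟪1, x₁, c⟫ ⊗ₜ[K] ⟪1, y, τ k x₄ * (b₂ ◁ x₅)⟫) (by fun_prop) (by fun_prop)).symm
  · refine sweedler_congr fun b₀ k => ?_
    conv_lhs =>
      enter [2, x₁, d, 2, g, d]
      simp only [sweedler_pull (Δ g)]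
    simp (disch := fun_prop) only [sweedler_coassoc]

end CompatibilityConditions

/-! ### Multiplicativity of the smash coproduct -/

namespace CompatibilityConditions

variable {K H A B E P : Type*} [Field K] [Ring H] [Bialgebra K H] [Ring A] [Algebra K A]
  [Coalgebra K A] [Ring B] [Algebra K B] [Coalgebra K B] [Ring E] [Algebra K E]
  [AddCommGroup P] [Module K P]
  {coA : LeftComoduleCoalgebra K H A} {coB : RightComoduleCoalgebra K H B}
  {wA : LeftWeakAction K H A} {wB : RightWeakAction K H B}
  {σ : H →ₗ[K] H →ₗ[K] A} {τ : H →ₗ[K] H →ₗ[K] B}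
  {e : A ⊗[K] (H ⊗[K] B) ≃ₗ[K] E}

local notation "Δ" => Coalgebra.comul (R := K)
local notation "ε" => Coalgebra.counit (R := K)
local notation "⟪" a ", " x ", " b "⟫" => e (a ⊗ₜ[K] (x ⊗ₜ[K] b))
local notation "D" => smashComulLinear coA coB e

variable (C : CompatibilityConditions coA.coact coB.coact wA.act wB.act σ τ)
include C

variable (he : IsCrossedMul wA wB σ τ e)
  (hσ : IsLeftCrossedProduct wA.act σ) (hτ : IsRightCrossedProduct wB.act τ)
include he hσ hτ

omit hσ hτ in
/-- `Δ(x)Δ(x') = Δ(xx')`. -/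
theorem comul_H_mul_comul_H (x x' : H) :
    D ⟪1, x, 1⟫ * D ⟪1, x', 1⟫ = D (⟪1, x, 1⟫ * ⟪1, x', 1⟫) := by
  have h := comul_convolution (coA := coA) (coB := coB) (e := e) (TensorProduct.lift σ)
    (LinearMap.mul' K H) (TensorProduct.lift τ) ?_ ?_ ?_ ?_ ?_ ?_ (x ⊗ₜ x')
  · simp (disch := fun_prop) only [sweedler_comul_tmul, TensorProduct.lift.tmul,
      LinearMap.mul'_apply] at h
    have mul : ∀ x x' : H, ⟪1, x, 1⟫ * ⟪1, x', 1⟫ =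
        sweedler (Δ x) fun x₁ d => sweedler (Δ x') fun y₁ d' => sweedler (Δ d) fun x₂ x₃ =>
        sweedler (Δ d') fun y₂ y₃ => ⟪σ x₁ y₁, x₂ * y₂, τ x₃ y₃⟫ := by
      intro x x'
      rw [he.H_mul_H]
      refine sweedler_congr fun x₁ d => ?_
      simp only [sweedler_pull (Δ x')]
    rw [C.comul_H, C.comul_H]
    simp only [sweedler_mul_sweedler, Algebra.TensorProduct.tmul_mul_tmul, mul]
    exact h.symm
  all_goals intro z; apply eq_of_tmul z <;> [fun_prop; fun_prop; intro y y']
  all_goals simp (disch := fun_prop) only [sweedler_comul_tmul, TensorProduct.lift.tmul,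
    LinearMap.mul'_apply]
  · exact C.comul_σ y y'
  · rw [← sweedler_comul_mul y y' (fun a b => a ⊗ₜ[K] b) (by fun_prop) (by fun_prop),
      sweedler_tmul_eq]
  · exact C.comul_τ y y'
  · exact C.sweedler_coact_σ y y' (fun h c => h ⊗ₜ c) (by fun_prop) (by fun_prop)
  · exact C.coact_τ y y'
  · exact C.sweedler_τ_σ y y' (fun b a => b ⊗ₜ a) (by fun_prop) (by fun_prop)

theorem comul_mul_B (v : E) (b : B) : D (v * ⟪1, 1, b⟫) = D v * D ⟪1, 1, b⟫ := by
  have : (D) ∘ₗ LinearMap.mulRight K ⟪1, 1, b⟫ = LinearMap.mulRight K (D ⟪1, 1, b⟫) ∘ₗ D := by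
    refine eq_of_tmul_tmul (e := e) fun a x b' => ?_
    simp only [LinearMap.comp_apply, LinearMap.mulRight_apply]
    rw [he.mul_of_one_right hσ hτ, C.comul_mul_comul_mul_comul he hσ hτ a x (b' * b),
      C.comul_mul_comul_mul_comul he hσ hτ a x b', ← C.comul_B_mul_comul_B he hσ hτ]
    simp only [mul_assoc]
  exact DFunLike.congr_fun this v

theorem comul_A_mul (a : A) (v : E) : D (⟪a, 1, 1⟫ * v) = D ⟪a, 1, 1⟫ * D v := by
  have : (D) ∘ₗ LinearMap.mulLeft K ⟪a, 1, 1⟫ = LinearMap.mulLeft K (D ⟪a, 1, 1⟫) ∘ₗ D := by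
    refine eq_of_tmul_tmul (e := e) fun a' x b => ?_
    simp only [LinearMap.comp_apply, LinearMap.mulLeft_apply]
    rw [he.mul_of_one_left hσ hτ, C.comul_mul_comul_mul_comul he hσ hτ (a * a') x b,
      C.comul_mul_comul_mul_comul he hσ hτ a' x b, ← C.comul_A_mul_comul_A he hσ hτ]
    simp only [mul_assoc]
  exact DFunLike.congr_fun this v

/-- The factor `x` is moved past `a` by `x a = (x₁ ▷ a) x₂`, and is then multiplied with `x'`. -/
theorem comul_H_mul (x : H) (v : E) : D (⟪1, x, 1⟫ * v) = D ⟪1, x, 1⟫ * D v := by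
  have : (D) ∘ₗ LinearMap.mulLeft K ⟪1, x, 1⟫ = LinearMap.mulLeft K (D ⟪1, x, 1⟫) ∘ₗ D := by
    refine eq_of_tmul_tmul (e := e) fun a x' b => ?_
    simp only [LinearMap.comp_apply, LinearMap.mulLeft_apply]
    have h : D (⟪1, x, 1⟫ * ⟪a, 1, 1⟫ * ⟪1, x', 1⟫) =
        D ⟪1, x, 1⟫ * D ⟪a, 1, 1⟫ * D ⟪1, x', 1⟫ := by
      rw [C.comul_H_mul_comul_A he hσ hτ, he.H_mul_A hσ hτ]
      simp only [sweedler_mul, map_sweedler]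
      refine sweedler_congr fun x₁ x₂ => ?_
      rw [← C.comul_A_mul_comul_H he hσ hτ, mul_assoc, C.comul_H_mul_comul_H he,
        ← C.comul_A_mul he hσ hτ, ← mul_assoc, he.mul_of_one_left hσ hτ, mul_one]
    rw [C.comul_mul_comul_mul_comul he hσ hτ a x' b, ← he.A_mul_H_mul_B hσ hτ a x' b, ← mul_assoc,
      ← mul_assoc, C.comul_mul_B he hσ hτ, h]
    simp only [mul_assoc]
  exact DFunLike.congr_fun this v

/-- The factor `b` is moved past `a` by `b a = a b`, and is then multiplied with `x`. -/
theorem comul_B_mul (b : B) (v : E) : D (⟪1, 1, b⟫ * v) = D ⟪1, 1, b⟫ * D v := by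
  have : (D) ∘ₗ LinearMap.mulLeft K ⟪1, 1, b⟫ = LinearMap.mulLeft K (D ⟪1, 1, b⟫) ∘ₗ D := by
    refine eq_of_tmul_tmul (e := e) fun a x b' => ?_
    simp only [LinearMap.comp_apply, LinearMap.mulLeft_apply]
    have hab : ⟪a, 1, b⟫ = ⟪a, 1, 1⟫ * ⟪1, 1, b⟫ := by
      rw [he.mul_of_one_left hσ hτ, mul_one]
    have h : D (⟪1, 1, b⟫ * ⟪a, 1, 1⟫ * ⟪1, x, 1⟫) =
        D ⟪1, 1, b⟫ * D ⟪a, 1, 1⟫ * D ⟪1, x, 1⟫ := by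
      rw [C.comul_B_mul_comul_A he hσ hτ, he.B_mul_A hσ hτ, hab, mul_assoc,
        C.comul_A_mul he hσ hτ, C.comul_A_mul he hσ hτ, ← C.comul_B_mul_comul_H he hσ hτ, mul_assoc]
    rw [C.comul_mul_comul_mul_comul he hσ hτ a x b', ← he.A_mul_H_mul_B hσ hτ a x b', ← mul_assoc,
      ← mul_assoc, C.comul_mul_B he hσ hτ, h]
    simp only [mul_assoc]
  exact DFunLike.congr_fun this v

/-- Every element of `E` is a sum of products `a x b`, so left multiplicativity for the three
factors suffices. -/
theorem comul_mul (u v : E) : D (u * v) = D u * D v := by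
  have : (D) ∘ₗ LinearMap.mulRight K v = LinearMap.mulRight K (D v) ∘ₗ D := by
    refine eq_of_tmul_tmul (e := e) fun a x b => ?_
    simp only [LinearMap.comp_apply, LinearMap.mulRight_apply]
    rw [C.comul_mul_comul_mul_comul he hσ hτ a x b, ← he.A_mul_H_mul_B hσ hτ a x b]
    simp only [mul_assoc]
    rw [C.comul_A_mul he hσ hτ, C.comul_H_mul he hσ hτ, C.comul_B_mul he hσ hτ]
  exact DFunLike.congr_fun this u

end CompatibilityConditions

section Counit

variable {K H A B E : Type*} [Field K] [Ring H] [Bialgebra K H] [Ring A] [Algebra K A]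
  [Coalgebra K A] [Ring B] [Algebra K B] [Coalgebra K B] [Ring E] [Algebra K E]
  {wA : LeftWeakAction K H A} {wB : RightWeakAction K H B}
  {σ : H →ₗ[K] H →ₗ[K] A} {τ : H →ₗ[K] H →ₗ[K] B}
  {e : A ⊗[K] (H ⊗[K] B) ≃ₗ[K] E}

/-- The counit factors as `ε_A` after `projA`, for which products have been computed. -/
theorem smashCounitLinear_mul (he : IsCrossedMul wA wB σ τ e) (hA : LeftCounital wA σ)
    (hB : RightCounital wB τ) (u v : E) :
    smashCounitLinear e (u * v) = smashCounitLinear e u * smashCounitLinear e v := by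
  have hp : smashCounitLinear e = Coalgebra.counit (R := K) ∘ₗ projA e := by
    refine eq_of_tmul_tmul (e := e) fun a x b => ?_
    simp only [smashCounitLinear_tmul, LinearMap.comp_apply, projA_tmul, map_smul, smul_eq_mul]
    ring
  have : smashCounitLinear e ∘ₗ LinearMap.mulRight K v =
      LinearMap.mulRight K (smashCounitLinear e v) ∘ₗ smashCounitLinear e := by
    refine eq_of_tmul_tmul (e := e) fun a x b => ?_
    have : smashCounitLinear e ∘ₗ LinearMap.mulLeft K (e (a ⊗ₜ[K] (x ⊗ₜ[K] b))) =
        LinearMap.mulLeft K (smashCounitLinear e (e (a ⊗ₜ[K] (x ⊗ₜ[K] b)))) ∘ₗ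
          smashCounitLinear e := by
      refine eq_of_tmul_tmul (e := e) fun a' x' b' => ?_
      simp only [LinearMap.comp_apply, LinearMap.mulLeft_apply, smashCounitLinear_tmul]
      rw [hp, LinearMap.comp_apply, projA_mul he hB]
      simp only [map_smul, map_sweedler, hA.counit_mul, hA.counit_act, hA.counit_cocycle]
      have h := sweedler_counit_left (K := K) x (fun y => (Coalgebra.counit (R := K) a *
        Coalgebra.counit (R := K) a' * Coalgebra.counit (R := K) x') *
        Coalgebra.counit (R := K) y) (by fun_prop)
      trans Coalgebra.counit (R := K) b • Coalgebra.counit (R := K) b' •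
        ((Coalgebra.counit (R := K) a * Coalgebra.counit (R := K) a' *
          Coalgebra.counit (R := K) x') * Coalgebra.counit (R := K) x)
      · rw [← h]
        refine congrArg _ (congrArg _ (sweedler_congr fun _ _ => ?_))
        rw [smul_eq_mul]
        ring
      · simp only [smul_eq_mul]
        ring
    exact DFunLike.congr_fun this v
  exact DFunLike.congr_fun this u

end Counit

/-! ### The characterization of biproducts -/

/-- The smash coproduct of the statement, transported along `e`, is `smashComulLinear`. -/
theorem map_smashComul {K H A B E : Type*} [Field K] [Ring H] [Bialgebra K H] [AddCommGroup A]
    [Module K A] [Coalgebra K A] [AddCommGroup B] [Module K B] [Coalgebra K B] [AddCommGroup E]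
    [Module K E] (coA : LeftComoduleCoalgebra K H A) (coB : RightComoduleCoalgebra K H B)
    (e : A ⊗[K] (H ⊗[K] B) ≃ₗ[K] E) (a : A) (x : H) (b : B) :
    TensorProduct.map e.toLinearMap e.toLinearMap (smashComul coA.coact coB.coact a x b) =
      smashComulLinear coA coB e (e (a ⊗ₜ[K] (x ⊗ₜ[K] b))) := by
  rw [smashComulLinear_tmul]
  simp only [smashComul, Δ₂, map_sweedler, TensorProduct.map_tmul, LinearEquiv.coe_coe]

section Main

variable {K : Type u₁} {H : Type u₂} {A : Type u₃} {B : Type u₄}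
    [Field K] [Ring H] [Bialgebra K H]
    [Ring A] [Algebra K A] [Coalgebra K A] [Ring B] [Algebra K B] [Coalgebra K B]
    {coA : LeftComoduleCoalgebra K H A} {coB : RightComoduleCoalgebra K H B}
    {wA : LeftWeakAction K H A} {wB : RightWeakAction K H B}
    {σ : H →ₗ[K] H →ₗ[K] A} {τ : H →ₗ[K] H →ₗ[K] B}
    (hσ : IsLeftCrossedProduct wA.act σ) (hτ : IsRightCrossedProduct wB.act τ)
include hσ hτ

theorem CompatibilityConditions.isDoubleCrossedBiproduct_of_isCrossedMul
    (C : CompatibilityConditions coA.coact coB.coact wA.act wB.act σ τ)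
    (hA : LeftCounital wA σ) (hB : RightCounital wB τ)
    {E : Type (max u₂ u₃ u₄)} [Ring E] [Algebra K E] (e : A ⊗[K] (H ⊗[K] B) ≃ₗ[K] E)
    (he : IsCrossedMul wA wB σ τ e) (h1 : e (1 ⊗ₜ[K] (1 ⊗ₜ[K] 1)) = 1) :
    IsDoubleCrossedBiproduct coA.coact coB.coact wA.act wB.act σ τ := by
  let _ := smashCoalgebra coA coB e
  refine ⟨E, inferInstance, Bialgebra.mk' K E ?_ ?_ ?_ ?_, e, he, h1,
    fun a x b => (map_smashComul coA coB e a x b).symm, fun a x b => smashCounitLinear_tmul e a x b⟩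
  · change smashCounitLinear e 1 = 1
    rw [← h1, smashCounitLinear_tmul, C.counit_algA.1, C.counit_algB.1, Bialgebra.counit_one,
      mul_one, mul_one]
  · exact smashCounitLinear_mul he hA hB _ _
  · change smashComulLinear coA coB e 1 = 1
    rw [← h1, C.comul_H]
    simp (disch := fun_prop) only [sweedler_comul_one, Algebra.TensorProduct.one_def]
    rw [h1]
  · exact C.comul_mul he hσ hτ _ _

theorem CompatibilityConditions.isDoubleCrossedBiproduct
    (C : CompatibilityConditions coA.coact coB.coact wA.act wB.act σ τ)
    (hεσ : ∀ x x' : H, Coalgebra.counit (R := K) (σ x x') =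
      Coalgebra.counit (R := K) x * Coalgebra.counit (R := K) x')
    (hετ : ∀ x x' : H, Coalgebra.counit (R := K) (τ x x') =
      Coalgebra.counit (R := K) x * Coalgebra.counit (R := K) x') :
    IsDoubleCrossedBiproduct coA.coact coB.coact wA.act wB.act σ τ := by
  have he : IsCrossedMul (E := twoSidedCrossedProduct hσ hτ) wA wB σ τ
    (toTwoSidedCrossedProduct hσ hτ) := toTwoSidedCrossedProduct_mul hσ hτ
  exact C.isDoubleCrossedBiproduct_of_isCrossedMul hσ hτ ⟨C.counit_algA.2, C.counit_actA, hεσ⟩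
    ⟨C.counit_algB.2, C.counit_actB, hετ⟩ (E := twoSidedCrossedProduct hσ hτ)
    (toTwoSidedCrossedProduct hσ hτ) he (toTwoSidedCrossedProduct_one hσ hτ)

theorem IsDoubleCrossedBiproduct.compatibilityConditions
    (hE : IsDoubleCrossedBiproduct coA.coact coB.coact wA.act wB.act σ τ)
    (hA₁ : Coalgebra.counit (R := K) (1 : A) = 1)
    (hB₁ : Coalgebra.counit (R := K) (1 : B) = 1)
    (hεσ : ∀ x x' : H, Coalgebra.counit (R := K) (σ x x') =
      Coalgebra.counit (R := K) x * Coalgebra.counit (R := K) x')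
    (hετ : ∀ x x' : H, Coalgebra.counit (R := K) (τ x x') =
      Coalgebra.counit (R := K) x * Coalgebra.counit (R := K) x') :
    CompatibilityConditions coA.coact coB.coact wA.act wB.act σ τ := by
  obtain ⟨E, _, _, e, hmul, hone, hcomul, hcounit⟩ := hE
  have hE : IsBiproduct coA coB wA wB σ τ e :=
    { mul := hmul
      one := hone
      comul := eq_of_tmul_tmul (e := e) fun a x b =>
        (hcomul a x b).trans (map_smashComul coA coB e a x b)
      counit := eq_of_tmul_tmul (e := e) fun a x b => by
        rw [hcounit, smashCounitLinear_tmul] }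
  have hA := hE.leftCounital hσ hτ hA₁ hB₁ hεσ
  have hB := hE.rightCounital hσ hτ hA₁ hB₁ hετ
  exact
    { counit_algA := ⟨hA₁, hA.counit_mul⟩
      counit_algB := ⟨hB₁, hB.counit_mul⟩
      comul_oneA := hE.comul_oneA hB₁
      comul_oneB := hE.comul_oneB hA₁
      coact_oneA := hE.coact_oneA hA₁ hB₁
      coact_oneB := hE.coact_oneB hA₁ hB₁
      counit_actA := hA.counit_act
      counit_actB := hB.counit_act
      twisted_comoduleA := hE.twisted_comoduleA hB hA₁ hB₁ hσ hτ
      twisted_comoduleB := hE.twisted_comoduleB hA hA₁ hB₁ hσ hτ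
      comul_mulA := hE.comul_mulA hB hA₁ hB₁ hσ hτ
      coact_mulA := hE.coact_mulA hA hB hA₁ hB₁ hσ hτ
      comul_mulB := hE.comul_mulB hA hA₁ hB₁ hσ hτ
      coact_mulB := hE.coact_mulB hA hB hA₁ hB₁ hσ hτ
      coact_σ := hE.coact_σ hA hB hA₁ hB₁
      comul_σ := hE.comul_σ hB hA₁ hB₁
      coact_τ := hE.coact_τ hA hB hA₁ hB₁
      comul_τ := hE.comul_τ hA hA₁ hB₁
      comul_actA := hE.comul_actA hB hA₁ hB₁ hσ hτ
      coact_actA := hE.coact_actA hA hB hA₁ hB₁ hσ hτ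
      coact_actB := hE.coact_actB hA hB hA₁ hB₁ hσ hτ
      comul_actB := hE.comul_actB hA hA₁ hB₁ hσ hτ
      coactA_τ := hE.coactA_τ hA hB hA₁ hB₁ hσ hτ
      coactB_σ := hE.coactB_σ hA hB hA₁ hB₁ hσ hτ
      double := hE.double hA hB hA₁ hB₁ hσ hτ
      exchange := hE.exchange hA hB hA₁ hB₁ hσ hτ }

end Main

end DoubleCrossed

theorem theorem3p2 {K : Type u₁} {H : Type u₂} {A : Type u₃} {B : Type u₄}
    [Field K] [Ring H] [Bialgebra K H]
    [Ring A] [Algebra K A] [Coalgebra K A] [Ring B] [Algebra K B] [Coalgebra K B]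
    (coA : DoubleCrossed.LeftComoduleCoalgebra K H A)
    (coB : DoubleCrossed.RightComoduleCoalgebra K H B)
    (wA : DoubleCrossed.LeftWeakAction K H A)
    (wB : DoubleCrossed.RightWeakAction K H B)
    (σ : H →ₗ[K] H →ₗ[K] A) (τ : H →ₗ[K] H →ₗ[K] B)
    (hσ : DoubleCrossed.IsLeftCrossedProduct wA.act σ)
    (hτ : DoubleCrossed.IsRightCrossedProduct wB.act τ)
    (hA : Coalgebra.counit (R := K) (1 : A) = 1)
    (hB : Coalgebra.counit (R := K) (1 : B) = 1)
    (hεσ : ∀ x x' : H, Coalgebra.counit (R := K) (σ x x') =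
      Coalgebra.counit (R := K) x * Coalgebra.counit (R := K) x')
    (hετ : ∀ x x' : H, Coalgebra.counit (R := K) (τ x x') =
      Coalgebra.counit (R := K) x * Coalgebra.counit (R := K) x') :
    DoubleCrossed.IsDoubleCrossedBiproduct coA.coact coB.coact wA.act wB.act σ τ ↔
      DoubleCrossed.CompatibilityConditions coA.coact coB.coact wA.act wB.act σ τ :=
  ⟨fun h => h.compatibilityConditions hσ hτ hA hB hεσ hετ,
    fun C => C.isDoubleCrossedBiproduct hσ hτ hεσ hετ⟩
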